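/- Let $c\ge 1$ be real, let $T_c(x,y)=\big(cx+(c-1)y+1,\,(c+1)x+cy+1\big)$, and put $P_k=T_c^k(0,0)$ for $k\in\mathbb Z$. Let $Q_c^+$ be the convex hull of $\{P_k : k\in\mathbb Z\}$ and $Q_c^-=-Q_c^+$. Let $S_c$ be the translation surface obtained from the disjoint union of $Q_c^+$ and $Q_c^-$ by gluing, for every $k\in\mathbb Z$, the edge $[P_k,P_{k+1}]$ of $Q_c^+$ to the edge $[-P_{k+1},-P_k]$ of $Q_c^-$ by the translation $z\mapsto z-P_k-P_{k+1}$. The points represented by the vertices are the cone singularities of $S_c$. Let $\mathrm{Aut}(S_c)$ be the group of homeomorphisms $f:S_c\to S_c$ that preserve the set of cone singularities and for which there is $A\in GL(2,\mathbb R)$ such that $f$ has the form $z\mapsto Az+\mathrm{const}$ in the local translation charts of the complement of the singularities; this $A$ is unique and is written $\mathbf D(f)$. Let $\Gamma(S_c)=\mathbf D(\mathrm{Aut}(S_c))\subset GL(2,\mathbb R)$ be the Veech group. A cylinder in direction $u\in\mathbb R^2\setminus\{0\}$ is an open subset of $S_c$, free of singularities, that is isometric, by a map preserving directions, to the quotient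 of an open strip parallel to $u$ by a translation $z\mapsto z+wu$ with $w>0$; it is maximal if no larger cylinder in direction $u$ contains it. The single right Dehn twist of a cylinder moves each point at relative height $t\in(0,1)$ (measured from the boundary component on the right of the direction $u$ to the one on its left) in the direction $u$ by $t$ times the circumference. Then the kernel of the homomorphism $\mathbf D:\mathrm{Aut}(S_c)\to\Gamma(S_c)$ is trivial. Moreover, in each of the directions $(1,0)$ and $(1,1)$ the surface $S_c$ decomposes into maximal cylinders (they are pairwise disjoint and their closures cover $S_c$), and $\mathrm{Aut}(S_c)$ contains, and is generated by, the following four elements: \begin{itemize} \item $\widehat{-I}_c$, which swaps the two pieces $Q_c^+$ and $Q_c^-$ by the rotation $z\mapsto -z$; \item $\hat A_c$, which preserves each of the pieces $Q_c^+$ and $Q_c^-$ and acts on both by the reflection $(x,y)\mapsto(-x,y)$; \item $\hat D_c$, which maps every maximal horizontal cylinder to itself and acts on it as a single right Dehn twist; \item $\hat E_c$, which maps every maximal cylinder of slope $1$ to itself and acts on it as a single right Dehn twist. \end{itemize} -/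

import Mathlib

open Set Filter Topology

/-- The plane `ℝ²`; a vector `z` has the coordinates `z 0` (horizontal) and `z 1` (vertical). -/
abbrev Plane : Type := Fin 2 → ℝ

namespace HooperSurface

noncomputable section

/-- The affine map `T_c (x, y) = (c x + (c - 1) y + 1, (c + 1) x + c y + 1)`, as a bijection. -/
def T (c : ℝ) : Equiv.Perm Plane where
  toFun z := ![c * z 0 + (c - 1) * z 1 + 1, (c + 1) * z 0 + c * z 1 + 1]
  invFun z := ![c * z 0 - (c - 1) * z 1 - 1, -(c + 1) * z 0 + c * z 1 + 1]
  left_inv z := by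
    ext i
    fin_cases i <;> simp <;> ring
  right_inv z := by
    ext i
    fin_cases i <;> simp <;> ring

/-- The vertices `P_k = T_c^k (0, 0)`, `k ∈ ℤ`. -/
def P (c : ℝ) (k : ℤ) : Plane := (T c ^ k) 0

/-- The infinite polygon `Q_c^+`, the convex hull of the vertices. -/
def Qplus (c : ℝ) : Set Plane := convexHull ℝ (range (P c))

/-- The infinite polygon `Q_c^-`, the image of `Q_c^+` under the rotation by `π`. -/
def Qminus (c : ℝ) : Set Plane := (fun z => -z) '' Qplus c

/-- The translation vector that carries the edge `[-P_{k+1}, -P_k]` of `Q_c^-` to the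
edge `[P_k, P_{k+1}]` of `Q_c^+`. -/
def edgeShift (c : ℝ) (k : ℤ) : Plane := P c k + P c (k + 1)

/-- The edge identifications: a point of the edge `[P_k, P_{k+1}]` of `Q_c^+` is identified with its
translate on the edge `[-P_{k+1}, -P_k]` of `Q_c^-`. -/
inductive Glue (c : ℝ) : Qplus c ⊕ Qminus c → Qplus c ⊕ Qminus c → Prop
  | edge (k : ℤ) (x : Qplus c) (y : Qminus c) (hx : (x : Plane) ∈ segment ℝ (P c k) (P c (k + 1)))
      (hy : (y : Plane) = x - edgeShift c k) : Glue c (Sum.inl x) (Sum.inr y)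

/-- The surface `S_c`: the quotient of the disjoint union of `Q_c^+` and `Q_c^-` by the
equivalence relation generated by the edge identifications. -/
def Surface (c : ℝ) : Type := Quot (Glue c)

/-- The quotient topology. -/
instance (c : ℝ) : TopologicalSpace (Surface c) :=
  inferInstanceAs (TopologicalSpace (Quot (Glue c)))

/-- The point of `S_c` represented by a point of `Q_c^+`. -/
def ofPlus (c : ℝ) (z : Plane) (hz : z ∈ Qplus c) : Surface c := Quot.mk _ (Sum.inl ⟨z, hz⟩)

/-- The point of `S_c` represented by a point of `Q_c^-`. -/
def ofMinus (c : ℝ) (z : Plane) (hz : z ∈ Qminus c) : Surface c := Quot.mk _ (Sum.inr ⟨z, hz⟩)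

/-- `IsChartAt c p γ`: near `0`, the map `γ` is (the inverse of) a translation chart of `S_c` around
the point `p = γ 0`. There are charts around the interior points of the two polygons, and charts
around the points in the interior of an edge, where `Q_c^+` and the copy of `Q_c^-` translated by
`edgeShift c k` are placed next to each other along their common edge. The points of `S_c` that have
no chart are those represented by the vertices: the cone singularities. -/
inductive IsChartAt (c : ℝ) (p : Surface c) (γ : Plane → Surface c) : Prop
  | plus (z : Plane) (hz : z ∈ interior (Qplus c)) (h0 : γ 0 = p)
      (h : ∀ᶠ v in 𝓝 (0 : Plane), ∃ hv : z + v ∈ Qplus c, γ v = ofPlus c (z + v) hv)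
  | minus (z : Plane) (hz : z ∈ interior (Qminus c)) (h0 : γ 0 = p)
      (h : ∀ᶠ v in 𝓝 (0 : Plane), ∃ hv : z + v ∈ Qminus c, γ v = ofMinus c (z + v) hv)
  | edge (k : ℤ) (z : Plane) (hz : z ∈ openSegment ℝ (P c k) (P c (k + 1))) (h0 : γ 0 = p)
      (h : ∀ᶠ v in 𝓝 (0 : Plane),
        (∃ hv : z + v ∈ Qplus c, γ v = ofPlus c (z + v) hv) ∨
        (∃ hv : z + v - edgeShift c k ∈ Qminus c, γ v = ofMinus c (z + v - edgeShift c k) hv))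

/-- The homeomorphism `f` of `S_c` is affine with derivative `A`: it carries the translation charts
around `p`, precomposed with `A⁻¹`, to the translation charts around `f p`. Thus `f` preserves the
set of cone singularities, and `f` is `z ↦ A z + const` in all translation charts. -/
def HasDerivative {c : ℝ} (f : Surface c ≃ₜ Surface c) (A : GL (Fin 2) ℝ) : Prop :=
  ∀ (p : Surface c) (γ : Plane → Surface c),
    IsChartAt c p γ ↔
      IsChartAt c (f p) (fun v => f (γ (((A⁻¹ : GL (Fin 2) ℝ) : Matrix (Fin 2) (Fin 2) ℝ).mulVec v)))

theorem HasDerivative.one (c : ℝ) : HasDerivative (1 : Surface c ≃ₜ Surface c) 1 := by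
  intro p γ
  simp

theorem HasDerivative.mul {c : ℝ} {f g : Surface c ≃ₜ Surface c} {A B : GL (Fin 2) ℝ}
    (hf : HasDerivative f A) (hg : HasDerivative g B) : HasDerivative (f * g) (A * B) := by
  intro p γ
  rw [hg p γ, hf (g p)]
  simp only [Matrix.mulVec_mulVec, mul_inv_rev, Units.val_mul]
  rfl

theorem HasDerivative.inv {c : ℝ} {f : Surface c ≃ₜ Surface c} {A : GL (Fin 2) ℝ}
    (hf : HasDerivative f A) : HasDerivative f⁻¹ A⁻¹ := by
  intro p γ
  rw [hf (f⁻¹ p)]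
  have h1 : ∀ q, f (f⁻¹ q) = q := fun q => f.apply_symm_apply q
  have h2 : (A : Matrix (Fin 2) (Fin 2) ℝ) * ((A⁻¹ : GL (Fin 2) ℝ) : Matrix (Fin 2) (Fin 2) ℝ) = 1 := by
    rw [← Units.val_mul, mul_inv_cancel, Units.val_one]
  simp only [h1, inv_inv, Matrix.mulVec_mulVec, h2, Matrix.one_mulVec]

/-- The affine automorphism group `Aut(S_c)`. -/
def Aut (c : ℝ) : Subgroup (Surface c ≃ₜ Surface c) where
  carrier := {f | ∃ A, HasDerivative f A}
  one_mem' := ⟨1, HasDerivative.one c⟩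
  mul_mem' := fun ⟨A, hA⟩ ⟨B, hB⟩ => ⟨A * B, hA.mul hB⟩
  inv_mem' := fun ⟨A, hA⟩ => ⟨A⁻¹, hA.inv⟩

/-- The Veech group `Γ(S_c)`. -/
def VeechGroup (c : ℝ) : Subgroup (GL (Fin 2) ℝ) where
  carrier := {A | ∃ f : Surface c ≃ₜ Surface c, HasDerivative f A}
  one_mem' := ⟨1, HasDerivative.one c⟩
  mul_mem' := fun ⟨f, hf⟩ ⟨g, hg⟩ => ⟨f * g, hf.mul hg⟩
  inv_mem' := fun ⟨f, hf⟩ => ⟨f⁻¹, hf.inv⟩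

/-! The derivative of an affine automorphism is unique: it can be read off near the points
of the triangle with the vertices `P_{-1}`, `P_0`, `P_1`. -/

theorem P_zero (c : ℝ) : P c 0 = 0 := by simp [P]

theorem P_one (c : ℝ) : P c 1 = ![1, 1] := by simp [P, T]

theorem P_neg_one (c : ℝ) : P c (-1) = ![-1, 1] := by
  simp only [P, zpow_neg, zpow_one]
  show (T c).symm 0 = _
  simp [T]

theorem P_pos {c : ℝ} (hc : 1 ≤ c) (n : ℕ) : 1 ≤ P c (n + 1) 0 ∧ 1 ≤ P c (n + 1) 1 := by
  induction n with
  | zero => simp [P_one]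
  | succ n ih =>
    have : P c ((n + 1 : ℕ) + 1) = T c (P c (n + 1)) := by
      have e : (((n + 1 : ℕ) : ℤ) + 1) = 1 + ((n : ℤ) + 1) := by push_cast; ring
      rw [P, e, zpow_one_add]; rfl
    rw [this]
    obtain ⟨h0, h1⟩ := ih
    simp only [T, Equiv.coe_fn_mk, Matrix.cons_val_zero, Matrix.cons_val_one]
    constructor <;> nlinarith

theorem P_neg {c : ℝ} (hc : 1 ≤ c) (n : ℕ) : P c (-(n + 1)) 0 ≤ -1 ∧ 1 ≤ P c (-(n + 1)) 1 := by
  induction n with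
  | zero => simp [P_neg_one]
  | succ n ih =>
    have : P c (-((n + 1 : ℕ) + 1)) = (T c).symm (P c (-(n + 1))) := by
      have e : (-(((n + 1 : ℕ) : ℤ) + 1)) = -1 + -((n : ℤ) + 1) := by push_cast; ring
      rw [P, e, zpow_add, zpow_neg_one]; rfl
    rw [this]
    obtain ⟨h0, h1⟩ := ih
    simp only [T, Equiv.coe_fn_symm_mk, Matrix.cons_val_zero, Matrix.cons_val_one]
    constructor <;> nlinarith

/-- The interior of the triangle with the vertices `P_{-1}`, `P_0`, `P_1`. -/
def triangle : Set Plane := {z | |z 0| < z 1 ∧ z 1 < 1}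

theorem isOpen_triangle : IsOpen triangle := by
  have h0 : Continuous fun z : Plane => |z 0| := (continuous_apply 0).abs
  have h1 : Continuous fun z : Plane => z 1 := continuous_apply 1
  exact (isOpen_lt h0 h1).inter (isOpen_lt h1 continuous_const)

theorem triangle_subset (c : ℝ) : triangle ⊆ Qplus c := by
  rintro z ⟨h1, h2⟩
  have hconv : Convex ℝ (Qplus c) := convex_convexHull ℝ _
  have m (k : ℤ) : P c k ∈ Qplus c := subset_convexHull ℝ _ (mem_range_self k)
  obtain ⟨h3, h4⟩ := abs_lt.1 h1
  have key := hconv.sum_mem (t := Finset.univ)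
    (w := ![(z 1 + z 0) / 2, (z 1 - z 0) / 2, 1 - z 1]) (z := ![P c 1, P c (-1), P c 0])
    (by intro i _; fin_cases i <;> simp <;> linarith)
    (by simp [Fin.sum_univ_three]; ring)
    (by intro i _; fin_cases i <;> simp [m])
  convert key using 1
  ext i
  fin_cases i <;> simp [Fin.sum_univ_three, P_zero, P_one, P_neg_one] <;> ring

theorem not_mem_edge {c : ℝ} (hc : 1 ≤ c) {z : Plane} (hz : z ∈ triangle) (k : ℤ) :
    z ∉ segment ℝ (P c k) (P c (k + 1)) := by
  rintro ⟨a, b, ha, hb, hab, rfl⟩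
  obtain ⟨h1, h2⟩ := hz
  obtain ⟨h3, h4⟩ := abs_lt.1 h1
  simp only [Pi.add_apply, Pi.smul_apply, smul_eq_mul] at h2 h3 h4
  rcases lt_trichotomy k 0 with hk | rfl | hk
  · obtain ⟨n, rfl⟩ : ∃ n : ℕ, k = -(n + 1) := ⟨(-k - 1).toNat, by omega⟩
    obtain ⟨p0, p1⟩ := P_neg hc n
    cases n with
    | zero =>
      simp [P_zero, P_neg_one] at h3
    | succ n =>
      have q1 := (P_neg hc n).2
      have e : (-(((n + 1 : ℕ) : ℤ) + 1) + 1) = -((n : ℤ) + 1) := by push_cast; ring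
      rw [e] at h2
      nlinarith
  · simp [P_zero, P_one] at h4
  · obtain ⟨n, rfl⟩ : ∃ n : ℕ, k = n + 1 := ⟨(k - 1).toNat, by omega⟩
    have p1 := (P_pos hc n).2
    have q1 := (P_pos hc (n + 1)).2
    push_cast at q1
    nlinarith

/-- A point of the triangle is identified with no other point of the two polygons. -/
theorem eq_of_triangle {c : ℝ} (hc : 1 ≤ c) {z : Plane} (hz : z ∈ triangle)
    {x : Qplus c ⊕ Qminus c}
    (h : (Quot.mk (Glue c) x) = ofPlus c z (triangle_subset c hz)) :
    x = Sum.inl ⟨z, triangle_subset c hz⟩ := by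
  let F : Surface c → Prop := Quot.lift (fun x => x = Sum.inl ⟨z, triangle_subset c hz⟩) (by
    rintro _ _ ⟨k, x, y, hx, hy⟩
    simp only [reduceCtorEq, eq_iff_iff, iff_false, Sum.inl.injEq]
    rintro rfl
    exact not_mem_edge hc hz k hx)
  have : F (Quot.mk (Glue c) x) = F (ofPlus c z (triangle_subset c hz)) := by rw [h]
  exact this.mpr rfl

theorem HasDerivative.unique {c : ℝ} (hc : 1 ≤ c) {f : Surface c ≃ₜ Surface c}
    {A B : GL (Fin 2) ℝ} (hA : HasDerivative f A) (hB : HasDerivative f B) : A = B := by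
  classical
  let z₀ : Plane := ![0, 1 / 2]
  have hz₀ : z₀ ∈ triangle := by
    constructor <;> norm_num [z₀]
  have hsub := triangle_subset c
  let q := ofPlus c z₀ (hsub hz₀)
  let γ₀ : Plane → Surface c := fun v => if h : z₀ + v ∈ triangle then ofPlus c (z₀ + v) (hsub h) else q
  have hev : ∀ᶠ v in 𝓝 (0 : Plane), z₀ + v ∈ triangle := by
    have : ContinuousAt (fun v : Plane => z₀ + v) 0 := by fun_prop
    exact this.eventually_mem (by simpa using isOpen_triangle.mem_nhds hz₀)
  have hγ₀ : IsChartAt c q γ₀ := by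
    refine .plus z₀ (interior_maximal hsub isOpen_triangle hz₀) (by simp [γ₀, q, hz₀]) ?_
    filter_upwards [hev] with v hv
    exact ⟨hsub hv, by simp [γ₀, hv]⟩
  have hAA' : (A : Matrix (Fin 2) (Fin 2) ℝ) * ((A⁻¹ : GL (Fin 2) ℝ) : Matrix (Fin 2) (Fin 2) ℝ) = 1 := by
    rw [← Units.val_mul, mul_inv_cancel, Units.val_one]
  have h1 : IsChartAt c (f.symm q)
      (fun v => f.symm (γ₀ ((A : Matrix (Fin 2) (Fin 2) ℝ).mulVec v))) := by
    rw [hA]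
    simpa only [Matrix.mulVec_mulVec, hAA', Matrix.one_mulVec, Homeomorph.apply_symm_apply] using hγ₀
  rw [hB] at h1
  simp only [Homeomorph.apply_symm_apply, Matrix.mulVec_mulVec] at h1
  set M : Matrix (Fin 2) (Fin 2) ℝ :=
    (A : Matrix (Fin 2) (Fin 2) ℝ) * ((B⁻¹ : GL (Fin 2) ℝ) : Matrix (Fin 2) (Fin 2) ℝ) with hM
  have hM0 : γ₀ (M.mulVec 0) = q := by simp [γ₀, q, hz₀]
  have key : ∀ᶠ v in 𝓝 (0 : Plane), ∃ hv : z₀ + v ∈ Qplus c,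
      γ₀ (M.mulVec v) = ofPlus c (z₀ + v) hv := by
    cases h1 with
    | plus z hz h0 h =>
      obtain ⟨hv, e⟩ := h.self_of_nhds
      have := eq_of_triangle hc hz₀ (e.symm.trans hM0)
      simp only [Sum.inl.injEq, Subtype.mk.injEq, add_zero] at this
      rwa [this] at h
    | minus z hz h0 h =>
      obtain ⟨hv, e⟩ := h.self_of_nhds
      have := eq_of_triangle hc hz₀ (e.symm.trans hM0)
      simp at this
    | edge k z hz h0 h =>
      rcases h.self_of_nhds with ⟨hv, e⟩ | ⟨hv, e⟩
      · have := eq_of_triangle hc hz₀ (e.symm.trans hM0)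
        simp only [Sum.inl.injEq, Subtype.mk.injEq, add_zero] at this
        rw [this] at hz
        exact absurd (openSegment_subset_segment ℝ _ _ hz) (not_mem_edge hc hz₀ k)
      · have := eq_of_triangle hc hz₀ (e.symm.trans hM0)
        simp at this
  have hevM : ∀ᶠ v in 𝓝 (0 : Plane), z₀ + M.mulVec v ∈ triangle := by
    have : ContinuousAt (fun v : Plane => M.mulVec v) 0 :=
      (continuous_const.matrix_mulVec continuous_id).continuousAt
    have ht : Tendsto (fun v : Plane => M.mulVec v) (𝓝 0) (𝓝 0) := by
      simpa [ContinuousAt] using this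
    exact ht.eventually hev
  have hfix : ∀ᶠ v in 𝓝 (0 : Plane), M.mulVec v = v := by
    filter_upwards [key, hevM] with v ⟨hv, e⟩ hMv
    rw [show γ₀ (M.mulVec v) = ofPlus c _ (hsub hMv) from dif_pos hMv] at e
    have := eq_of_triangle hc hMv e.symm
    simp only [Sum.inl.injEq, Subtype.mk.injEq] at this
    exact (add_left_cancel this).symm
  have hall : ∀ v : Plane, M.mulVec v = v := by
    intro v
    have ht : Tendsto (fun t : ℝ => t • v) (𝓝[≠] 0) (𝓝 0) := by
      have : Continuous (fun t : ℝ => t • v) := by fun_prop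
      simpa using (this.tendsto 0).mono_left nhdsWithin_le_nhds
    obtain ⟨t, h1, h2⟩ := ((ht.eventually hfix).and self_mem_nhdsWithin).exists
    rw [Matrix.mulVec_smul] at h1
    exact smul_right_injective _ h2 h1
  have hM1 : M = 1 := Matrix.ext_of_mulVec_single fun i => by rw [hall, Matrix.one_mulVec]
  have : A * B⁻¹ = 1 := Units.ext (by rw [Units.val_mul]; exact hM1)
  exact mul_inv_eq_one.1 this

/-- The derivative map `D : Aut(S_c) → Γ(S_c)`. -/
def derivative {c : ℝ} (hc : 1 ≤ c) : Aut c →* VeechGroup c :=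
  MonoidHom.mk' (fun f => ⟨f.2.choose, f.1, f.2.choose_spec⟩) fun f g =>
    Subtype.ext ((f * g).2.choose_spec.unique hc (f.2.choose_spec.mul g.2.choose_spec))

theorem derivative_spec {c : ℝ} (hc : 1 ≤ c) (f : Aut c) :
    HasDerivative (f : Surface c ≃ₜ Surface c) (derivative hc f : GL (Fin 2) ℝ) :=
  f.2.choose_spec

/-- `f` swaps the two pieces of `S_c`, rotating each of them by `π`. -/
def IsPieceSwap {c : ℝ} (f : Surface c ≃ₜ Surface c) : Prop :=
  (∀ z (hz : z ∈ Qplus c), ∃ hz' : -z ∈ Qminus c, f (ofPlus c z hz) = ofMinus c (-z) hz') ∧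
  (∀ z (hz : z ∈ Qminus c), ∃ hz' : -z ∈ Qplus c, f (ofMinus c z hz) = ofPlus c (-z) hz')

/-- `f` preserves each of the two pieces of `S_c` and is induced by the Euclidean reflection in the
line `x = 0`. -/
def IsReflection {c : ℝ} (f : Surface c ≃ₜ Surface c) : Prop :=
  (∀ z (hz : z ∈ Qplus c), ∃ hz' : ![-z 0, z 1] ∈ Qplus c,
    f (ofPlus c z hz) = ofPlus c ![-z 0, z 1] hz') ∧
  (∀ z (hz : z ∈ Qminus c), ∃ hz' : ![-z 0, z 1] ∈ Qminus c,
    f (ofMinus c z hz) = ofMinus c ![-z 0, z 1] hz')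

/-- The wedge product `(a, b) ∧ (c, d) = a d - b c`. -/
def wedge (u z : Plane) : ℝ := u 0 * z 1 - u 1 * z 0

/-- The open strip in the plane in the direction `u`, to the left of the line `ℝ u`. -/
def strip (u : Plane) (h : ℝ) : Set Plane := {z | 0 < wedge u z ∧ wedge u z < h}

/-- `Φ` parametrizes an open cylinder of `S_c` in the direction `u`: on the strip it is a local
isometry that preserves directions, and it is injective modulo the translation by `w u`. In units
of the length of `u`, the circumference is `w`; the strip has the width `h / |u|`. -/
structure IsCylinder (c : ℝ) (u : Plane) (w h : ℝ) (Φ : Plane → Surface c) : Prop where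
  w_pos : 0 < w
  h_pos : 0 < h
  chart : ∀ z ∈ strip u h, IsChartAt c (Φ z) (fun v => Φ (z + v))
  eq_iff : ∀ z ∈ strip u h, ∀ z' ∈ strip u h, Φ z = Φ z' ↔ ∃ n : ℤ, z' = z + (n * w) • u

/-- `Φ` parametrizes a cylinder that is contained in no larger cylinder of the same direction. -/
def IsMaximalCylinder (c : ℝ) (u : Plane) (w h : ℝ) (Φ : Plane → Surface c) : Prop :=
  IsCylinder c u w h Φ ∧ ∀ w' h' Φ', IsCylinder c u w' h' Φ' →
    Φ '' strip u h ⊆ Φ' '' strip u h' → Φ' '' strip u h' = Φ '' strip u h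

/-- The maximal cylinders of `S_c` in the direction `u`, as subsets of `S_c`. -/
def maximalCylinders (c : ℝ) (u : Plane) : Set (Set (Surface c)) :=
  {C | ∃ w h Φ, IsMaximalCylinder c u w h Φ ∧ C = Φ '' strip u h}

/-- `S_c` decomposes into its maximal cylinders in the direction `u`: these are pairwise disjoint,
and their closures cover the surface. -/
def HasCylinderDecomposition (c : ℝ) (u : Plane) : Prop :=
  (maximalCylinders c u).PairwiseDisjoint id ∧ ⋃ C ∈ maximalCylinders c u, closure C = univ

/-- `S_c` decomposes into maximal cylinders in the direction `u`; the homeomorphism `f` maps each of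
them to itself, and acts on it as a single right Dehn twist: the point at the relative height
`t ∈ (0, 1)` in the cylinder is moved forward in the direction `u` by `t` times the
circumference. -/
def IsRightTwist {c : ℝ} (u : Plane) (f : Surface c ≃ₜ Surface c) : Prop :=
  HasCylinderDecomposition c u ∧
  (∀ C ∈ maximalCylinders c u, f '' C = C) ∧
  ∀ w h Φ, IsMaximalCylinder c u w h Φ →
    ∀ z ∈ strip u h, f (Φ z) = Φ (z + (wedge u z / h * w) • u)

end

end HooperSurface

namespace HooperSurface

/-! ### The vertices -/

/-! Local picture. The abscissas of the `P c k` increase with `k` by at least 1, and `Q_c^+` is cut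
out by the half-planes `0 ≤ lam c m z`. Its interior, one open edge and the interior of the copy of
`Q_c^-` across that edge form a planar chart `psi c k` with domain `W c k`. Two charts either agree
near a point or differ near it (`psi_dichotomy`), so maps with the same linear part in charts that
agree at one point of a connected set agree on all of it (`Flat.eqOn`).

The twists. Diagonals parallel to `u`, joining `P_{-k}` to `P_k` for the horizontal direction and
`P_{1-k}` to `P_k` for slope 1, cut `Q_c^+` into trapezoids. A trapezoid and its half-turned copy in
`Q_c^-` form a cylinder. All cylinders of one direction have the same ratio `κ` of circumference to
height, 2 and `c + 1` respectively, so the simultaneous single twists form one affine map with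
derivative `z ↦ z + κ (u ∧ z) u`. The structure `Direction` holds what the two cases share. These
cylinders are maximal, and there are no other maximal ones, because a line along a diagonal runs
into a vertex (`Direction.inCyl_of_line`).

Trivial kernel. A saddle connection is a straight segment that cannot be continued at either end; an
automorphism maps saddle connections to saddle connections and acts on their vectors by its
derivative. The surface is tiled by vertical strips, one over each edge, whose only singular points
are the two ends of that edge. A saddle connection therefore crosses complete strips: its vector has
abscissa of absolute value at least 1 (`IsSaddle.one_le_abs_fst`), at least 2 if it is horizontal,
and one that moves to the right and is exactly as wide as its first strip has the vector of that
edge. The vector `(1, 1)` belongs to the edge from `P_0` to `P_1` only, so an automorphism with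
derivative 1 fixes points of this edge, and by continuation it is the identity
(`HasDerivative.eq_one`).

Generation. Since the kernel is trivial, it suffices that the four derivatives generate the Veech
group. The lower bounds on saddle vectors, combined with the shears, give a descent: reflections in
the generated group lower `|x| + |y|` of a saddle vector by at least `2 / (c + 1)` until it is
horizontal or has slope 1 (`exists_reduction`). Applied to the image of `(2, 0)` under a given `A`,
this leaves two cases. If the image is horizontal, the bounds for `A` and its inverse force diagonal
entries `±1` and an even shear. If it has slope 1, they contradict each other
(`snd_ne_fst_of_veech`). -/

theorem P_succ (c : ℝ) (k : ℤ) : P c (k + 1) = T c (P c k) := by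
  rw [P, add_comm, zpow_one_add]; rfl

theorem P_pred (c : ℝ) (k : ℤ) : P c (k - 1) = (T c).symm (P c k) := by
  rw [Equiv.eq_symm_apply, ← P_succ, sub_add_cancel]

theorem P_succ_fst (c : ℝ) (k : ℤ) :
    P c (k + 1) 0 = c * P c k 0 + (c - 1) * P c k 1 + 1 := by
  rw [P_succ]; simp [T]

theorem P_succ_snd (c : ℝ) (k : ℤ) :
    P c (k + 1) 1 = (c + 1) * P c k 0 + c * P c k 1 + 1 := by
  rw [P_succ]; simp [T]

theorem P_pred_fst (c : ℝ) (k : ℤ) :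
    P c (k - 1) 0 = c * P c k 0 - (c - 1) * P c k 1 - 1 := by
  rw [P_pred]; simp [T]

theorem P_pred_snd (c : ℝ) (k : ℤ) :
    P c (k - 1) 1 = -(c + 1) * P c k 0 + c * P c k 1 + 1 := by
  rw [P_pred]; simp [T]

theorem P_neg_nat (c : ℝ) (n : ℕ) :
    P c (-n) 0 = -P c n 0 ∧ P c (-n) 1 = P c n 1 := by
  induction n with
  | zero => simp [P_zero]
  | succ n ih =>
    have e : (-((n + 1 : ℕ) : ℤ)) = -(n : ℤ) - 1 := by push_cast; ring
    rw [e, P_pred_fst, P_pred_snd, ih.1, ih.2]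
    push_cast
    rw [P_succ_fst, P_succ_snd]
    constructor <;> ring

theorem P_neg_fst (c : ℝ) (k : ℤ) : P c (-k) 0 = -P c k 0 := by
  obtain ⟨n, rfl | rfl⟩ := k.eq_nat_or_neg
  · exact (P_neg_nat c n).1
  · rw [(P_neg_nat c n).1]; simp

theorem P_neg_snd (c : ℝ) (k : ℤ) : P c (-k) 1 = P c k 1 := by
  obtain ⟨n, rfl | rfl⟩ := k.eq_nat_or_neg
  · exact (P_neg_nat c n).2
  · rw [(P_neg_nat c n).2]; simp

theorem P_nonneg {c : ℝ} (hc : 1 ≤ c) {k : ℤ} (hk : 0 ≤ k) : 0 ≤ P c k 0 ∧ 0 ≤ P c k 1 := by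
  lift k to ℕ using hk
  cases k with
  | zero => simp [P_zero]
  | succ n =>
    have := P_pos hc n
    push_cast
    constructor <;> linarith [this.1, this.2]

theorem P_snd_nonneg {c : ℝ} (hc : 1 ≤ c) (k : ℤ) : 0 ≤ P c k 1 := by
  rcases le_total 0 k with hk | hk
  · exact (P_nonneg hc hk).2
  · rw [← P_neg_snd]; exact (P_nonneg hc (by omega)).2

/-- For `k ≥ 0` the width of the edge is `1 + (c - 1) (x_k + y_k)`, and negative `k` follow by the
mirror symmetry. The lower bounds for saddle connections all go back to this estimate. -/
theorem one_le_width {c : ℝ} (hc : 1 ≤ c) (k : ℤ) : 1 ≤ P c (k + 1) 0 - P c k 0 := by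
  rcases le_or_gt 0 k with hk | hk
  · obtain ⟨h0, h1⟩ := P_nonneg hc hk
    rw [P_succ_fst]; nlinarith
  · obtain ⟨h0, h1⟩ := P_nonneg hc (k := -(k + 1)) (by omega)
    have e : P c k 0 = -P c (-(k + 1) + 1) 0 := by
      rw [← P_neg_fst]; congr 1; ring_nf
    have e' := P_succ_fst c (-(k + 1))
    rw [P_neg_fst c (k + 1)] at e' h0
    rw [e, e']; nlinarith

theorem width_pos {c : ℝ} (hc : 1 ≤ c) (k : ℤ) : 0 < P c (k + 1) 0 - P c k 0 := by
  linarith [one_le_width hc k]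

theorem fst_strictMono {c : ℝ} (hc : 1 ≤ c) : StrictMono fun k : ℤ => P c k 0 :=
  strictMono_int_of_lt_succ fun k => by linarith [one_le_width hc k]

theorem one_le_fst_sub {c : ℝ} (hc : 1 ≤ c) {j k : ℤ} (h : j < k) : 1 ≤ P c k 0 - P c j 0 := by
  have := (fst_strictMono hc).monotone (show j + 1 ≤ k by omega)
  linarith [one_le_width hc j, this]

theorem P_injective {c : ℝ} (hc : 1 ≤ c) : Function.Injective (P c) := fun _ _ h =>
  (fst_strictMono hc).injective (congrFun h 0)

theorem natCast_le_fst {c : ℝ} (hc : 1 ≤ c) (n : ℕ) : (n : ℝ) ≤ P c n 0 := by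
  induction n with
  | zero => simp [P_zero]
  | succ n ih => push_cast; linarith [one_le_width hc n]

/-- Every abscissa lies over exactly one edge. -/
theorem exists_strip {c : ℝ} (hc : 1 ≤ c) (x : ℝ) : ∃ k : ℤ, P c k 0 ≤ x ∧ x < P c (k + 1) 0 := by
  obtain ⟨n, hn⟩ := exists_nat_gt |x|
  have h1 := natCast_le_fst hc n
  have h2 := P_neg_fst c n
  have hx := abs_lt.1 hn
  obtain ⟨k, hk, hk'⟩ := Int.exists_greatest_of_bdd (P := fun k : ℤ => P c k 0 ≤ x)
    ⟨n, fun z hz => by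
      by_contra! hlt
      have := (fst_strictMono hc).monotone hlt.le
      linarith [hx.2]⟩ ⟨-n, by linarith [hx.1]⟩
  refine ⟨k, hk, ?_⟩
  by_contra! h
  have := hk' _ h
  omega

/-! ### The lines through the edges -/

theorem wedge_add_right (u z z' : Plane) : wedge u (z + z') = wedge u z + wedge u z' := by
  simp [wedge]; ring

theorem wedge_sub_right (u z z' : Plane) : wedge u (z - z') = wedge u z - wedge u z' := by
  simp [wedge]; ring

theorem wedge_smul_right (u z : Plane) (a : ℝ) : wedge u (a • z) = a * wedge u z := by
  simp [wedge]; ring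

theorem wedge_neg_right (u z : Plane) : wedge u (-z) = -wedge u z := by
  simp [wedge]; ring

theorem wedge_self (u : Plane) : wedge u u = 0 := by
  simp [wedge]; ring

theorem wedge_zero_right (u : Plane) : wedge u 0 = 0 := by
  simp [wedge]

theorem continuous_wedge (u : Plane) : Continuous (wedge u) := by
  unfold wedge; fun_prop

/-- The affine function that vanishes on the line through the edge `[P_k, P_{k+1}]` and is positive
above it. -/
noncomputable def lam (c : ℝ) (k : ℤ) (z : Plane) : ℝ :=
  wedge (P c (k + 1) - P c k) (z - P c k)

theorem lam_eq (c : ℝ) (k : ℤ) (z : Plane) : lam c k z =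
    (P c (k + 1) 0 - P c k 0) * (z 1 - P c k 1) - (P c (k + 1) 1 - P c k 1) * (z 0 - P c k 0) := rfl

theorem continuous_lam (c : ℝ) (k : ℤ) : Continuous (lam c k) := by
  unfold lam wedge; fun_prop

theorem lam_add (c : ℝ) (k : ℤ) (z v : Plane) :
    lam c k (z + v) = lam c k z + wedge (P c (k + 1) - P c k) v := by
  simp [lam, wedge]; ring

/-- `edgeShift c k - z` is the half-turn of `z` about the midpoint of the edge. It exchanges `Q_c^+`
with the copy of `Q_c^-` across the edge, so statements below an edge reduce to statements above it.
-/
theorem lam_shift_sub (c : ℝ) (k : ℤ) (z : Plane) :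
    lam c k (edgeShift c k - z) = -lam c k z := by
  simp [lam, wedge, edgeShift]; ring

theorem lam_self (c : ℝ) (k : ℤ) : lam c k (P c k) = 0 := by
  simp [lam, wedge]

theorem lam_self_succ (c : ℝ) (k : ℤ) : lam c k (P c (k + 1)) = 0 := by
  simp [lam, wedge]; ring

theorem lam_comb (c : ℝ) (k : ℤ) (z z' : Plane) {a b : ℝ} (hab : a + b = 1) :
    lam c k (a • z + b • z') = a * lam c k z + b * lam c k z' := by
  obtain rfl : b = 1 - a := by linarith
  simp [lam, wedge]; ring

/-- `lam` is an oriented area, and the linear part of `T c`, which takes each edge to the next one,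
has determinant `c² - (c² - 1) = 1`. -/
theorem lam_T (c : ℝ) (k : ℤ) (z : Plane) : lam c (k + 1) (T c z) = lam c k z := by
  simp only [lam_eq, P_succ_fst c (k + 1), P_succ_snd c (k + 1)]
  simp only [P_succ_fst c k, P_succ_snd c k, T, Equiv.coe_fn_mk, Matrix.cons_val_zero,
    Matrix.cons_val_one]
  ring

theorem lam_P_shift (c : ℝ) (m j : ℤ) : lam c m (P c j) = lam c 0 (P c (j - m)) := by
  induction m using Int.induction_on generalizing j with
  | zero => simp
  | succ i ih =>
    have := lam_T c i (P c (j - 1))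
    rw [← P_succ, sub_add_cancel] at this
    rw [this, ih]; congr 2; ring
  | pred i ih =>
    have := lam_T c (-i - 1) (P c j)
    rw [← P_succ, sub_add_cancel] at this
    rw [← this, ih]; congr 2; ring

/-- By invariance under `T c` only the edge from `(0, 0)` to `(1, 1)` matters, and the claim becomes
`x ≤ y` at every vertex. This is clear for `n ≤ 0`, where `x ≤ 0 ≤ y`; otherwise `y_n - x_n =
x_{n-1} + y_{n-1}`. -/
theorem lam_P_nonneg {c : ℝ} (hc : 1 ≤ c) (m j : ℤ) : 0 ≤ lam c m (P c j) := by
  rw [lam_P_shift, lam_eq]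
  generalize j - m = n
  simp only [zero_add, P_one, P_zero]
  simp
  rcases le_or_gt n 0 with h | h
  · have := (P_nonneg hc (k := -n) (by omega)).1
    rw [P_neg_fst] at this
    linarith [P_snd_nonneg hc n]
  · obtain ⟨h0, h1⟩ := P_nonneg hc (k := n - 1) (by omega)
    have e0 := P_succ_fst c (n - 1)
    have e1 := P_succ_snd c (n - 1)
    rw [sub_add_cancel] at e0 e1
    rw [e0, e1]; linarith

theorem lam_nonneg_of_mem {c : ℝ} (hc : 1 ≤ c) {z : Plane} (hz : z ∈ Qplus c) (m : ℤ) :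
    0 ≤ lam c m z := by
  have hconv : Convex ℝ {z | 0 ≤ lam c m z} := by
    intro x hx y hy a b ha hb hab
    rw [mem_ofPred_eq, lam_comb _ _ _ _ hab]
    exact add_nonneg (mul_nonneg ha hx) (mul_nonneg hb hy)
  exact convexHull_min (by rintro _ ⟨j, rfl⟩; exact lam_P_nonneg hc m j) hconv hz

/-- Split `z` into the point of the line through edge `k` with the same abscissa, which interpolates
the two ends, and a vertical displacement. Over an edge, the inequality for that edge then implies
all the others. -/
theorem width_mul_lam (c : ℝ) (k m : ℤ) (z : Plane) :
    (P c (k + 1) 0 - P c k 0) * lam c m z =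
      (P c (k + 1) 0 - z 0) * lam c m (P c k) + (z 0 - P c k 0) * lam c m (P c (k + 1)) +
        (P c (m + 1) 0 - P c m 0) * lam c k z := by
  simp only [lam_eq]; ring

theorem lam_nonneg_of_strip {c : ℝ} (hc : 1 ≤ c) {k : ℤ} {z : Plane} (h0 : P c k 0 ≤ z 0)
    (h1 : z 0 ≤ P c (k + 1) 0) (h : 0 ≤ lam c k z) (m : ℤ) : 0 ≤ lam c m z := by
  have := width_mul_lam c k m z
  have h2 := mul_nonneg (sub_nonneg.2 h1) (lam_P_nonneg hc m k)
  have h3 := mul_nonneg (sub_nonneg.2 h0) (lam_P_nonneg hc m (k + 1))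
  have h4 := mul_nonneg (width_pos hc m).le h
  exact nonneg_of_mul_nonneg_right (by linarith) (width_pos hc k)

theorem P_mem (c : ℝ) (k : ℤ) : P c k ∈ Qplus c := subset_convexHull ℝ _ (mem_range_self k)

theorem convex_Qplus (c : ℝ) : Convex ℝ (Qplus c) := convex_convexHull ℝ _

theorem neg_mem_Qminus {c : ℝ} {z : Plane} : -z ∈ Qminus c ↔ z ∈ Qplus c := by
  simp [Qminus]

theorem mem_Qminus {c : ℝ} {z : Plane} : z ∈ Qminus c ↔ -z ∈ Qplus c := by
  rw [← neg_mem_Qminus, neg_neg]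

/-! ### The two directions of the cylinder decompositions -/

/-- The distance, in terms of `u ∧ z`, of two consecutive diagonals parallel to `u`. -/
noncomputable def height (c : ℝ) (u : Plane) (j : ℤ) : ℝ :=
  wedge u (P c (j + 1)) - wedge u (P c j)

/-- The data of a direction `u` in which the surface decomposes into cylinders: the diagonals
`[P_{e-k}, P_k]` are parallel to `u`, and the cylinders have the inverse modulus `κ`. -/
structure Direction (c : ℝ) (u : Plane) (e : ℤ) (κ : ℝ) : Prop where
  fst : u 0 = 1
  base : e = 0 ∨ e = 1
  pos : 0 < κ
  symm : ∀ k, wedge u (P c (e - k)) = wedge u (P c k)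
  step : ∀ j, e ≤ j → wedge u (P c j) + 1 ≤ wedge u (P c (j + 1))
  bottom : ∀ z, (∀ m, 0 ≤ lam c m z) → wedge u (P c e) ≤ wedge u z
  period : ∀ j, edgeShift c j - edgeShift c (e - 1 - j) =
    (κ * height c u j) • u

/-- The common ratio 2 comes from `y_{j+1} - y_j = x_j + x_{j+1}`: the height of the trapezoid is
half the sum of its two parallel sides, whose lengths are `2 x_j` and `2 x_{j+1}`. -/
theorem horizontal {c : ℝ} (hc : 1 ≤ c) : Direction c ![1, 0] 0 2 where
  fst := rfl
  base := Or.inl rfl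
  pos := two_pos
  symm k := by simp [wedge, P_neg_snd]
  step j hj := by
    obtain ⟨h0, h1⟩ := P_nonneg hc hj
    simp [wedge]
    rw [P_succ_snd]; nlinarith
  bottom z hz := by
    have h0 := hz 0
    have h1 := hz (-1)
    simp [lam_eq, P_zero, P_one, P_neg_one] at h0 h1
    simp [wedge, P_zero]
    linarith
  period j := by
    have h : edgeShift c (0 - 1 - j) = P c (-(j + 1)) + P c (-j) := by
      unfold edgeShift; congr 2 <;> ring
    rw [h, edgeShift]
    ext i
    fin_cases i
    · simp only [Fin.zero_eta, Pi.sub_apply, Pi.add_apply, P_neg_fst, height, wedge,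
        P_succ_fst, P_succ_snd]
      simp; ring
    · simp only [Fin.mk_one, Pi.sub_apply, Pi.add_apply, P_neg_snd, height, wedge]
      simp; ring

theorem P_one_sub_fst (c : ℝ) (k : ℤ) :
    P c (1 - k) 0 = -c * P c k 0 + (c - 1) * P c k 1 + 1 := by
  rw [show 1 - k = -k + 1 by ring, P_succ_fst, P_neg_fst, P_neg_snd]; ring

theorem P_one_sub_snd (c : ℝ) (k : ℤ) :
    P c (1 - k) 1 = -(c + 1) * P c k 0 + c * P c k 1 + 1 := by
  rw [show 1 - k = -k + 1 by ring, P_succ_snd, P_neg_fst, P_neg_snd]; ring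

/-- `P_k ↦ P_{1-k}` extends to the affine involution `T c` after the mirror reflection, which
preserves `y - x`. The base is `e = 1` because the lowest diagonal is the edge from `P_0` to `P_1`
itself. Here `height` is `2 x_j`, and the period is `2 (c + 1) x_j`. -/
theorem diagonal {c : ℝ} (hc : 1 ≤ c) : Direction c ![1, 1] 1 (c + 1) where
  fst := rfl
  base := Or.inr rfl
  pos := by linarith
  symm k := by simp [wedge, P_one_sub_fst, P_one_sub_snd]; ring
  step j hj := by
    have h0 := one_le_fst_sub hc (show (0 : ℤ) < j by omega)
    simp [P_zero] at h0
    simp [wedge]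
    rw [P_succ_snd, P_succ_fst]; linarith
  bottom z hz := by
    have h0 := hz 0
    simp [lam_eq, P_zero, P_one] at h0
    simp [wedge, P_one]
    linarith
  period j := by
    have h : edgeShift c (1 - 1 - j) = P c (1 - (j + 1)) + P c (1 - j) := by
      unfold edgeShift; congr 2 <;> ring
    rw [h, edgeShift]
    ext i
    fin_cases i
    · simp only [Fin.zero_eta, Pi.sub_apply, Pi.add_apply, P_one_sub_fst, height, wedge,
        P_succ_fst, P_succ_snd]
      simp; ring
    · simp only [Fin.mk_one, Pi.sub_apply, Pi.add_apply, P_one_sub_snd, height, wedge,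
        P_succ_fst, P_succ_snd]
      simp; ring

namespace Direction

variable {c : ℝ} {u : Plane} {e : ℤ} {κ : ℝ}

theorem step_pos (d : Direction c u e κ) {j : ℤ} (hj : e ≤ j) :
    0 < height c u j := by
  unfold height; linarith [d.step j hj]

theorem wedge_edge (c : ℝ) (u : Plane) (j : ℤ) :
    wedge (P c (j + 1) - P c j) u = -height c u j := by
  simp [height, wedge]; ring

theorem wedge_edge_symm (d : Direction c u e κ) (j : ℤ) :
    wedge (P c (e - 1 - j + 1) - P c (e - 1 - j)) u =
      height c u j := by
  rw [wedge_edge, height, height, show e - 1 - j + 1 = e - j by ring, show e - 1 - j = e - (j + 1) by ring,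
    d.symm, d.symm]; ring

/-- Moving in the direction `u` towards the right edge of a trapezoid. -/
theorem lam_right (c : ℝ) (u : Plane) (j : ℤ) (z : Plane) (s : ℝ) :
    lam c j (z + s • u) = lam c j z - s * height c u j := by
  rw [lam_add, wedge_smul_right, wedge_edge]; ring

theorem lam_left (d : Direction c u e κ) (j : ℤ) (z : Plane) (s : ℝ) :
    lam c (e - 1 - j) (z + s • u) =
      lam c (e - 1 - j) z + s * height c u j := by
  rw [lam_add, wedge_smul_right, d.wedge_edge_symm]

/-- Along `u` the function `lam c j` decreases at the rate `height c u j`, so `lam / height` is the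
distance to the right side in units of `u`. The level `u ∧ z` fixes the position on that side. -/
theorem right_point (d : Direction c u e κ) {j : ℤ} (hj : e ≤ j) (z : Plane) :
    z + (lam c j z / height c u j) • u =
      P c j + ((wedge u z - wedge u (P c j)) / height c u j) •
        (P c (j + 1) - P c j) := by
  have h := (d.step_pos hj).ne'
  ext i
  fin_cases i
  · simp only [lam, Pi.add_apply, Pi.smul_apply, smul_eq_mul, Pi.sub_apply, Fin.zero_eta]
    field_simp
    simp [height, wedge]; ring
  · simp only [lam, Pi.add_apply, Pi.smul_apply, smul_eq_mul, Pi.sub_apply, Fin.mk_one]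
    field_simp
    simp [height, wedge]; ring

theorem left_point (d : Direction c u e κ) {j : ℤ} (hj : e ≤ j) (z : Plane) :
    z + (-(lam c (e - 1 - j) z / height c u j)) • u =
      P c (e - j) + ((wedge u z - wedge u (P c j)) / height c u j) •
        (P c (e - 1 - j) - P c (e - j)) := by
  have h := (d.step_pos hj).ne'
  have e1 := d.symm j
  have e2 := d.symm (j + 1)
  rw [show e - (j + 1) = e - 1 - j by ring] at e2
  have hh : height c u j = wedge u (P c (e - 1 - j)) - wedge u (P c (e - j)) := by
    rw [e1, e2, height]
  rw [← e1, hh]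
  rw [hh] at h
  have e3 : e - 1 - j + 1 = e - j := by ring
  ext i
  fin_cases i
  · simp only [lam, e3, Pi.add_apply, Pi.smul_apply, smul_eq_mul, Pi.sub_apply, Fin.zero_eta]
    field_simp
    simp [wedge]; ring
  · simp only [lam, e3, Pi.add_apply, Pi.smul_apply, smul_eq_mul, Pi.sub_apply, Fin.mk_one]
    field_simp
    simp [wedge]; ring

end Direction

/-! ### Trapezoids and levels -/

theorem mem_of_between {S : Set Plane} (hS : Convex ℝ S) {z u : Plane} {p q : ℝ} (hp : 0 ≤ p)
    (hq : 0 ≤ q) (h1 : z + p • u ∈ S) (h2 : z + (-q) • u ∈ S) : z ∈ S := by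
  rcases hp.eq_or_lt with rfl | hp
  · simpa using h1
  · have hpq : 0 < p + q := by linarith
    have := hS h1 h2 (a := q / (p + q)) (b := p / (p + q)) (by positivity) (by positivity)
      (by field_simp; ring)
    convert this using 1
    ext i
    simp only [Pi.add_apply, Pi.smul_apply, smul_eq_mul]
    field_simp
    ring

theorem convex_combo_mem {S : Set Plane} (hS : Convex ℝ S) {a b : Plane} {t : ℝ} (h0 : 0 ≤ t)
    (h1 : t ≤ 1) (ha : a ∈ S) (hb : b ∈ S) : a + t • (b - a) ∈ S :=
  hS.add_smul_sub_mem ha hb ⟨h0, h1⟩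

/-- The trapezoid between two consecutive diagonals parallel to `u`. -/
theorem Direction.trapezoid_subset {c : ℝ} {u : Plane} {e : ℤ} {κ : ℝ} (d : Direction c u e κ)
    {j : ℤ} (hj : e ≤ j) {z : Plane} (h0 : wedge u (P c j) ≤ wedge u z)
    (h1 : wedge u z ≤ wedge u (P c (j + 1))) (h2 : 0 ≤ lam c j z)
    (h3 : 0 ≤ lam c (e - 1 - j) z) : z ∈ Qplus c := by
  have hpos := d.step_pos hj
  have t0 : 0 ≤ (wedge u z - wedge u (P c j)) / height c u j :=
    div_nonneg (by linarith) hpos.le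
  have t1 : (wedge u z - wedge u (P c j)) / height c u j ≤ 1 := by
    rw [div_le_one hpos, height]; linarith
  -- `z` lies on a chord parallel to `u` whose ends are on the left and right edges.
  refine mem_of_between (convex_Qplus c) (u := u) (div_nonneg h2 hpos.le)
    (div_nonneg h3 hpos.le) ?_ ?_
  · rw [d.right_point hj]
    exact convex_combo_mem (convex_Qplus c) t0 t1 (P_mem c _) (P_mem c _)
  · rw [d.left_point hj]
    exact convex_combo_mem (convex_Qplus c) t0 t1 (P_mem c _) (P_mem c _)

theorem Direction.level_le {c : ℝ} {u : Plane} {e : ℤ} {κ : ℝ} (d : Direction c u e κ) (n : ℕ) :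
    wedge u (P c e) + n ≤ wedge u (P c (e + n)) := by
  induction n with
  | zero => simp
  | succ n ih =>
    have := d.step (e + n) (by omega)
    rw [add_assoc] at this
    push_cast
    linarith

theorem Direction.level_mono {c : ℝ} {u : Plane} {e : ℤ} {κ : ℝ} (d : Direction c u e κ)
    {i j : ℤ} (hi : e ≤ i) (hij : i ≤ j) : wedge u (P c i) ≤ wedge u (P c j) := by
  obtain ⟨n, rfl⟩ := Int.le.dest hij
  clear hij
  induction n with
  | zero => simp
  | succ n ih =>
    have := d.step (i + n) (by omega)
    rw [add_assoc] at this
    push_cast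
    linarith

/-- Every level above the lowest one lies between two consecutive diagonals. -/
theorem Direction.exists_level {c : ℝ} {u : Plane} {e : ℤ} {κ : ℝ} (d : Direction c u e κ) {y : ℝ}
    (hy : wedge u (P c e) ≤ y) :
    ∃ j, e ≤ j ∧ wedge u (P c j) ≤ y ∧ y < wedge u (P c (j + 1)) := by
  obtain ⟨n, hn⟩ := exists_nat_gt (y - wedge u (P c e))
  obtain ⟨j, ⟨hj, hj1⟩, hj'⟩ := Int.exists_greatest_of_bdd
    (P := fun k : ℤ => e ≤ k ∧ wedge u (P c k) ≤ y)
    ⟨e + n, fun z ⟨hz, hz'⟩ => by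
      by_contra! hlt
      have := d.level_mono (i := e + n) (by omega) hlt.le
      linarith [d.level_le n]⟩ ⟨e, le_rfl, hy⟩
  refine ⟨j, hj, hj1, ?_⟩
  by_contra! h
  have := hj' _ ⟨by omega, h⟩
  omega

/-! ### The polygon -/

/-- A convex hull of infinitely many points need not be closed, so the half-planes alone do not
suffice. Slicing horizontally puts each point into a trapezoid whose corners are vertices. -/
theorem mem_Qplus_iff {c : ℝ} (hc : 1 ≤ c) {z : Plane} : z ∈ Qplus c ↔ ∀ m, 0 ≤ lam c m z := by
  refine ⟨fun h m => lam_nonneg_of_mem hc h m, fun h => ?_⟩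
  have d := horizontal hc
  obtain ⟨j, hj, h0, h1⟩ := d.exists_level (d.bottom z h)
  exact d.trapezoid_subset hj h0 h1.le (h _) (h _)

theorem mem_Qplus_of_strip {c : ℝ} (hc : 1 ≤ c) {k : ℤ} {z : Plane} (h0 : P c k 0 ≤ z 0)
    (h1 : z 0 ≤ P c (k + 1) 0) (h : 0 ≤ lam c k z) : z ∈ Qplus c :=
  (mem_Qplus_iff hc).2 (lam_nonneg_of_strip hc h0 h1 h)

theorem isClosed_Qplus {c : ℝ} (hc : 1 ≤ c) : IsClosed (Qplus c) := by
  have : Qplus c = ⋂ m, {z | 0 ≤ lam c m z} := by ext z; simp [mem_Qplus_iff hc]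
  rw [this]
  exact isClosed_iInter fun m => isClosed_le continuous_const (continuous_lam c m)

/-- An interior point can be moved slightly downwards within the polygon, and every `lam` strictly
decreases in that direction. -/
theorem lam_pos_of_interior {c : ℝ} (hc : 1 ≤ c) {z : Plane} (hz : z ∈ interior (Qplus c)) (m : ℤ) :
    0 < lam c m z := by
  have h1 : ∀ᶠ s in 𝓝[>] (0 : ℝ), z + s • ![0, -1] ∈ interior (Qplus c) := by
    have hcont : Continuous fun s : ℝ => z + s • (![0, -1] : Plane) := by fun_prop
    exact ((hcont.tendsto 0).mono_left nhdsWithin_le_nhds).eventually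
      (by simpa using isOpen_interior.mem_nhds hz)
  obtain ⟨s, hs, hs'⟩ := (h1.and self_mem_nhdsWithin).exists
  have h2 := lam_nonneg_of_mem hc (interior_subset hs) m
  rw [lam_add] at h2
  simp [wedge] at h2
  have := mul_pos (width_pos hc m) hs'
  linarith

theorem interior_of_strip {c : ℝ} (hc : 1 ≤ c) {k : ℤ} {z : Plane} (h0 : P c k 0 < z 0)
    (h1 : z 0 < P c (k + 1) 0) (h : 0 < lam c k z) : z ∈ interior (Qplus c) := by
  have ho : IsOpen {z : Plane | P c k 0 < z 0 ∧ z 0 < P c (k + 1) 0 ∧ 0 < lam c k z} :=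
    (isOpen_lt continuous_const (continuous_apply 0)).inter
      ((isOpen_lt (continuous_apply 0) continuous_const).inter
        (isOpen_lt continuous_const (continuous_lam c k)))
  exact interior_maximal (fun z hz => mem_Qplus_of_strip hc hz.1.le hz.2.1.le hz.2.2.le) ho
    ⟨h0, h1, h⟩

theorem interior_above_vertex {c : ℝ} (hc : 1 ≤ c) {k : ℤ} {z : Plane} (h0 : z 0 = P c k 0)
    (h : P c k 1 < z 1) : z ∈ interior (Qplus c) := by
  have ho : IsOpen {z : Plane | P c (k - 1) 0 < z 0 ∧ z 0 < P c (k + 1) 0 ∧ 0 < lam c (k - 1) z ∧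
      0 < lam c k z} :=
    (isOpen_lt continuous_const (continuous_apply 0)).inter
      ((isOpen_lt (continuous_apply 0) continuous_const).inter
        ((isOpen_lt continuous_const (continuous_lam c _)).inter
          (isOpen_lt continuous_const (continuous_lam c k))))
  have w1 := width_pos hc k
  have w2 := width_pos hc (k - 1)
  have hl := lam_self_succ c (k - 1)
  refine interior_maximal (fun z hz => ?_) ho ⟨?_, ?_, ?_, ?_⟩
  · rcases le_total (z 0) (P c k 0) with h | h
    · exact mem_Qplus_of_strip hc (k := k - 1) hz.1.le (by simpa using h) hz.2.2.1.le
    · exact mem_Qplus_of_strip hc h hz.2.1.le hz.2.2.2.le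
  · rw [sub_add_cancel] at w2; linarith
  · linarith
  · rw [lam_eq] at hl ⊢
    rw [sub_add_cancel] at w2 hl ⊢
    rw [h0]
    have := mul_pos w2 (sub_pos.2 h)
    linarith
  · rw [lam_eq, h0]
    have := mul_pos w1 (sub_pos.2 h)
    linarith

theorem openSegment_of_strip {c : ℝ} (hc : 1 ≤ c) {k : ℤ} {z : Plane} (h0 : P c k 0 < z 0)
    (h1 : z 0 < P c (k + 1) 0) (h : lam c k z = 0) : z ∈ openSegment ℝ (P c k) (P c (k + 1)) := by
  have w := width_pos hc k
  refine ⟨(P c (k + 1) 0 - z 0) / (P c (k + 1) 0 - P c k 0),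
    (z 0 - P c k 0) / (P c (k + 1) 0 - P c k 0), div_pos (by linarith) w, div_pos (by linarith) w,
    by field_simp; ring, ?_⟩
  rw [lam_eq] at h
  ext i
  fin_cases i
  · simp; field_simp; ring
  · simp; field_simp; linarith

theorem fst_of_segment {c : ℝ} (hc : 1 ≤ c) {k : ℤ} {z : Plane}
    (hz : z ∈ segment ℝ (P c k) (P c (k + 1))) :
    P c k 0 ≤ z 0 ∧ z 0 ≤ P c (k + 1) 0 ∧ lam c k z = 0 := by
  obtain ⟨a, b, ha, hb, hab, rfl⟩ := hz
  have w := width_pos hc k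
  obtain rfl : a = 1 - b := by linarith
  refine ⟨?_, ?_, ?_⟩
  · simp; nlinarith
  · simp; nlinarith
  · rw [lam_comb _ _ _ _ (by ring), lam_self, lam_self_succ]; ring

theorem fst_of_openSegment {c : ℝ} (hc : 1 ≤ c) {k : ℤ} {z : Plane}
    (hz : z ∈ openSegment ℝ (P c k) (P c (k + 1))) :
    P c k 0 < z 0 ∧ z 0 < P c (k + 1) 0 ∧ lam c k z = 0 := by
  refine ⟨?_, ?_, (fst_of_segment hc (openSegment_subset_segment ℝ _ _ hz)).2.2⟩ <;>
  · obtain ⟨a, b, ha, hb, hab, rfl⟩ := hz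
    have w := width_pos hc k
    obtain rfl : a = 1 - b := by linarith
    simp; nlinarith

theorem segment_subset_Qplus (c : ℝ) (k : ℤ) : segment ℝ (P c k) (P c (k + 1)) ⊆ Qplus c :=
  (convex_Qplus c).segment_subset (P_mem c k) (P_mem c (k + 1))

theorem index_unique {c : ℝ} (hc : 1 ≤ c) {k m : ℤ} {x : ℝ} (h0 : P c k 0 < x)
    (h1 : x < P c (k + 1) 0) (h2 : P c m 0 ≤ x) (h3 : x ≤ P c (m + 1) 0) : m = k := by
  have a1 := (fst_strictMono hc).lt_iff_lt.1 (show P c m 0 < P c (k + 1) 0 by linarith)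
  have a2 := (fst_strictMono hc).lt_iff_lt.1 (show P c k 0 < P c (m + 1) 0 by linarith)
  omega

/-- The polygon consists of its interior, its open edges and its vertices. -/
theorem mem_Qplus_cases {c : ℝ} (hc : 1 ≤ c) {z : Plane} (hz : z ∈ Qplus c) :
    z ∈ interior (Qplus c) ∨ (∃ k, z ∈ openSegment ℝ (P c k) (P c (k + 1))) ∨ ∃ k, z = P c k := by
  obtain ⟨k, h0, h1⟩ := exists_strip hc (z 0)
  have hl := lam_nonneg_of_mem hc hz k
  rcases h0.eq_or_lt with h | h
  · have : 0 ≤ z 1 - P c k 1 := by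
      rw [lam_eq, ← h] at hl
      exact nonneg_of_mul_nonneg_right (by linarith) (width_pos hc k)
    rcases this.eq_or_lt with h' | h'
    · refine Or.inr (Or.inr ⟨k, ?_⟩)
      ext i
      fin_cases i
      · exact h.symm
      · simp; linarith
    · exact Or.inl (interior_above_vertex hc h.symm (by linarith))
  · rcases hl.eq_or_lt with hl | hl
    · exact Or.inr (Or.inl ⟨k, openSegment_of_strip hc h h1 hl.symm⟩)
    · exact Or.inl (interior_of_strip hc h h1 hl)

/-! ### Points of the surface -/

open Classical in
/-- The point of the surface represented by a point of `Q_c^+`, with a default value elsewhere. -/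
noncomputable def pl (c : ℝ) (z : Plane) : Surface c :=
  if h : z ∈ Qplus c then ofPlus c z h else ofPlus c (P c 0) (P_mem c 0)

open Classical in
/-- The point of the surface represented by a point of `Q_c^-`, with a default value elsewhere. -/
noncomputable def mi (c : ℝ) (z : Plane) : Surface c :=
  if h : z ∈ Qminus c then ofMinus c z h else ofPlus c (P c 0) (P_mem c 0)

theorem pl_of_mem {c : ℝ} {z : Plane} (h : z ∈ Qplus c) : pl c z = ofPlus c z h := dif_pos h

theorem mi_of_mem {c : ℝ} {z : Plane} (h : z ∈ Qminus c) : mi c z = ofMinus c z h := dif_pos h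

theorem surface_cases {c : ℝ} (p : Surface c) :
    (∃ z ∈ Qplus c, p = pl c z) ∨ ∃ z ∈ Qplus c, p = mi c (-z) := by
  obtain ⟨x | x, rfl⟩ := Quot.exists_rep p
  · exact Or.inl ⟨x, x.2, (pl_of_mem x.2).symm⟩
  · refine Or.inr ⟨-x, mem_Qminus.1 x.2, ?_⟩
    rw [neg_neg]
    exact (mi_of_mem x.2).symm

theorem continuous_mk (c : ℝ) : Continuous (Quot.mk (Glue c) : _ → Surface c) :=
  continuous_quot_mk

theorem continuousOn_pl (c : ℝ) : ContinuousOn (pl c) (Qplus c) := by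
  rw [continuousOn_iff_continuous_domRestrict]
  have : (Qplus c).domRestrict (pl c) = fun x => Quot.mk (Glue c) (Sum.inl x) := by
    ext x
    exact pl_of_mem x.2
  rw [this]
  exact (continuous_mk c).comp continuous_inl

theorem continuousOn_mi (c : ℝ) : ContinuousOn (mi c) (Qminus c) := by
  rw [continuousOn_iff_continuous_domRestrict]
  have : (Qminus c).domRestrict (mi c) = fun x => Quot.mk (Glue c) (Sum.inr x) := by
    ext x
    exact mi_of_mem x.2
  rw [this]
  exact (continuous_mk c).comp continuous_inr

theorem shift_sub_mem_segment {c : ℝ} {k : ℤ} {z : Plane}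
    (hz : z ∈ segment ℝ (P c k) (P c (k + 1))) :
    edgeShift c k - z ∈ segment ℝ (P c k) (P c (k + 1)) := by
  obtain ⟨a, b, ha, hb, hab, rfl⟩ := hz
  refine ⟨b, a, hb, ha, by linarith, ?_⟩
  obtain rfl : a = 1 - b := by linarith
  ext i
  simp [edgeShift]; ring

theorem sub_shift_mem_Qminus {c : ℝ} {k : ℤ} {z : Plane} :
    z - edgeShift c k ∈ Qminus c ↔ edgeShift c k - z ∈ Qplus c := by
  rw [mem_Qminus, neg_sub]

theorem pl_eq_mi {c : ℝ} {k : ℤ} {z : Plane} (hz : z ∈ segment ℝ (P c k) (P c (k + 1))) :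
    pl c z = mi c (z - edgeShift c k) := by
  have h1 := segment_subset_Qplus c k hz
  have h2 : z - edgeShift c k ∈ Qminus c :=
    sub_shift_mem_Qminus.2 (segment_subset_Qplus c k (shift_sub_mem_segment hz))
  rw [pl_of_mem h1, mi_of_mem h2]
  exact Quot.sound (Glue.edge k ⟨z, h1⟩ ⟨_, h2⟩ hz rfl)

theorem interior_Qminus {c : ℝ} {z : Plane} :
    z ∈ interior (Qminus c) ↔ -z ∈ interior (Qplus c) := by
  have h : Qminus c = (Homeomorph.neg Plane) ⁻¹' Qplus c := by
    ext w; simp [mem_Qminus]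
  rw [h, ← (Homeomorph.neg Plane).preimage_interior]
  simp

theorem not_mem_segment_of_interior {c : ℝ} (hc : 1 ≤ c) {z : Plane}
    (hz : z ∈ interior (Qplus c)) (k : ℤ) : z ∉ segment ℝ (P c k) (P c (k + 1)) := fun h =>
  (lam_pos_of_interior hc hz k).ne' (fst_of_segment hc h).2.2

/-- `Glue` moves only edge points, so the predicate of being this representative descends to the
quotient. Lifting a predicate in this way avoids any analysis of chains of identifications. -/
theorem rep_of_interior {c : ℝ} (hc : 1 ≤ c) {a : Plane} (ha : a ∈ interior (Qplus c))
    {x : Qplus c ⊕ Qminus c} (h : (Quot.mk (Glue c) x : Surface c) = pl c a) :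
    x = Sum.inl ⟨a, interior_subset ha⟩ := by
  let F : Surface c → Prop := Quot.lift (fun x => x = Sum.inl ⟨a, interior_subset ha⟩) (by
    rintro _ _ ⟨k, x, y, hx, hy⟩
    simp only [reduceCtorEq, eq_iff_iff, iff_false, Sum.inl.injEq]
    rintro rfl
    exact not_mem_segment_of_interior hc ha k hx)
  have : F (Quot.mk (Glue c) x) = F (pl c a) := by rw [h]
  rw [pl_of_mem (interior_subset ha)] at this
  exact this.mpr rfl

theorem rep_of_interior_minus {c : ℝ} (hc : 1 ≤ c) {a : Plane} (ha : a ∈ interior (Qminus c))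
    {x : Qplus c ⊕ Qminus c} (h : (Quot.mk (Glue c) x : Surface c) = mi c a) :
    x = Sum.inr ⟨a, interior_subset ha⟩ := by
  let F : Surface c → Prop := Quot.lift (fun x => x = Sum.inr ⟨a, interior_subset ha⟩) (by
    rintro _ _ ⟨k, x, y, hx, hy⟩
    simp only [reduceCtorEq, eq_iff_iff, false_iff, Sum.inr.injEq]
    rintro rfl
    refine not_mem_segment_of_interior hc (interior_Qminus.1 ha) k ?_
    simp only at hy
    rw [hy, neg_sub]
    exact shift_sub_mem_segment hx)
  have : F (Quot.mk (Glue c) x) = F (mi c a) := by rw [h]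
  rw [mi_of_mem (interior_subset ha)] at this
  exact this.mpr rfl

/-- The abscissa of an interior point of an edge determines the edge, so the point takes part in one
identification only and its class has two elements. -/
theorem rep_of_edge {c : ℝ} (hc : 1 ≤ c) {k : ℤ} {a : Plane}
    (ha : a ∈ openSegment ℝ (P c k) (P c (k + 1)))
    {x : Qplus c ⊕ Qminus c} (h : (Quot.mk (Glue c) x : Surface c) = pl c a) :
    (∃ h, x = Sum.inl ⟨a, h⟩) ∨ ∃ h, x = Sum.inr ⟨a - edgeShift c k, h⟩ := by
  have ha' := openSegment_subset_segment ℝ _ _ ha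
  obtain ⟨l0, l1, l2⟩ := fst_of_openSegment hc ha
  let F : Surface c → Prop := Quot.lift
    (fun x => (∃ h, x = Sum.inl ⟨a, h⟩) ∨ ∃ h, x = Sum.inr ⟨a - edgeShift c k, h⟩) (by
    rintro _ _ ⟨m, ⟨x, hx'⟩, ⟨y, hy'⟩, hx, hy⟩
    simp only at hx hy
    have l3 := fst_of_segment hc hx
    simp only [reduceCtorEq, eq_iff_iff, Sum.inl.injEq, Sum.inr.injEq, Subtype.mk.injEq, exists_prop,
      and_false, or_false, false_or]
    constructor
    · rintro ⟨_, rfl⟩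
      obtain rfl := index_unique hc l0 l1 l3.1 l3.2.1
      exact ⟨hy ▸ hy', hy⟩
    · rintro ⟨_, rfl⟩
      have hs := fst_of_segment hc (shift_sub_mem_segment hx)
      have e : edgeShift c k - a = edgeShift c m - x := by rw [← neg_sub, hy, neg_sub]
      rw [← e] at hs
      simp only [edgeShift, Pi.sub_apply, Pi.add_apply] at hs
      obtain rfl := index_unique hc (k := k) (x := P c k 0 + P c (k + 1) 0 - a 0)
        (by linarith) (by linarith) hs.1 hs.2.1
      have : x = a := (sub_right_injective e).symm
      exact ⟨this ▸ hx', this⟩)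
  have : F (Quot.mk (Glue c) x) = F (pl c a) := by rw [h]
  rw [pl_of_mem (segment_subset_Qplus c k ha')] at this
  exact this.mpr (Or.inl ⟨segment_subset_Qplus c k ha', rfl⟩)

/-! ### The translation charts -/

/-- The domain of the chart around the edge `[P_k, P_{k+1}]`: the interiors of `Q_c^+` and of the
translated copy of `Q_c^-` on the other side of the edge, and the open edge. -/
def W (c : ℝ) (k : ℤ) : Set Plane :=
  interior (Qplus c) ∪ {z | P c k 0 < z 0 ∧ z 0 < P c (k + 1) 0} ∪
    {z | edgeShift c k - z ∈ interior (Qplus c)}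

open Classical in
/-- The inverse of the chart around the edge `[P_k, P_{k+1}]`. -/
noncomputable def psi (c : ℝ) (k : ℤ) (z : Plane) : Surface c :=
  if 0 ≤ lam c k z then pl c z else mi c (z - edgeShift c k)

theorem psi_of_nonneg {c : ℝ} {k : ℤ} {z : Plane} (h : 0 ≤ lam c k z) : psi c k z = pl c z :=
  if_pos h

theorem psi_of_neg {c : ℝ} {k : ℤ} {z : Plane} (h : lam c k z < 0) :
    psi c k z = mi c (z - edgeShift c k) := if_neg h.not_ge

theorem isOpen_W (c : ℝ) (k : ℤ) : IsOpen (W c k) := by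
  refine (isOpen_interior.union ?_).union ?_
  · exact (isOpen_lt continuous_const (continuous_apply 0)).inter
      (isOpen_lt (continuous_apply 0) continuous_const)
  · exact isOpen_interior.preimage (continuous_const.sub continuous_id)

theorem interior_subset_W (c : ℝ) (k : ℤ) : interior (Qplus c) ⊆ W c k := fun _ h =>
  Or.inl (Or.inl h)

theorem edge_subset_W {c : ℝ} (hc : 1 ≤ c) (k : ℤ) :
    openSegment ℝ (P c k) (P c (k + 1)) ⊆ W c k := fun _ h =>
  Or.inl (Or.inr ⟨(fst_of_openSegment hc h).1, (fst_of_openSegment hc h).2.1⟩)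

theorem shift_sub_mem_W {c : ℝ} {k : ℤ} {z : Plane} : edgeShift c k - z ∈ W c k ↔ z ∈ W c k := by
  have (z : Plane) (h : z ∈ W c k) : edgeShift c k - z ∈ W c k := by
    rcases h with (h | h) | h
    · exact Or.inr (by simpa using h)
    · refine Or.inl (Or.inr ?_)
      simp only [mem_ofPred_eq, edgeShift, Pi.sub_apply, Pi.add_apply] at h ⊢
      constructor <;> linarith
    · exact Or.inl (Or.inl h)
  exact ⟨fun h => by simpa using this _ h, this z⟩

theorem shift_sub_fst {c : ℝ} {k : ℤ} {z : Plane}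
    (h : P c k 0 < z 0 ∧ z 0 < P c (k + 1) 0) :
    P c k 0 < (edgeShift c k - z) 0 ∧ (edgeShift c k - z) 0 < P c (k + 1) 0 := by
  simp only [edgeShift, Pi.sub_apply, Pi.add_apply]
  constructor <;> linarith

theorem mem_interior_of_W {c : ℝ} (hc : 1 ≤ c) {k : ℤ} {z : Plane} (hz : z ∈ W c k)
    (h : 0 < lam c k z) : z ∈ interior (Qplus c) := by
  rcases hz with (hz | hz) | hz
  · exact hz
  · exact interior_of_strip hc hz.1 hz.2 h
  · have := lam_pos_of_interior hc hz k
    rw [lam_shift_sub] at this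
    linarith

theorem mem_edge_of_W {c : ℝ} (hc : 1 ≤ c) {k : ℤ} {z : Plane} (hz : z ∈ W c k)
    (h : lam c k z = 0) : z ∈ openSegment ℝ (P c k) (P c (k + 1)) := by
  rcases hz with (hz | hz) | hz
  · exact absurd h (lam_pos_of_interior hc hz k).ne'
  · exact openSegment_of_strip hc hz.1 hz.2 h
  · have := lam_pos_of_interior hc hz k
    rw [lam_shift_sub] at this
    linarith

theorem shift_sub_mem_interior_of_W {c : ℝ} (hc : 1 ≤ c) {k : ℤ} {z : Plane} (hz : z ∈ W c k)
    (h : lam c k z < 0) : edgeShift c k - z ∈ interior (Qplus c) :=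
  mem_interior_of_W hc (shift_sub_mem_W.2 hz) (by rw [lam_shift_sub]; linarith)

theorem mem_Qplus_of_W {c : ℝ} (hc : 1 ≤ c) {k : ℤ} {z : Plane} (hz : z ∈ W c k)
    (h : 0 ≤ lam c k z) : z ∈ Qplus c := by
  rcases h.eq_or_lt with h | h
  · exact segment_subset_Qplus c k (openSegment_subset_segment ℝ _ _ (mem_edge_of_W hc hz h.symm))
  · exact interior_subset (mem_interior_of_W hc hz h)

theorem psi_of_nonpos {c : ℝ} (hc : 1 ≤ c) {k : ℤ} {z : Plane} (hz : z ∈ W c k)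
    (h : lam c k z ≤ 0) : psi c k z = mi c (z - edgeShift c k) := by
  rcases h.eq_or_lt with h | h
  · rw [psi_of_nonneg h.ge]
    exact pl_eq_mi (openSegment_subset_segment ℝ _ _ (mem_edge_of_W hc hz h))
  · exact psi_of_neg h

theorem P_notMem_W {c : ℝ} (hc : 1 ≤ c) (j k : ℤ) : P c j ∉ W c k := by
  intro h
  have h0 := lam_P_nonneg hc k j
  rcases h with (h | h) | h
  · exact (lam_pos_of_interior hc h j).ne' (lam_self c j)
  · have a1 := (fst_strictMono hc).lt_iff_lt.1 h.1
    have a2 := (fst_strictMono hc).lt_iff_lt.1 h.2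
    omega
  · have := lam_pos_of_interior hc h k
    rw [lam_shift_sub] at this
    linarith

/-- A point of the image of a chart is represented by only one point of `Q_c^+`. -/
theorem eq_of_psi_eq_pl {c : ℝ} (hc : 1 ≤ c) {k : ℤ} {w a : Plane} (hw : w ∈ W c k)
    (ha : a ∈ Qplus c) (h : psi c k w = pl c a) : w = a := by
  rw [pl_of_mem ha] at h
  rcases lt_trichotomy (lam c k w) 0 with hl | hl | hl
  · rw [psi_of_neg hl] at h
    have := rep_of_interior_minus hc (interior_Qminus.2
      (by simpa using shift_sub_mem_interior_of_W hc hw hl)) h.symm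
    simp at this
  · rw [psi_of_nonneg hl.ge] at h
    rcases rep_of_edge hc (mem_edge_of_W hc hw hl) h.symm with ⟨_, h⟩ | ⟨_, h⟩
    · simpa [eq_comm] using h
    · simp at h
  · rw [psi_of_nonneg hl.le] at h
    have := rep_of_interior hc (mem_interior_of_W hc hw hl) h.symm
    simpa [eq_comm] using this

theorem eq_of_psi_eq_mi {c : ℝ} (hc : 1 ≤ c) {k : ℤ} {w a : Plane} (hw : w ∈ W c k)
    (ha : a ∈ Qminus c) (h : psi c k w = mi c a) : w - edgeShift c k = a := by
  rw [mi_of_mem ha] at h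
  rcases lt_trichotomy (lam c k w) 0 with hl | hl | hl
  · rw [psi_of_neg hl] at h
    have := rep_of_interior_minus hc (interior_Qminus.2
      (by simpa using shift_sub_mem_interior_of_W hc hw hl)) h.symm
    simpa [eq_comm] using this
  · rw [psi_of_nonneg hl.ge] at h
    rcases rep_of_edge hc (mem_edge_of_W hc hw hl) h.symm with ⟨_, h⟩ | ⟨_, h⟩
    · simp at h
    · simpa [eq_comm] using h
  · rw [psi_of_nonneg hl.le] at h
    have := rep_of_interior hc (mem_interior_of_W hc hw hl) h.symm
    simp at this

/-- The transition functions between charts: the identity where the point lies in `Q_c^+`, and a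
translation by the difference of the edge shifts where it lies in `Q_c^-`. -/
theorem psi_eq_psi {c : ℝ} (hc : 1 ≤ c) {k m : ℤ} {z w : Plane} (hz : z ∈ W c k) (hw : w ∈ W c m)
    (h : psi c k z = psi c m w) : (0 ≤ lam c m w ∧ z = w) ∨
      (lam c m w < 0 ∧ z - edgeShift c k = w - edgeShift c m) := by
  rcases le_or_gt 0 (lam c m w) with hl | hl
  · rw [psi_of_nonneg hl] at h
    exact Or.inl ⟨hl, eq_of_psi_eq_pl hc hz (mem_Qplus_of_W hc hw hl) h⟩
  · rw [psi_of_neg hl] at h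
    refine Or.inr ⟨hl, eq_of_psi_eq_mi hc hz ?_ h⟩
    exact sub_shift_mem_Qminus.2 (interior_subset (shift_sub_mem_interior_of_W hc hw hl))

theorem eventually_add_mem {U : Set Plane} (hU : IsOpen U) {z : Plane} (hz : z ∈ U) :
    ∀ᶠ v in 𝓝 (0 : Plane), z + v ∈ U := by
  have : ContinuousAt (fun v : Plane => z + v) 0 := by fun_prop
  exact this.eventually_mem (by simpa using hU.mem_nhds hz)

theorem eventually_lam_pos {c : ℝ} {k : ℤ} {z : Plane} (h : 0 < lam c k z) :
    ∀ᶠ v in 𝓝 (0 : Plane), 0 < lam c k (z + v) :=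
  eventually_add_mem (isOpen_lt continuous_const (continuous_lam c k)) h

theorem eventually_lam_neg {c : ℝ} {k : ℤ} {z : Plane} (h : lam c k z < 0) :
    ∀ᶠ v in 𝓝 (0 : Plane), lam c k (z + v) < 0 :=
  eventually_add_mem (isOpen_lt (continuous_lam c k) continuous_const) h

/-- Two charts agree near a point or differ near it. -/
theorem psi_dichotomy {c : ℝ} (hc : 1 ≤ c) {k m : ℤ} {z w : Plane} (hz : z ∈ W c k)
    (hw : w ∈ W c m) : (∀ᶠ v in 𝓝 (0 : Plane), psi c k (z + v) = psi c m (w + v)) ∨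
      ∀ᶠ v in 𝓝 (0 : Plane), psi c k (z + v) ≠ psi c m (w + v) := by
  have hzW := eventually_add_mem (isOpen_W c k) hz
  have hwW := eventually_add_mem (isOpen_W c m) hw
  by_cases h1 : k = m
  · subst h1
    by_cases h2 : z = w
    · exact Or.inl (by simp [h2])
    · right
      filter_upwards [hzW, hwW] with v h3 h4 h5
      rcases psi_eq_psi hc h3 h4 h5 with ⟨_, h⟩ | ⟨_, h⟩
      · exact h2 (add_right_cancel h)
      · exact h2 (add_right_cancel (sub_left_injective h))
  by_cases h2 : z = w
  · subst h2
    have hne : ∀ v : Plane, lam c m (z + v) < 0 → z + v ∈ W c k → z + v ∈ W c m →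
        psi c k (z + v) ≠ psi c m (z + v) ∨ edgeShift c k = edgeShift c m := by
      intro v h3 h4 h5
      by_cases h : psi c k (z + v) = psi c m (z + v)
      · rcases psi_eq_psi hc h4 h5 h with ⟨h', _⟩ | ⟨_, h'⟩
        · linarith
        · exact Or.inr (sub_right_injective h')
      · exact Or.inl h
    -- Charts of different edges with the same planar coordinates cannot agree on the side of
    -- `Q_c^-`; they agree exactly on the side of `Q_c^+`.
    have hshift : edgeShift c k ≠ edgeShift c m := by
      intro h
      have e := congrFun h 0
      simp only [edgeShift, Pi.add_apply] at e
      rcases lt_or_gt_of_ne h1 with h | h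
      · linarith [fst_strictMono hc h, fst_strictMono hc (show k + 1 < m + 1 by omega)]
      · linarith [fst_strictMono hc h, fst_strictMono hc (show m + 1 < k + 1 by omega)]
    rcases lt_trichotomy (lam c m z) 0 with hl | hl | hl
    · right
      filter_upwards [hzW, hwW, eventually_lam_neg hl] with v h3 h4 h5
      exact (hne v h5 h3 h4).resolve_right hshift
    -- If `z` is on edge `m`, it lies strictly below edge `k`, since it cannot be on another edge or
    -- in the interior. The roles of the two charts are therefore exchanged.
    · right
      have hm := mem_edge_of_W hc hw hl
      obtain ⟨l0, l1, l2⟩ := fst_of_openSegment hc hm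
      have hk : lam c k z < 0 := by
        by_contra! h
        rcases h.eq_or_lt with h | h
        · obtain ⟨l3, l4, -⟩ := fst_of_openSegment hc (mem_edge_of_W hc hz h.symm)
          exact h1 (index_unique hc l0 l1 l3.le l4.le)
        · exact (lam_pos_of_interior hc (mem_interior_of_W hc hz h) m).ne' hl
      filter_upwards [hzW, hwW, eventually_lam_neg hk] with v h3 h4 h5 h6
      rcases psi_eq_psi hc h4 h3 h6.symm with ⟨h', _⟩ | ⟨_, h'⟩
      · linarith
      · exact hshift (sub_right_injective h').symm
    · left
      have hint := mem_interior_of_W hc hw hl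
      filter_upwards [eventually_add_mem isOpen_interior hint] with v hv
      rw [psi_of_nonneg (lam_pos_of_interior hc hv _).le,
        psi_of_nonneg (lam_pos_of_interior hc hv _).le]
  -- Now the coordinates differ, so agreement is possible only in `Q_c^-`, and only if both describe
  -- the same point there.
  by_cases h3 : z - edgeShift c k = w - edgeShift c m
  · have h3v (v : Plane) : z + v - edgeShift c k = w + v - edgeShift c m := by
      rw [add_sub_right_comm, h3, add_sub_right_comm]
    rcases lt_trichotomy (lam c m w) 0 with hl | hl | hl
    · left
      have hint := shift_sub_mem_interior_of_W hc hw hl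
      have : ∀ᶠ v in 𝓝 (0 : Plane), lam c k (z + v) < 0 := by
        refine eventually_lam_neg ?_
        rw [← neg_sub, ← h3, neg_sub] at hint
        have := lam_pos_of_interior hc hint k
        rw [lam_shift_sub] at this
        linarith
      filter_upwards [eventually_lam_neg hl, this] with v h4 h5
      rw [psi_of_neg h4, psi_of_neg h5, h3v]
    · right
      have hk : 0 < lam c k z := by
        by_contra! h
        rcases h.eq_or_lt with h | h
        · obtain ⟨l0, l1, -⟩ := fst_of_openSegment hc (mem_edge_of_W hc hz h)
          obtain ⟨l3, l4, -⟩ := fst_of_openSegment hc (mem_edge_of_W hc hw hl)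
          have e := congrFun h3 0
          simp only [edgeShift, Pi.add_apply, Pi.sub_apply] at e
          refine h1 (index_unique hc (x := P c k 0 + P c (k + 1) 0 - z 0) ?_ ?_ ?_ ?_).symm <;>
            linarith
        · have hint := shift_sub_mem_interior_of_W hc hz h
          rw [← neg_sub, h3, neg_sub] at hint
          have := lam_pos_of_interior hc hint m
          rw [lam_shift_sub] at this
          linarith
      filter_upwards [hzW, hwW, eventually_lam_pos hk] with v h4 h5 h6 h7
      rcases psi_eq_psi hc h5 h4 h7.symm with ⟨_, h'⟩ | ⟨h', _⟩
      · exact h2 (add_right_cancel h').symm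
      · linarith
    · right
      filter_upwards [hzW, hwW, eventually_lam_pos hl] with v h4 h5 h6 h7
      rcases psi_eq_psi hc h4 h5 h7 with ⟨_, h'⟩ | ⟨h', _⟩
      · exact h2 (add_right_cancel h')
      · linarith
  · right
    filter_upwards [hzW, hwW] with v h4 h5 h6
    rcases psi_eq_psi hc h4 h5 h6 with ⟨_, h⟩ | ⟨_, h⟩
    · exact h2 (add_right_cancel h)
    · refine h3 ?_
      rw [add_sub_right_comm, add_sub_right_comm w] at h
      exact add_right_cancel h

/-- The three kinds of charts are all germs of maps `psi`. An interior point of either polygon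
belongs to the chart of every edge, so index 0 serves for it. -/
theorem isChartAt_iff {c : ℝ} (hc : 1 ≤ c) {p : Surface c} {γ : Plane → Surface c} :
    IsChartAt c p γ ↔
      γ 0 = p ∧ ∃ k, ∃ z ∈ W c k, ∀ᶠ v in 𝓝 (0 : Plane), γ v = psi c k (z + v) := by
  constructor
  · rintro (⟨z, hz, h0, h⟩ | ⟨z, hz, h0, h⟩ | ⟨k, z, hz, h0, h⟩)
    · refine ⟨h0, 0, z, interior_subset_W c 0 hz, ?_⟩
      filter_upwards [h] with v ⟨hv, e⟩
      rw [e, psi_of_nonneg (lam_nonneg_of_mem hc hv 0), pl_of_mem hv]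
    · have hz' := interior_Qminus.1 hz
      have hW : z + edgeShift c 0 ∈ W c 0 := Or.inr (by simpa using hz')
      refine ⟨h0, 0, z + edgeShift c 0, hW, ?_⟩
      have : lam c 0 (z + edgeShift c 0) < 0 := by
        have := lam_pos_of_interior hc hz' 0
        rw [show -z = edgeShift c 0 - (z + edgeShift c 0) by abel, lam_shift_sub] at this
        linarith
      filter_upwards [h, eventually_lam_neg this] with v ⟨hv, e⟩ h'
      rw [e, psi_of_neg h', show z + edgeShift c 0 + v - edgeShift c 0 = z + v by abel,
        mi_of_mem hv]
    · refine ⟨h0, k, z, edge_subset_W hc k hz, ?_⟩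
      filter_upwards [h, eventually_add_mem (isOpen_W c k) (edge_subset_W hc k hz)] with v h hW
      rcases h with ⟨hv, e⟩ | ⟨hv, e⟩
      · rw [e, psi_of_nonneg (lam_nonneg_of_mem hc hv k), pl_of_mem hv]
      · rw [e, psi_of_nonpos hc hW, mi_of_mem hv]
        have := lam_nonneg_of_mem hc (sub_shift_mem_Qminus.1 hv) k
        rw [lam_shift_sub] at this
        linarith
  · rintro ⟨h0, k, z, hz, h⟩
    have hW := eventually_add_mem (isOpen_W c k) hz
    rcases lt_trichotomy (lam c k z) 0 with hl | hl | hl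
    · refine .minus (z - edgeShift c k) ?_ h0 ?_
      · rw [interior_Qminus, neg_sub]
        exact shift_sub_mem_interior_of_W hc hz hl
      · filter_upwards [h, hW, eventually_lam_neg hl] with v e hv hv'
        have hQ : z - edgeShift c k + v ∈ Qminus c := by
          rw [← add_sub_right_comm, sub_shift_mem_Qminus]
          exact interior_subset (shift_sub_mem_interior_of_W hc hv hv')
        refine ⟨hQ, ?_⟩
        rw [e, psi_of_neg hv', ← mi_of_mem, add_sub_right_comm]
    · refine .edge k z (mem_edge_of_W hc hz hl) h0 ?_
      filter_upwards [h, hW] with v e hv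
      rcases le_or_gt 0 (lam c k (z + v)) with hv' | hv'
      · have hQ := mem_Qplus_of_W hc hv hv'
        exact Or.inl ⟨hQ, by rw [e, psi_of_nonneg hv', pl_of_mem hQ]⟩
      · have hQ := sub_shift_mem_Qminus.2
          (interior_subset (shift_sub_mem_interior_of_W hc hv hv'))
        exact Or.inr ⟨hQ, by rw [e, psi_of_neg hv', mi_of_mem hQ]⟩
    · refine .plus z (mem_interior_of_W hc hz hl) h0 ?_
      filter_upwards [h, hW, eventually_lam_pos hl] with v e hv hv'
      have hQ := mem_Qplus_of_W hc hv hv'.le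
      exact ⟨hQ, by rw [e, psi_of_nonneg hv'.le, pl_of_mem hQ]⟩

theorem isChartAt_psi {c : ℝ} (hc : 1 ≤ c) {k : ℤ} {z : Plane} (hz : z ∈ W c k) :
    IsChartAt c (psi c k z) fun v => psi c k (z + v) :=
  (isChartAt_iff hc).2 ⟨by simp, k, z, hz, by simp⟩

theorem IsChartAt.congr {c : ℝ} {p : Surface c} (hc : 1 ≤ c) {γ γ' : Plane → Surface c}
    (h : IsChartAt c p γ) (h' : γ =ᶠ[𝓝 0] γ') : IsChartAt c p γ' := by
  obtain ⟨h0, k, z, hz, hv⟩ := (isChartAt_iff hc).1 h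
  refine (isChartAt_iff hc).2 ⟨h'.self_of_nhds ▸ h0, k, z, hz, ?_⟩
  filter_upwards [hv, h'] with v h1 h2
  rw [← h2, h1]

theorem continuousAt_psi {c : ℝ} (hc : 1 ≤ c) {k : ℤ} {z : Plane} (hz : z ∈ W c k) :
    ContinuousAt (psi c k) z := by
  have hplus : ContinuousOn (psi c k) (W c k ∩ {z | 0 ≤ lam c k z}) :=
    ((continuousOn_pl c).mono fun w hw => mem_Qplus_of_W hc hw.1 hw.2).congr
      fun w hw => psi_of_nonneg hw.2
  have hminus : ContinuousOn (psi c k) (W c k ∩ {z | lam c k z ≤ 0}) := by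
    have : ContinuousOn (fun z => mi c (z - edgeShift c k)) (W c k ∩ {z | lam c k z ≤ 0}) := by
      refine (continuousOn_mi c).comp (by fun_prop) fun w hw => ?_
      rw [sub_shift_mem_Qminus]
      exact mem_Qplus_of_W hc (shift_sub_mem_W.2 hw.1)
        (by rw [lam_shift_sub]; exact neg_nonneg.2 hw.2)
    exact this.congr fun w hw => psi_of_nonpos hc hw.1 hw.2
  have hW := (isOpen_W c k).mem_nhds hz
  have hcl1 : IsClosed {z | 0 ≤ lam c k z} := isClosed_le continuous_const (continuous_lam c k)
  have hcl2 : IsClosed {z | lam c k z ≤ 0} := isClosed_le (continuous_lam c k) continuous_const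
  have h1 : ContinuousWithinAt (psi c k) (W c k ∩ {z | 0 ≤ lam c k z}) z := by
    by_cases h : 0 ≤ lam c k z
    · exact hplus z ⟨hz, h⟩
    · exact continuousWithinAt_of_notMem_closure fun h' =>
        h ((hcl1.closure_subset_iff.2 inter_subset_right) h')
  have h2 : ContinuousWithinAt (psi c k) (W c k ∩ {z | lam c k z ≤ 0}) z := by
    by_cases h : lam c k z ≤ 0
    · exact hminus z ⟨hz, h⟩
    · exact continuousWithinAt_of_notMem_closure fun h' =>
        h ((hcl2.closure_subset_iff.2 inter_subset_right) h')
  refine (h1.union h2).continuousAt (mem_of_superset hW fun w hw => ?_)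
  rcases le_total 0 (lam c k w) with h | h
  · exact Or.inl ⟨hw, h⟩
  · exact Or.inr ⟨hw, h⟩

/-! ### Flat maps and their unique continuation -/

section Flat

variable {E : Type*} [NormedAddCommGroup E] [NormedSpace ℝ E]

/-- Near `x`, the map `σ` is the linear map `L` in the translation charts. -/
def Flat {c : ℝ} (L : E →L[ℝ] Plane) (σ : E → Surface c) (x : E) : Prop :=
  ∃ k, ∃ z ∈ W c k, ∀ᶠ s in 𝓝 (0 : E), σ (x + s) = psi c k (z + L s)

theorem Flat.dichotomy {c : ℝ} (hc : 1 ≤ c) {L : E →L[ℝ] Plane} {σ τ : E → Surface c} {x : E}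
    (hσ : Flat L σ x) (hτ : Flat L τ x) : (∀ᶠ y in 𝓝 x, σ y = τ y) ∨ ∀ᶠ y in 𝓝 x, σ y ≠ τ y := by
  obtain ⟨k, z, hz, h1⟩ := hσ
  obtain ⟨m, w, hw, h2⟩ := hτ
  have hL : Tendsto L (𝓝 0) (𝓝 0) := by simpa using L.continuous.tendsto 0
  have hx : Tendsto (fun y => y - x) (𝓝 x) (𝓝 0) := by
    have : Continuous fun y : E => y - x := by fun_prop
    simpa using this.tendsto x
  refine (psi_dichotomy hc hz hw).imp (fun h => ?_) (fun h => ?_)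
  · filter_upwards [hx.eventually h1, hx.eventually h2, hx.eventually (hL.eventually h)]
      with y e1 e2 e3
    rw [add_sub_cancel] at e1 e2
    rw [e1, e2, e3]
  · filter_upwards [hx.eventually h1, hx.eventually h2, hx.eventually (hL.eventually h)]
      with y e1 e2 e3
    rw [add_sub_cancel] at e1 e2
    rw [e1, e2]
    exact e3

/-- Flat maps on a connected set that agree at one point are equal. -/
theorem Flat.eqOn {c : ℝ} (hc : 1 ≤ c) {L : E →L[ℝ] Plane} {σ τ : E → Surface c} {I : Set E}
    (hI : IsPreconnected I) (hσ : ∀ x ∈ I, Flat L σ x) (hτ : ∀ x ∈ I, Flat L τ x) {x₀ : E}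
    (hx₀ : x₀ ∈ I) (h : σ x₀ = τ x₀) : EqOn σ τ I := by
  -- Local agreement and local disagreement are open and disjoint, and by the dichotomy they cover
  -- `I`. No separation property of the surface is needed.
  have hU : IsOpen {x | ∀ᶠ y in 𝓝 x, σ y = τ y} := isOpen_setOfPred_eventually_nhds
  have hV : IsOpen {x | ∀ᶠ y in 𝓝 x, σ y ≠ τ y} := isOpen_setOfPred_eventually_nhds
  have hd : Disjoint {x | ∀ᶠ y in 𝓝 x, σ y = τ y} {x | ∀ᶠ y in 𝓝 x, σ y ≠ τ y} :=
    Set.disjoint_left.2 fun x h1 h2 => h2.self_of_nhds h1.self_of_nhds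
  have hsub := hI.subset_left_of_subset_union hU hV hd
    (fun x hx => (hσ x hx).dichotomy hc (hτ x hx))
    ⟨x₀, hx₀, ((hσ x₀ hx₀).dichotomy hc (hτ x₀ hx₀)).resolve_right
      fun h' => h'.self_of_nhds h⟩
  exact fun x hx => (hsub hx).self_of_nhds

theorem Flat.continuousAt {c : ℝ} (hc : 1 ≤ c) {L : E →L[ℝ] Plane} {σ : E → Surface c} {x : E}
    (hσ : Flat L σ x) : ContinuousAt σ x := by
  obtain ⟨k, z, hz, h⟩ := hσ
  have hx : Tendsto (fun y => y - x) (𝓝 x) (𝓝 0) := by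
    have : Continuous fun y : E => y - x := by fun_prop
    simpa using this.tendsto x
  have h' : σ =ᶠ[𝓝 x] fun y => psi c k (z + L (y - x)) := by
    filter_upwards [hx.eventually h] with y hy
    rwa [add_sub_cancel] at hy
  refine ContinuousAt.congr ?_ h'.symm
  have hf : ContinuousAt (fun y => z + L (y - x)) x := by fun_prop
  exact ContinuousAt.comp (by simpa using continuousAt_psi hc hz) hf

/-- The composition of a chart with an affine map is flat. -/
theorem flat_psi {c : ℝ} {k : ℤ} (L : E →L[ℝ] Plane) {z : Plane} {x : E} (hz : z + L x ∈ W c k) :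
    Flat L (fun y => psi c k (z + L y)) x :=
  ⟨k, z + L x, hz, by simp [add_assoc]⟩

end Flat

theorem isChartAt_iff_flat {c : ℝ} (hc : 1 ≤ c) {Φ : Plane → Surface c} {z : Plane} :
    IsChartAt c (Φ z) (fun v => Φ (z + v)) ↔ Flat (.id ℝ Plane) Φ z := by
  simp [isChartAt_iff hc, Flat]

/-- A chart cannot be extended to a vertex. -/
theorem ray_not_psi {c : ℝ} (hc : 1 ≤ c) {j : ℤ} {d : Plane}
    (hd : ∀ᶠ t in 𝓝[>] (0 : ℝ), P c j + t • d ∈ Qplus c) {k : ℤ} {z : Plane} (hz : z ∈ W c k)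
    (h : ∀ᶠ t in 𝓝[>] (0 : ℝ), pl c (P c j + t • d) = psi c k (z + t • d)) : False := by
  have ht : Tendsto (fun t : ℝ => t • d) (𝓝[>] 0) (𝓝 0) := by
    have : Continuous fun t : ℝ => t • d := by fun_prop
    simpa using (this.tendsto 0).mono_left nhdsWithin_le_nhds
  obtain ⟨t, h1, h2, h3⟩ :=
    (hd.and (h.and (ht.eventually (eventually_add_mem (isOpen_W c k) hz)))).exists
  have := add_right_cancel (eq_of_psi_eq_pl hc h3 h1 h2.symm)
  exact P_notMem_W hc j k (this ▸ hz)

/-! ### Affine maps in charts -/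

theorem IsChartAt.map {c : ℝ} (hc : 1 ≤ c) {f : Surface c → Surface c}
    {B : Matrix (Fin 2) (Fin 2) ℝ}
    (hf : ∀ k, ∀ z ∈ W c k, IsChartAt c (f (psi c k z)) fun v => f (psi c k (z + B.mulVec v)))
    {p : Surface c} {γ : Plane → Surface c} (h : IsChartAt c p γ) :
    IsChartAt c (f p) fun v => f (γ (B.mulVec v)) := by
  obtain ⟨h0, k, z, hz, hv⟩ := (isChartAt_iff hc).1 h
  have hp : p = psi c k z := by
    have := hv.self_of_nhds
    rw [add_zero, h0] at this
    exact this
  have ht : Tendsto (fun v : Plane => B.mulVec v) (𝓝 0) (𝓝 0) := by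
    have : Continuous fun v : Plane => B.mulVec v := continuous_const.matrix_mulVec continuous_id
    simpa using this.tendsto 0
  rw [hp]
  refine (hf k z hz).congr hc ?_
  filter_upwards [ht.eventually hv] with v e
  rw [e]

theorem hasDerivative_of_charts {c : ℝ} (hc : 1 ≤ c) {f : Surface c ≃ₜ Surface c}
    {A : GL (Fin 2) ℝ}
    (h : ∀ k, ∀ z ∈ W c k, IsChartAt c (f (psi c k z)) fun v =>
      f (psi c k (z + ((A⁻¹ : GL (Fin 2) ℝ) : Matrix (Fin 2) (Fin 2) ℝ).mulVec v)))
    (h' : ∀ k, ∀ z ∈ W c k, IsChartAt c (f.symm (psi c k z)) fun v =>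
      f.symm (psi c k (z + (A : Matrix (Fin 2) (Fin 2) ℝ).mulVec v))) : HasDerivative f A := by
  intro p γ
  refine ⟨fun hγ => hγ.map hc h, fun hγ => ?_⟩
  have := hγ.map hc h'
  have hA : ((A⁻¹ : GL (Fin 2) ℝ) : Matrix (Fin 2) (Fin 2) ℝ) * (A : Matrix (Fin 2) (Fin 2) ℝ)
      = 1 := by
    rw [← Units.val_mul, inv_mul_cancel, Units.val_one]
  simpa only [Homeomorph.symm_apply_apply, Matrix.mulVec_mulVec, hA, Matrix.one_mulVec] using this

theorem isChartAt_of_psi {c : ℝ} (hc : 1 ≤ c) {f : Surface c → Surface c} {k m : ℤ} {z w : Plane}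
    {B : Matrix (Fin 2) (Fin 2) ℝ} (hw : w ∈ W c m)
    (h : ∀ᶠ v in 𝓝 (0 : Plane), f (psi c k (z + B.mulVec v)) = psi c m (w + v)) :
    IsChartAt c (f (psi c k z)) fun v => f (psi c k (z + B.mulVec v)) :=
  (isChartAt_iff hc).2 ⟨by simp, m, w, hw, h⟩

/-- The homeomorphism of the surface induced by an involution of the two polygons. -/
def homeoOfInvolution {c : ℝ} {g : Qplus c ⊕ Qminus c → Qplus c ⊕ Qminus c} (hg : Continuous g)
    (h2 : ∀ x, g (g x) = x)
    (hG : ∀ x y, Glue c x y → (Quot.mk (Glue c) (g x)) = Quot.mk (Glue c) (g y)) :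
    Surface c ≃ₜ Surface c where
  toFun := Quot.lift (fun x => Quot.mk (Glue c) (g x)) hG
  invFun := Quot.lift (fun x => Quot.mk (Glue c) (g x)) hG
  left_inv := by rintro ⟨x⟩; exact congrArg (Quot.mk (Glue c)) (h2 x)
  right_inv := by rintro ⟨x⟩; exact congrArg (Quot.mk (Glue c)) (h2 x)
  continuous_toFun := continuous_quot_lift hG ((continuous_mk c).comp hg)
  continuous_invFun := continuous_quot_lift hG ((continuous_mk c).comp hg)

/-! ### The rotation by `π` -/

/-- The automorphism that swaps the two polygons. -/
def rotation (c : ℝ) : Surface c ≃ₜ Surface c :=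
  homeoOfInvolution
    (g := Sum.elim (fun x => Sum.inr ⟨-x, neg_mem_Qminus.2 x.2⟩)
      (fun y => Sum.inl ⟨-y, mem_Qminus.1 y.2⟩))
    (by
      refine Continuous.sumElim ?_ ?_
      · exact continuous_inr.comp (Continuous.subtype_mk (by fun_prop) _)
      · exact continuous_inl.comp (Continuous.subtype_mk (by fun_prop) _))
    (by rintro (x | x) <;> simp)
    (by
      rintro _ _ ⟨k, x, y, hx, hy⟩
      refine (Quot.sound (Glue.edge k _ _ ?_ ?_)).symm
      · show -(y : Plane) ∈ _
        rw [hy, neg_sub]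
        exact shift_sub_mem_segment hx
      · show -(x : Plane) = -(y : Plane) - _
        rw [hy]; abel)

theorem rotation_pl {c : ℝ} {z : Plane} (hz : z ∈ Qplus c) : rotation c (pl c z) = mi c (-z) := by
  rw [pl_of_mem hz, mi_of_mem (neg_mem_Qminus.2 hz)]; rfl

theorem rotation_mi {c : ℝ} {z : Plane} (hz : z ∈ Qminus c) : rotation c (mi c z) = pl c (-z) := by
  rw [mi_of_mem hz, pl_of_mem (mem_Qminus.1 hz)]; rfl

theorem rotation_rotation {c : ℝ} (p : Surface c) : rotation c (rotation c p) = p :=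
  (rotation c).left_inv p

/-- In the chart of each edge the rotation is the half-turn about the midpoint of the edge. Later
arguments treat `Q_c^+` directly and transfer to `Q_c^-` through this formula. -/
theorem rotation_psi {c : ℝ} (hc : 1 ≤ c) {k : ℤ} {z : Plane} (hz : z ∈ W c k) :
    rotation c (psi c k z) = psi c k (edgeShift c k - z) := by
  rcases le_or_gt 0 (lam c k z) with h | h
  · rw [psi_of_nonneg h, rotation_pl (mem_Qplus_of_W hc hz h),
      psi_of_nonpos hc (shift_sub_mem_W.2 hz) (by rw [lam_shift_sub]; linarith),
      sub_sub_cancel_left]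
  · rw [psi_of_neg h, psi_of_nonneg (by rw [lam_shift_sub]; linarith), rotation_mi, neg_sub]
    exact sub_shift_mem_Qminus.2 (interior_subset (shift_sub_mem_interior_of_W hc hz h))

theorem rotation_hasDerivative {c : ℝ} (hc : 1 ≤ c) : HasDerivative (rotation c) (-1) := by
  have key : ∀ k, ∀ z ∈ W c k, IsChartAt c (rotation c (psi c k z)) fun v =>
      rotation c (psi c k (z + (-1 : Matrix (Fin 2) (Fin 2) ℝ).mulVec v)) := by
    intro k z hz
    refine isChartAt_of_psi hc (shift_sub_mem_W.2 hz) ?_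
    have ht : Tendsto (fun v : Plane => -v) (𝓝 0) (𝓝 0) := by
      simpa using (continuous_neg (G := Plane)).tendsto 0
    filter_upwards [ht.eventually (eventually_add_mem (isOpen_W c k) hz)] with v hv
    rw [Matrix.neg_mulVec, Matrix.one_mulVec, rotation_psi hc hv]
    congr 1; abel
  refine hasDerivative_of_charts hc ?_ ?_
  · simpa using key
  · exact key

/-! ### The reflection -/

/-- The reflection in the vertical axis. -/
def refl (z : Plane) : Plane := ![-z 0, z 1]

theorem refl_refl (z : Plane) : refl (refl z) = z := by
  ext i; fin_cases i <;> simp [refl]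

theorem continuous_refl : Continuous refl := by
  unfold refl
  refine continuous_pi fun i => ?_
  fin_cases i
  · exact (continuous_apply 0).neg
  · exact continuous_apply 1

theorem refl_neg (z : Plane) : refl (-z) = -refl z := by
  ext i; fin_cases i <;> simp [refl]

theorem refl_add (z w : Plane) : refl (z + w) = refl z + refl w := by
  ext i; fin_cases i <;> simp [refl]; ring

theorem refl_sub (z w : Plane) : refl (z - w) = refl z - refl w := by
  ext i; fin_cases i <;> simp [refl]; ring

theorem refl_P (c : ℝ) (k : ℤ) : refl (P c k) = P c (-k) := by
  ext i; fin_cases i <;> simp [refl, P_neg_fst, P_neg_snd]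

theorem P_neg_one_sub_succ (c : ℝ) (k : ℤ) : P c (-1 - k + 1) = P c (-k) := by
  congr 1; ring

theorem P_neg_one_sub (c : ℝ) (k : ℤ) : P c (-1 - k) = P c (-(k + 1)) := by
  congr 1; ring

/-- The mirror image of the edge from `P_k` to `P_{k+1}` runs from `P_{-k}` back to `P_{-k-1}`, so
its index is `-1 - k`. -/
theorem refl_shift (c : ℝ) (k : ℤ) : refl (edgeShift c k) = edgeShift c (-1 - k) := by
  rw [edgeShift, edgeShift, refl_add, refl_P, refl_P, P_neg_one_sub_succ, P_neg_one_sub, add_comm]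

theorem lam_refl (c : ℝ) (k : ℤ) (z : Plane) : lam c (-1 - k) (refl z) = lam c k z := by
  rw [lam_eq, lam_eq, P_neg_one_sub_succ, P_neg_one_sub]
  simp only [P_neg_fst, P_neg_snd, refl]
  simp; ring

theorem refl_mem {c : ℝ} (hc : 1 ≤ c) {z : Plane} (hz : z ∈ Qplus c) : refl z ∈ Qplus c := by
  rw [mem_Qplus_iff hc] at hz ⊢
  intro m
  rw [show m = -1 - (-1 - m) by ring, lam_refl]
  exact hz _

theorem refl_mem_minus {c : ℝ} (hc : 1 ≤ c) {z : Plane} (hz : z ∈ Qminus c) :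
    refl z ∈ Qminus c := by
  rw [mem_Qminus] at hz ⊢
  rw [← refl_neg]
  exact refl_mem hc hz

theorem refl_mem_interior {c : ℝ} (hc : 1 ≤ c) {z : Plane} (hz : z ∈ interior (Qplus c)) :
    refl z ∈ interior (Qplus c) := by
  refine interior_maximal (t := refl ⁻¹' interior (Qplus c)) (fun w hw => ?_)
    (isOpen_interior.preimage continuous_refl) (by simpa [refl_refl] using hz)
  rw [← refl_refl w]
  exact refl_mem hc (interior_subset hw)

theorem refl_mem_W {c : ℝ} (hc : 1 ≤ c) {k : ℤ} {z : Plane} (hz : z ∈ W c k) :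
    refl z ∈ W c (-1 - k) := by
  rcases hz with (h | h) | h
  · exact Or.inl (Or.inl (refl_mem_interior hc h))
  · refine Or.inl (Or.inr ?_)
    simp only [mem_ofPred_eq, P_neg_one_sub_succ, P_neg_one_sub, P_neg_fst] at h ⊢
    simp only [refl, Matrix.cons_val_zero]
    constructor <;> linarith
  · refine Or.inr ?_
    rw [mem_ofPred_eq, ← refl_shift, ← refl_sub]
    exact refl_mem_interior hc h

/-- The automorphism that acts on both polygons by the reflection in the vertical axis. -/
def reflection {c : ℝ} (hc : 1 ≤ c) : Surface c ≃ₜ Surface c :=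
  homeoOfInvolution
    (g := Sum.map (fun x => ⟨refl x, refl_mem hc x.2⟩) (fun y => ⟨refl y, refl_mem_minus hc y.2⟩))
    (by
      refine Continuous.sumMap ?_ ?_
      · exact Continuous.subtype_mk (continuous_refl.comp continuous_subtype_val) _
      · exact Continuous.subtype_mk (continuous_refl.comp continuous_subtype_val) _)
    (by rintro (x | x) <;> simp [refl_refl])
    (by
      rintro _ _ ⟨k, x, y, hx, hy⟩
      refine Quot.sound (Glue.edge (-1 - k) _ _ ?_ ?_)
      · show refl (x : Plane) ∈ _
        rw [P_neg_one_sub_succ, P_neg_one_sub, ← refl_P, ← refl_P, segment_symm]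
        obtain ⟨a, b, ha, hb, hab, h⟩ := hx
        refine ⟨a, b, ha, hb, hab, ?_⟩
        rw [← h]
        ext i; fin_cases i <;> simp [refl]; ring
      · show refl (y : Plane) = refl (x : Plane) - _
        rw [hy, refl_sub, refl_shift])

theorem reflection_pl {c : ℝ} (hc : 1 ≤ c) {z : Plane} (hz : z ∈ Qplus c) :
    reflection hc (pl c z) = pl c (refl z) := by
  rw [pl_of_mem hz, pl_of_mem (refl_mem hc hz)]; rfl

theorem reflection_mi {c : ℝ} (hc : 1 ≤ c) {z : Plane} (hz : z ∈ Qminus c) :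
    reflection hc (mi c z) = mi c (refl z) := by
  rw [mi_of_mem hz, mi_of_mem (refl_mem_minus hc hz)]; rfl

theorem reflection_psi {c : ℝ} (hc : 1 ≤ c) {k : ℤ} {z : Plane} (hz : z ∈ W c k) :
    reflection hc (psi c k z) = psi c (-1 - k) (refl z) := by
  rcases le_or_gt 0 (lam c k z) with h | h
  · rw [psi_of_nonneg h, reflection_pl hc (mem_Qplus_of_W hc hz h),
      psi_of_nonneg (by rwa [lam_refl])]
  · rw [psi_of_neg h, psi_of_neg (by rwa [lam_refl]), reflection_mi, refl_sub, refl_shift]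
    exact sub_shift_mem_Qminus.2 (interior_subset (shift_sub_mem_interior_of_W hc hz h))

/-- The matrix of the reflection in the vertical axis. -/
def reflGL : GL (Fin 2) ℝ where
  val := !![-1, 0; 0, 1]
  inv := !![-1, 0; 0, 1]
  val_inv := by ext i j; fin_cases i <;> fin_cases j <;> simp
  inv_val := by ext i j; fin_cases i <;> fin_cases j <;> simp

theorem reflGL_mulVec (v : Plane) : (reflGL : Matrix (Fin 2) (Fin 2) ℝ).mulVec v = refl v := by
  ext i; fin_cases i <;> simp [reflGL, refl, Matrix.mulVec, dotProduct]

theorem reflGL_inv : reflGL⁻¹ = reflGL := Units.ext rfl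

theorem reflection_hasDerivative {c : ℝ} (hc : 1 ≤ c) : HasDerivative (reflection hc) reflGL := by
  have key : ∀ k, ∀ z ∈ W c k, IsChartAt c (reflection hc (psi c k z)) fun v =>
      reflection hc (psi c k (z + (reflGL : Matrix (Fin 2) (Fin 2) ℝ).mulVec v)) := by
    intro k z hz
    refine isChartAt_of_psi hc (refl_mem_W hc hz) ?_
    have ht : Tendsto refl (𝓝 0) (𝓝 0) := by
      have := continuous_refl.tendsto 0
      rwa [show refl 0 = 0 by ext i; fin_cases i <;> simp [refl]] at this
    filter_upwards [ht.eventually (eventually_add_mem (isOpen_W c k) hz)] with v hv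
    rw [reflGL_mulVec, reflection_psi hc hv, refl_add, refl_refl]
  refine hasDerivative_of_charts hc ?_ key
  rw [reflGL_inv]
  exact key

theorem isPieceSwap_rotation (c : ℝ) : IsPieceSwap (rotation c) :=
  ⟨fun _ hz => ⟨neg_mem_Qminus.2 hz, rfl⟩, fun _ hz => ⟨mem_Qminus.1 hz, rfl⟩⟩

theorem isReflection_reflection {c : ℝ} (hc : 1 ≤ c) : IsReflection (reflection hc) :=
  ⟨fun _ hz => ⟨refl_mem hc hz, rfl⟩, fun _ hz => ⟨refl_mem_minus hc hz, rfl⟩⟩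

/-! ### Shears -/

/-- The linear map `z ↦ z + a (u ∧ z) u`. -/
def shearGL (u : Plane) (a : ℝ) : GL (Fin 2) ℝ where
  val := !![1 - a * (u 0 * u 1), a * (u 0 * u 0); -(a * (u 1 * u 1)), 1 + a * (u 0 * u 1)]
  inv := !![1 + a * (u 0 * u 1), -(a * (u 0 * u 0)); a * (u 1 * u 1), 1 - a * (u 0 * u 1)]
  val_inv := by ext i j; fin_cases i <;> fin_cases j <;> simp <;> ring
  inv_val := by ext i j; fin_cases i <;> fin_cases j <;> simp <;> ring

theorem shearGL_mulVec (u : Plane) (a : ℝ) (v : Plane) :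
    (shearGL u a : Matrix (Fin 2) (Fin 2) ℝ).mulVec v = v + (a * wedge u v) • u := by
  ext i; fin_cases i <;> (simp [shearGL, wedge, Matrix.mulVec, dotProduct]; ring)

theorem shearGL_inv (u : Plane) (a : ℝ) : (shearGL u a)⁻¹ = shearGL u (-a) := by
  refine Units.ext ?_
  show !![1 + a * (u 0 * u 1), -(a * (u 0 * u 0)); a * (u 1 * u 1), 1 - a * (u 0 * u 1)] =
    !![1 - -a * (u 0 * u 1), -a * (u 0 * u 0); -(-a * (u 1 * u 1)), 1 + -a * (u 0 * u 1)]
  ext i j; fin_cases i <;> fin_cases j <;> (simp; try ring)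

/-! ### The cylinders -/

/-- The closed strip of the plane that contains the `j`-th trapezoid of the direction `u`. -/
def closedStrip (c : ℝ) (u : Plane) (j : ℤ) : Set Plane :=
  {z | wedge u (P c j) ≤ wedge u z ∧ wedge u z ≤ wedge u (P c (j + 1))}

/-- The open strip of the plane that contains the `j`-th trapezoid of the direction `u`. -/
def openStrip (c : ℝ) (u : Plane) (j : ℤ) : Set Plane :=
  {z | wedge u (P c j) < wedge u z ∧ wedge u z < wedge u (P c (j + 1))}

/-- The map from the closed strip onto the closed cylinder that consists of the `j`-th trapezoid of
`Q_c^+` and its counterpart in `Q_c^-`. -/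
noncomputable def cyl (c : ℝ) (u : Plane) (e : ℤ) (κ : ℝ) (j : ℤ) (z : Plane) : Surface c :=
  -- `lam` of the left side grows by `height` per unit of `u`, hence by `height * (κ * height)` in
  -- one turn around the cylinder. The floor counts the complete turns beyond the left side.
  psi c j (z - (⌊lam c (e - 1 - j) z / (height c u j * (κ * height c u j))⌋ *
    (κ * height c u j)) • u)

theorem openStrip_subset (c : ℝ) (u : Plane) (j : ℤ) : openStrip c u j ⊆ closedStrip c u j :=
  fun _ h => ⟨h.1.le, h.2.le⟩

theorem wedge_add_smul (u z : Plane) (s : ℝ) : wedge u (z + s • u) = wedge u z := by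
  rw [wedge_add_right, wedge_smul_right, wedge_self, mul_zero, add_zero]

theorem add_smul_mem_closedStrip {c : ℝ} {u : Plane} {j : ℤ} {z : Plane}
    (hz : z ∈ closedStrip c u j) (s : ℝ) : z + s • u ∈ closedStrip c u j := by
  simpa only [closedStrip, mem_ofPred_eq, wedge_add_smul] using hz

theorem add_smul_mem_openStrip {c : ℝ} {u : Plane} {j : ℤ} {z : Plane}
    (hz : z ∈ openStrip c u j) (s : ℝ) : z + s • u ∈ openStrip c u j := by
  simpa only [openStrip, mem_ofPred_eq, wedge_add_smul] using hz

theorem shift_sub_mem_closedStrip {c : ℝ} {u : Plane} {j : ℤ} {z : Plane}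
    (hz : z ∈ closedStrip c u j) : edgeShift c j - z ∈ closedStrip c u j := by
  simp only [closedStrip, mem_ofPred_eq, wedge_sub_right, edgeShift, wedge_add_right] at hz ⊢
  constructor <;> linarith

theorem shift_sub_mem_openStrip {c : ℝ} {u : Plane} {j : ℤ} {z : Plane}
    (hz : z ∈ openStrip c u j) : edgeShift c j - z ∈ openStrip c u j := by
  simp only [openStrip, mem_ofPred_eq, wedge_sub_right, edgeShift, wedge_add_right] at hz ⊢
  constructor <;> linarith

theorem isOpen_openStrip (c : ℝ) (u : Plane) (j : ℤ) : IsOpen (openStrip c u j) :=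
  (isOpen_lt continuous_const (continuous_wedge u)).inter
    (isOpen_lt (continuous_wedge u) continuous_const)

theorem isClosed_closedStrip (c : ℝ) (u : Plane) (j : ℤ) : IsClosed (closedStrip c u j) :=
  (isClosed_le continuous_const (continuous_wedge u)).inter
    (isClosed_le (continuous_wedge u) continuous_const)

namespace Direction

variable {c : ℝ} {u : Plane} {e : ℤ} {κ : ℝ}

theorem circ_pos (d : Direction c u e κ) {j : ℤ} (hj : e ≤ j) :
    0 < height c u j * (κ * height c u j) :=
  mul_pos (d.step_pos hj) (mul_pos d.pos (d.step_pos hj))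

theorem index_ne (d : Direction c u e κ) {j : ℤ} (hj : e ≤ j) : e - 1 - j ≠ j := by
  rcases d.base with h | h <;> omega

/-- The half-turn about the midpoint of the right side carries the left side to its translate by one
circumference, which bounds the copy of `Q_c^-` on the far side. -/
theorem lam_left_shift (d : Direction c u e κ) (j : ℤ) (z : Plane) :
    lam c (e - 1 - j) (edgeShift c j - z) =
      height c u j * (κ * height c u j) - lam c (e - 1 - j) z := by
  have h : edgeShift c j - z = (edgeShift c (e - 1 - j) - z) + (κ * height c u j) • u := by
    rw [← d.period j]; abel
  rw [h, d.lam_left, lam_shift_sub]; ring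

theorem sub_shift_period (d : Direction c u e κ) (j : ℤ) (z : Plane) :
    z - (κ * height c u j) • u - edgeShift c (e - 1 - j) = z - edgeShift c j := by
  rw [← d.period j]; abel

theorem mem_right_edge (d : Direction c u e κ) {j : ℤ} (hj : e ≤ j) {z : Plane}
    (hz : z ∈ closedStrip c u j) (h : lam c j z = 0) : z ∈ segment ℝ (P c j) (P c (j + 1)) := by
  have := d.right_point hj z
  rw [h, zero_div, zero_smul, add_zero] at this
  rw [this, segment_eq_image']
  refine ⟨_, ⟨div_nonneg (by linarith [hz.1]) (d.step_pos hj).le, ?_⟩, rfl⟩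
  rw [div_le_one (d.step_pos hj), height]
  linarith [hz.2]

theorem mem_left_edge (d : Direction c u e κ) {j : ℤ} (hj : e ≤ j) {z : Plane}
    (hz : z ∈ closedStrip c u j) (h : lam c (e - 1 - j) z = 0) :
    z ∈ segment ℝ (P c (e - 1 - j)) (P c (e - 1 - j + 1)) := by
  have := d.left_point hj z
  rw [h, zero_div, neg_zero, zero_smul, add_zero] at this
  rw [this, segment_symm, show e - 1 - j + 1 = e - j by ring, segment_eq_image']
  refine ⟨_, ⟨div_nonneg (by linarith [hz.1]) (d.step_pos hj).le, ?_⟩, rfl⟩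
  rw [div_le_one (d.step_pos hj), height]
  linarith [hz.2]

/-- Along `u` the rates of the two summands cancel, so the sum may be evaluated at the right end `R`
of the chord. The half-turn of `R` is again on the right edge, hence not to the left of the left
side. Geometrically, a chord of the trapezoid is no longer than the circumference. -/
theorem lam_add_le (d : Direction c u e κ) (hc : 1 ≤ c) {j : ℤ} (hj : e ≤ j) {z : Plane}
    (hz : z ∈ closedStrip c u j) :
    lam c (e - 1 - j) z + lam c j z ≤ height c u j * (κ * height c u j) := by
  have hh := d.step_pos hj
  set R := z + (lam c j z / height c u j) • u with hR
  have h1 : R ∈ segment ℝ (P c j) (P c (j + 1)) := by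
    refine d.mem_right_edge hj (add_smul_mem_closedStrip hz _) ?_
    rw [lam_right]; field_simp; ring
  have h2 : lam c (e - 1 - j) R = lam c (e - 1 - j) z + lam c j z := by
    rw [hR, d.lam_left]; field_simp
  rw [← h2]
  have h3 := lam_nonneg_of_mem hc (segment_subset_Qplus c j (shift_sub_mem_segment h1)) (e - 1 - j)
  rw [d.lam_left_shift] at h3
  linarith

theorem lam_add_nonneg (d : Direction c u e κ) (hc : 1 ≤ c) {j : ℤ} (hj : e ≤ j) {z : Plane}
    (hz : z ∈ closedStrip c u j) : 0 ≤ lam c (e - 1 - j) z + lam c j z := by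
  have := d.lam_add_le hc hj (shift_sub_mem_closedStrip hz)
  rw [d.lam_left_shift, lam_shift_sub] at this
  linarith

theorem mem_Qplus (d : Direction c u e κ) {j : ℤ} (hj : e ≤ j) {z : Plane}
    (hz : z ∈ closedStrip c u j) (h : 0 ≤ lam c j z) (h' : 0 ≤ lam c (e - 1 - j) z) :
    z ∈ Qplus c :=
  d.trapezoid_subset hj hz.1 hz.2 h h'

theorem shift_sub_mem_Qplus (d : Direction c u e κ) {j : ℤ} (hj : e ≤ j) {z : Plane}
    (hz : z ∈ closedStrip c u j) (h : lam c j z ≤ 0)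
    (h' : lam c (e - 1 - j) z ≤ height c u j * (κ * height c u j)) :
    edgeShift c j - z ∈ Qplus c :=
  d.mem_Qplus hj (shift_sub_mem_closedStrip hz) (by rw [lam_shift_sub]; linarith)
    (by rw [d.lam_left_shift]; linarith)

theorem mem_interior (d : Direction c u e κ) {j : ℤ} (hj : e ≤ j) {z : Plane}
    (hz : z ∈ openStrip c u j) (h : 0 < lam c j z) (h' : 0 < lam c (e - 1 - j) z) :
    z ∈ interior (Qplus c) := by
  refine interior_maximal (t := openStrip c u j ∩ ({z | 0 < lam c j z} ∩
    {z | 0 < lam c (e - 1 - j) z})) (fun w hw => ?_) ?_ ⟨hz, h, h'⟩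
  · exact d.mem_Qplus hj (openStrip_subset c u j hw.1) hw.2.1.le hw.2.2.le
  · exact (isOpen_openStrip c u j).inter
      ((isOpen_lt continuous_const (continuous_lam c j)).inter
        (isOpen_lt continuous_const (continuous_lam c _)))

theorem cyl_add_period (d : Direction c u e κ) {j : ℤ} (hj : e ≤ j) (z : Plane) (n : ℤ) :
    cyl c u e κ j (z + (n * (κ * height c u j)) • u) = cyl c u e κ j z := by
  have h := d.circ_pos hj
  have hf : (lam c (e - 1 - j) (z + (n * (κ * height c u j)) • u)) /
      (height c u j * (κ * height c u j)) =
      lam c (e - 1 - j) z / (height c u j * (κ * height c u j)) + n := by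
    rw [d.lam_left, div_add' _ _ _ h.ne']
    congr 1; ring
  unfold cyl
  rw [hf, Int.floor_add_intCast]
  congr 1
  push_cast
  module

/-- Every point of the strip can be moved into the fundamental domain. -/
theorem exists_reduce (d : Direction c u e κ) {j : ℤ} (hj : e ≤ j) (z : Plane) :
    ∃ n : ℤ, ∃ w : Plane, z = w + (n * (κ * height c u j)) • u ∧ 0 ≤ lam c (e - 1 - j) w ∧
      lam c (e - 1 - j) w < height c u j * (κ * height c u j) := by
  have h := d.circ_pos hj
  set n := ⌊lam c (e - 1 - j) z / (height c u j * (κ * height c u j))⌋ with hn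
  refine ⟨n, z + (-(n * (κ * height c u j))) • u, by module, ?_, ?_⟩
  · have := Int.floor_le (lam c (e - 1 - j) z / (height c u j * (κ * height c u j)))
    rw [← hn, le_div_iff₀ h] at this
    rw [d.lam_left]; linarith
  · have := Int.lt_floor_add_one (lam c (e - 1 - j) z / (height c u j * (κ * height c u j)))
    rw [← hn, div_lt_iff₀ h] at this
    rw [d.lam_left]; linarith

theorem cyl_of_fundamental (d : Direction c u e κ) {j : ℤ} (hj : e ≤ j) {z : Plane}
    (h0 : 0 ≤ lam c (e - 1 - j) z) (h1 : lam c (e - 1 - j) z < height c u j * (κ * height c u j)) :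
    cyl c u e κ j z = psi c j z := by
  have h := d.circ_pos hj
  have : ⌊lam c (e - 1 - j) z / (height c u j * (κ * height c u j))⌋ = 0 := by
    rw [Int.floor_eq_zero_iff]
    exact ⟨div_nonneg h0 h.le, (div_lt_one h).2 h1⟩
  simp [cyl, this]

theorem cyl_minus (d : Direction c u e κ) (hc : 1 ≤ c) {j : ℤ} (hj : e ≤ j) {z : Plane}
    (hz : z ∈ closedStrip c u j) (h : lam c j z ≤ 0)
    (h' : lam c (e - 1 - j) z ≤ height c u j * (κ * height c u j)) :
    cyl c u e κ j z = mi c (z - edgeShift c j) := by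
  have h0 : 0 ≤ lam c (e - 1 - j) z := by linarith [d.lam_add_nonneg hc hj hz]
  -- At the far end of the fundamental domain the floor has already jumped: one turn back, the point
  -- is on the left edge, which is glued to `Q_c^-`.
  rcases h'.eq_or_lt with h' | h'
  · have hp := d.cyl_add_period hj z (-1)
    set z' := z + (((-1 : ℤ) : ℝ) * (κ * height c u j)) • u with hz'
    have hl : lam c (e - 1 - j) z' = 0 := by
      rw [hz', d.lam_left, h']; push_cast; ring
    have hs := d.mem_left_edge hj (add_smul_mem_closedStrip hz _) hl
    rw [← hp, d.cyl_of_fundamental hj hl.ge (hl ▸ d.circ_pos hj),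
      psi_of_nonneg (lam_nonneg_of_mem hc (segment_subset_Qplus c _ hs) j), pl_eq_mi hs]
    congr 1
    rw [← d.sub_shift_period j z]
    push_cast
    module
  · rw [d.cyl_of_fundamental hj h0 h']
    rcases h.eq_or_lt with h | h
    · rw [psi_of_nonneg h.ge, pl_eq_mi (d.mem_right_edge hj hz h)]
    · exact psi_of_neg h

theorem cyl_plus (d : Direction c u e κ) (hc : 1 ≤ c) {j : ℤ} (hj : e ≤ j) {z : Plane}
    (hz : z ∈ closedStrip c u j) (h : 0 ≤ lam c j z) (h' : 0 ≤ lam c (e - 1 - j) z) :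
    cyl c u e κ j z = pl c z := by
  have h1 := d.lam_add_le hc hj hz
  rcases h.eq_or_lt with h | h
  · rw [pl_eq_mi (d.mem_right_edge hj hz h.symm)]
    exact d.cyl_minus hc hj hz h.ge (by linarith)
  · rw [d.cyl_of_fundamental hj h' (by linarith), psi_of_nonneg h.le]

theorem cyl_plus_of_mem (d : Direction c u e κ) (hc : 1 ≤ c) {j : ℤ} (hj : e ≤ j) {z : Plane}
    (hz : z ∈ closedStrip c u j) (hQ : z ∈ Qplus c) : cyl c u e κ j z = pl c z :=
  d.cyl_plus hc hj hz (lam_nonneg_of_mem hc hQ _) (lam_nonneg_of_mem hc hQ _)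

theorem rotation_cyl (d : Direction c u e κ) (hc : 1 ≤ c) {j : ℤ} (hj : e ≤ j) {z : Plane}
    (hz : z ∈ closedStrip c u j) :
    rotation c (cyl c u e κ j z) = cyl c u e κ j (edgeShift c j - z) := by
  obtain ⟨n, w, rfl, h0, h1⟩ := d.exists_reduce hj z
  have hw : w ∈ closedStrip c u j := by
    have := add_smul_mem_closedStrip hz (-(n * (κ * height c u j)))
    rwa [add_assoc, ← add_smul, add_neg_cancel, zero_smul, add_zero] at this
  have e1 : edgeShift c j - (w + (n * (κ * height c u j)) • u) =
      edgeShift c j - w + (((-n : ℤ) : ℝ) * (κ * height c u j)) • u := by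
    push_cast; module
  rw [e1, d.cyl_add_period hj, d.cyl_add_period hj]
  have hs := shift_sub_mem_closedStrip hw
  rcases le_total 0 (lam c j w) with h | h
  · rw [d.cyl_plus hc hj hw h h0, rotation_pl (d.mem_Qplus hj hw h h0),
      d.cyl_minus hc hj hs (by rw [lam_shift_sub]; linarith) (by rw [d.lam_left_shift]; linarith)]
    congr 1; abel
  · have hQ := d.shift_sub_mem_Qplus hj hw h h1.le
    rw [d.cyl_minus hc hj hw h h1.le, rotation_mi (sub_shift_mem_Qminus.2 hQ), neg_sub,
      d.cyl_plus_of_mem hc hj hs hQ]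

/-- The floor jumps on the translates of the left side. The strip is split into the closed pieces `G
n`, one per turn; on `G 0` the formulas for `Q_c^+` and `Q_c^-` hold up to the boundary, so
neighbouring pieces fit together. -/
theorem continuousOn_cyl (d : Direction c u e κ) (hc : 1 ≤ c) {j : ℤ} (hj : e ≤ j) :
    ContinuousOn (cyl c u e κ j) (closedStrip c u j) := by
  have hpos := d.circ_pos hj
  have hl := continuous_lam c (e - 1 - j)
  let G : ℤ → Set Plane := fun n => closedStrip c u j ∩
    {z | n * (height c u j * (κ * height c u j)) ≤ lam c (e - 1 - j) z ∧
      lam c (e - 1 - j) z ≤ (n + 1) * (height c u j * (κ * height c u j))}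
  have hGc (n : ℤ) : IsClosed (G n) := (isClosed_closedStrip c u j).inter
    ((isClosed_le continuous_const hl).inter (isClosed_le hl continuous_const))
  have hG0 : ContinuousOn (cyl c u e κ j) (G 0) := by
    have h1 : ContinuousOn (cyl c u e κ j) (G 0 ∩ {z | 0 ≤ lam c j z}) := by
      refine ((continuousOn_pl c).mono ?_).congr ?_
      · rintro z ⟨⟨hz, h0, _⟩, h⟩
        exact d.mem_Qplus hj hz h (by simpa using h0)
      · rintro z ⟨⟨hz, h0, _⟩, h⟩
        exact d.cyl_plus hc hj hz h (by simpa using h0)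
    have h2 : ContinuousOn (cyl c u e κ j) (G 0 ∩ {z | lam c j z ≤ 0}) := by
      have : ContinuousOn (fun z => mi c (z - edgeShift c j)) (G 0 ∩ {z | lam c j z ≤ 0}) := by
        refine (continuousOn_mi c).comp (by fun_prop) ?_
        rintro z ⟨⟨hz, _, h1⟩, h⟩
        exact sub_shift_mem_Qminus.2 (d.shift_sub_mem_Qplus hj hz h (by simpa using h1))
      refine this.congr ?_
      rintro z ⟨⟨hz, _, h1⟩, h⟩
      exact d.cyl_minus hc hj hz h (by simpa using h1)
    have := h1.union_of_isClosed h2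
      ((hGc 0).inter (isClosed_le continuous_const (continuous_lam c j)))
      ((hGc 0).inter (isClosed_le (continuous_lam c j) continuous_const))
    refine this.mono fun z hz => ?_
    rcases le_total 0 (lam c j z) with h | h
    · exact Or.inl ⟨hz, h⟩
    · exact Or.inr ⟨hz, h⟩
  have hG (n : ℤ) : ContinuousOn (cyl c u e κ j) (G n) := by
    have hmaps : MapsTo (fun z => z + (((-n : ℤ) : ℝ) * (κ * height c u j)) • u) (G n) (G 0) := by
      rintro z ⟨hz, h0, h1⟩
      refine ⟨add_smul_mem_closedStrip hz _, ?_, ?_⟩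
      · rw [d.lam_left]; push_cast; linarith
      · rw [d.lam_left]; push_cast; linarith
    refine (hG0.comp (by fun_prop) hmaps).congr fun z _ => ?_
    exact (d.cyl_add_period hj z (-n)).symm
  intro z hz
  obtain ⟨n, w, hzw, h0, h1⟩ := d.exists_reduce hj z
  have hlz : lam c (e - 1 - j) z =
      lam c (e - 1 - j) w + n * (height c u j * (κ * height c u j)) := by
    rw [hzw, d.lam_left]; ring
  have hU := ((hG (n - 1)).union_of_isClosed (hG n) (hGc _) (hGc _)) z
    (Or.inr ⟨hz, by linarith, by linarith⟩)
  refine hU.mono_of_mem_nhdsWithin ?_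
  have hopen : IsOpen {z | (n - 1) * (height c u j * (κ * height c u j)) < lam c (e - 1 - j) z ∧
      lam c (e - 1 - j) z < (n + 1) * (height c u j * (κ * height c u j))} :=
    (isOpen_lt continuous_const hl).inter (isOpen_lt hl continuous_const)
  filter_upwards [self_mem_nhdsWithin, mem_nhdsWithin_of_mem_nhds (hopen.mem_nhds
    (show z ∈ _ from ⟨by linarith, by linarith⟩))] with y hy hy'
  rcases le_total (lam c (e - 1 - j) y) (n * (height c u j * (κ * height c u j))) with h | h
  · exact Or.inl ⟨hy, by push_cast; linarith [hy'.1], by push_cast; linarith⟩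
  · exact Or.inr ⟨hy, h, hy'.2.le⟩

theorem mem_openSegment (d : Direction c u e κ) {j : ℤ} {z : Plane} {k : ℤ}
    (hk : k = j ∨ k = e - 1 - j) (hz : z ∈ openStrip c u j)
    (h : z ∈ segment ℝ (P c k) (P c (k + 1))) : z ∈ openSegment ℝ (P c k) (P c (k + 1)) := by
  have h1 : z ≠ P c k ∧ z ≠ P c (k + 1) := by
    rcases hk with rfl | rfl
    · exact ⟨fun h => hz.1.ne' (h ▸ rfl), fun h => hz.2.ne (h ▸ rfl)⟩
    · have e1 := d.symm j
      have e2 := d.symm (j + 1)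
      rw [show e - j = e - 1 - j + 1 by ring] at e1
      rw [show e - (j + 1) = e - 1 - j by ring] at e2
      exact ⟨fun h => hz.2.ne (by rw [h, e2]), fun h => hz.1.ne' (by rw [h, e1])⟩
  rw [← insert_endpoints_openSegment] at h
  rcases h with h | h | h
  · exact absurd h h1.1
  · exact absurd h h1.2
  · exact h

theorem mem_W_of_fundamental (d : Direction c u e κ) (hc : 1 ≤ c) {j : ℤ} (hj : e ≤ j)
    {z : Plane} (hz : z ∈ openStrip c u j) (h0 : 0 < lam c (e - 1 - j) z)
    (h1 : lam c (e - 1 - j) z < height c u j * (κ * height c u j)) : z ∈ W c j := by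
  rcases lt_trichotomy (lam c j z) 0 with h | h | h
  · refine Or.inr (d.mem_interior hj (shift_sub_mem_openStrip hz) ?_ ?_)
    · rw [lam_shift_sub]; linarith
    · rw [d.lam_left_shift]; linarith
  · exact edge_subset_W hc j (d.mem_openSegment (Or.inl rfl) hz
      (d.mem_right_edge hj (openStrip_subset c u j hz) h))
  · exact Or.inl (Or.inl (d.mem_interior hj hz h h0))

theorem left_edge (d : Direction c u e κ) (hc : 1 ≤ c) {j : ℤ} (hj : e ≤ j)
    {z : Plane} (hz : z ∈ openStrip c u j) (h0 : lam c (e - 1 - j) z = 0) :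
    z ∈ openSegment ℝ (P c (e - 1 - j)) (P c (e - 1 - j + 1)) ∧ 0 < lam c j z := by
  have h := d.mem_openSegment (Or.inr rfl) hz
    (d.mem_left_edge hj (openStrip_subset c u j hz) h0)
  refine ⟨h, lt_of_le_of_ne (lam_nonneg_of_mem hc (segment_subset_Qplus c _
    (openSegment_subset_segment ℝ _ _ h)) j) fun h' => ?_⟩
  have h2 := fst_of_segment hc (d.mem_right_edge hj (openStrip_subset c u j hz) h'.symm)
  obtain ⟨h3, h4, -⟩ := fst_of_openSegment hc h
  exact d.index_ne hj (index_unique hc h3 h4 h2.1 h2.2.1).symm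

/-- The cylinder map is a local isometry that preserves directions. -/
theorem flat_cyl (d : Direction c u e κ) (hc : 1 ≤ c) {j : ℤ} (hj : e ≤ j)
    {z : Plane} (hz : z ∈ openStrip c u j) : Flat (.id ℝ Plane) (cyl c u e κ j) z := by
  have hpos := d.circ_pos hj
  obtain ⟨n, w, rfl, h0, h1⟩ := d.exists_reduce hj z
  have hw : w ∈ openStrip c u j := by
    have := add_smul_mem_openStrip hz (-(n * (κ * height c u j)))
    rwa [add_assoc, ← add_smul, add_neg_cancel, zero_smul, add_zero] at this
  suffices h : Flat (.id ℝ Plane) (cyl c u e κ j) w by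
    obtain ⟨k, y, hy, h⟩ := h
    refine ⟨k, y, hy, ?_⟩
    filter_upwards [h] with s hs
    rw [add_right_comm, d.cyl_add_period hj, hs]
  have hopen (a b : ℝ) : IsOpen {z | a < lam c (e - 1 - j) z ∧ lam c (e - 1 - j) z < b} :=
    (isOpen_lt continuous_const (continuous_lam c _)).inter
      (isOpen_lt (continuous_lam c _) continuous_const)
  -- On the left side, where the floor jumps, the chart of the left edge is used; elsewhere the
  -- chart of the right edge works.
  rcases h0.eq_or_lt with h0 | h0
  · obtain ⟨he, hl⟩ := d.left_edge hc hj hw h0.symm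
    have hl' : lam c j (w + (κ * height c u j) • u) < 0 := by
      have hs := (d.left_edge hc hj (add_smul_mem_openStrip (shift_sub_mem_openStrip hw)
        (-(κ * height c u j))) (by rw [d.lam_left, d.lam_left_shift]; linarith)).2
      rw [show edgeShift c j - w + (-(κ * height c u j)) • u =
        edgeShift c j - (w + (κ * height c u j) • u) by module, lam_shift_sub] at hs
      linarith
    refine ⟨e - 1 - j, w, edge_subset_W hc _ he, ?_⟩
    filter_upwards [eventually_add_mem (isOpen_openStrip c u j) hw, eventually_lam_pos hl,
      eventually_lam_neg hl', eventually_add_mem (hopen (-(height c u j * (κ * height c u j)))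
        (height c u j * (κ * height c u j))) ⟨by linarith, by linarith⟩] with v h2 h3 h4 h5
    simp only [ContinuousLinearMap.id_apply]
    have h6 := openStrip_subset c u j h2
    rcases le_or_gt 0 (lam c (e - 1 - j) (w + v)) with h | h
    · rw [psi_of_nonneg h, d.cyl_plus hc hj h6 h3.le h]
    · have := d.cyl_add_period hj (w + v) 1
      rw [psi_of_neg h, ← this, Int.cast_one, one_mul, d.cyl_minus hc hj
        (add_smul_mem_closedStrip h6 _) (by rw [add_right_comm]; exact h4.le)
        (by rw [d.lam_left]; linarith), ← d.sub_shift_period, add_sub_cancel_right]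
  · refine ⟨j, w, d.mem_W_of_fundamental hc hj hw h0 h1, ?_⟩
    filter_upwards [eventually_add_mem (hopen 0 _) ⟨h0, h1⟩] with v hv
    exact d.cyl_of_fundamental hj hv.1.le hv.2

theorem cyl_eq_iff (d : Direction c u e κ) (hc : 1 ≤ c) {j : ℤ} (hj : e ≤ j)
    {z z' : Plane} (hz : z ∈ openStrip c u j) (hz' : z' ∈ openStrip c u j) :
    cyl c u e κ j z = cyl c u e κ j z' ↔ ∃ n : ℤ, z' = z + (n * (κ * height c u j)) • u := by
  constructor
  · intro h
    obtain ⟨n, w, rfl, h0, h1⟩ := d.exists_reduce hj z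
    obtain ⟨n', w', rfl, h0', h1'⟩ := d.exists_reduce hj z'
    have hw : w ∈ openStrip c u j := by
      have := add_smul_mem_openStrip hz (-(n * (κ * height c u j)))
      rwa [add_assoc, ← add_smul, add_neg_cancel, zero_smul, add_zero] at this
    have hw' : w' ∈ openStrip c u j := by
      have := add_smul_mem_openStrip hz' (-(n' * (κ * height c u j)))
      rwa [add_assoc, ← add_smul, add_neg_cancel, zero_smul, add_zero] at this
    rw [d.cyl_add_period hj, d.cyl_add_period hj] at h
    suffices hww : w = w' by
      refine ⟨n' - n, ?_⟩
      rw [hww]; push_cast; module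
    rcases h0.eq_or_lt with h0 | h0
    · obtain ⟨he, hl⟩ := d.left_edge hc hj hw h0.symm
      have hQ := segment_subset_Qplus c _ (openSegment_subset_segment ℝ _ _ he)
      rcases h0'.eq_or_lt with h0' | h0'
      · obtain ⟨he', hl'⟩ := d.left_edge hc hj hw' h0'.symm
        have hQ' := segment_subset_Qplus c _ (openSegment_subset_segment ℝ _ _ he')
        rw [d.cyl_plus hc hj (openStrip_subset c u j hw) hl.le h0.le,
          d.cyl_plus hc hj (openStrip_subset c u j hw') hl'.le h0'.le,
          ← psi_of_nonneg (k := e - 1 - j) h0.le] at h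
        exact eq_of_psi_eq_pl hc (edge_subset_W hc _ he) hQ' h
      · rw [d.cyl_plus hc hj (openStrip_subset c u j hw) hl.le h0.le,
          d.cyl_of_fundamental hj h0'.le h1'] at h
        exact (eq_of_psi_eq_pl hc (d.mem_W_of_fundamental hc hj hw' h0' h1') hQ h.symm).symm
    · have hW := d.mem_W_of_fundamental hc hj hw h0 h1
      rw [d.cyl_of_fundamental hj h0.le h1] at h
      rcases h0'.eq_or_lt with h0' | h0'
      · obtain ⟨he', hl'⟩ := d.left_edge hc hj hw' h0'.symm
        have hQ' := segment_subset_Qplus c _ (openSegment_subset_segment ℝ _ _ he')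
        rw [d.cyl_plus hc hj (openStrip_subset c u j hw') hl'.le h0'.le] at h
        exact eq_of_psi_eq_pl hc hW hQ' h
      · rw [d.cyl_of_fundamental hj h0'.le h1'] at h
        rcases psi_eq_psi hc hW (d.mem_W_of_fundamental hc hj hw' h0' h1') h with ⟨_, h⟩ | ⟨_, h⟩
        · exact h
        · exact sub_left_injective h
  · rintro ⟨n, rfl⟩
    exact (d.cyl_add_period hj z n).symm

end Direction

namespace Direction

variable {c : ℝ} {u : Plane} {e : ℤ} {κ : ℝ}

/-! ### The decomposition of the surface into the cylinders -/

theorem level_strictMono (d : Direction c u e κ) {i j : ℤ} (hi : e ≤ i)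
    (hij : i < j) : wedge u (P c i) < wedge u (P c j) := by
  have := d.level_mono (i := i + 1) (j := j) (by omega) (by omega)
  linarith [d.step i hi]

theorem level_of_segment {k : ℤ} {z : Plane} (hz : z ∈ segment ℝ (P c k) (P c (k + 1))) :
    ∃ t : ℝ, 0 ≤ t ∧ t ≤ 1 ∧ wedge u z = wedge u (P c k) + t * height c u k := by
  rw [segment_eq_image'] at hz
  obtain ⟨t, ht, rfl⟩ := hz
  exact ⟨t, ht.1, ht.2, by rw [wedge_add_right, wedge_smul_right, wedge_sub_right, height]⟩

theorem height_symm (d : Direction c u e κ) (j : ℤ) : height c u (e - 1 - j) = -height c u j := by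
  have := d.wedge_edge_symm j
  rw [wedge_edge] at this
  linarith

/-- Every edge is a side of a trapezoid, except for the edge parallel to `u`, if there is one. -/
theorem edge_cases (d : Direction c u e κ) (k : ℤ) :
    (∃ j, e ≤ j ∧ (k = j ∨ k = e - 1 - j)) ∨ (e = 1 ∧ k = 0) := by
  rcases le_or_gt e k with h | h
  · exact Or.inl ⟨k, h, Or.inl rfl⟩
  · rcases le_or_gt e (e - 1 - k) with h' | h'
    · exact Or.inl ⟨e - 1 - k, h', Or.inr (by ring)⟩
    · right
      rcases d.base with h0 | h0 <;> constructor <;> omega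

theorem edge_subset_closedStrip (d : Direction c u e κ) {j k : ℤ} (hj : e ≤ j)
    (hk : k = j ∨ k = e - 1 - j) {z : Plane} (hz : z ∈ segment ℝ (P c k) (P c (k + 1))) :
    z ∈ closedStrip c u j := by
  have hh := d.step_pos hj
  obtain ⟨t, h0, h1, h⟩ := level_of_segment (u := u) hz
  have hj1 : wedge u (P c (j + 1)) = wedge u (P c j) + height c u j := by rw [height]; ring
  rcases hk with rfl | rfl
  · constructor
    · rw [h]; nlinarith
    · rw [h, hj1]; nlinarith
  · have e2 := d.symm (j + 1)
    rw [show e - (j + 1) = e - 1 - j by ring] at e2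
    rw [d.height_symm, e2, hj1] at h
    constructor
    · rw [h]; nlinarith
    · rw [h, hj1]; nlinarith

theorem shift_level (d : Direction c u e κ) {j k : ℤ} (hk : k = j ∨ k = e - 1 - j) :
    wedge u (edgeShift c k) = wedge u (edgeShift c j) := by
  rcases hk with rfl | rfl
  · rfl
  · have := congrArg (wedge u) (d.period j)
    rw [wedge_sub_right, wedge_smul_right, wedge_self] at this
    linarith

theorem flat_edge_level (d : Direction c u e κ) (he : e = 1) {z : Plane}
    (hz : z ∈ segment ℝ (P c 0) (P c (0 + 1))) : wedge u z = wedge u (P c e) := by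
  obtain ⟨t, _, _, h⟩ := level_of_segment (u := u) hz
  subst he
  have := d.symm 1
  rw [sub_self] at this
  rw [h, height, zero_add, this]; ring

theorem strip_index_unique (d : Direction c u e κ) {i j : ℤ} (hi : e ≤ i) (hj : e ≤ j) {z : Plane}
    (hz : z ∈ openStrip c u i) (hz' : z ∈ closedStrip c u j) : i = j := by
  by_contra hij
  rcases lt_or_gt_of_ne hij with h | h
  · linarith [d.level_mono (i := i + 1) (j := j) (by omega) (by omega), hz.2, hz'.1]
  · linarith [d.level_mono (i := j + 1) (j := i) (by omega) (by omega), hz.1, hz'.2]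

theorem shift_sub_mem_openStrip_of_edge (d : Direction c u e κ) {j : ℤ} (hj : e ≤ j) {k : ℤ}
    {z : Plane} (hz : z ∈ segment ℝ (P c k) (P c (k + 1))) (h : z ∈ openStrip c u j) :
    edgeShift c k - z ∈ openStrip c u j := by
  rcases d.edge_cases k with ⟨i, hi, hk⟩ | ⟨he, rfl⟩
  · obtain rfl := d.strip_index_unique hj hi h (d.edge_subset_closedStrip hi hk hz)
    have h1 := shift_sub_mem_openStrip h
    simp only [openStrip, mem_ofPred_eq, wedge_sub_right, d.shift_level hk] at h1 ⊢
    exact h1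
  · have := d.flat_edge_level he hz
    linarith [h.1, d.level_mono le_rfl hj]

/-- The points of the open cylinder that contains the `j`-th trapezoid. -/
def inCyl (d : Direction c u e κ) {j : ℤ} (hj : e ≤ j) : Surface c → Prop :=
  Quot.lift (Sum.elim (fun x => (x : Plane) ∈ openStrip c u j)
    (fun y => -(y : Plane) ∈ openStrip c u j)) (by
    rintro _ _ ⟨k, x, y, hx, hy⟩
    simp only [Sum.elim_inl, Sum.elim_inr, eq_iff_iff, hy, neg_sub]
    refine ⟨d.shift_sub_mem_openStrip_of_edge hj hx, fun h => ?_⟩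
    simpa using d.shift_sub_mem_openStrip_of_edge hj (shift_sub_mem_segment hx) h)

theorem inCyl_pl (d : Direction c u e κ) {j : ℤ} (hj : e ≤ j) {z : Plane} (hz : z ∈ Qplus c) :
    d.inCyl hj (pl c z) ↔ z ∈ openStrip c u j := by
  rw [pl_of_mem hz]; rfl

theorem inCyl_mi (d : Direction c u e κ) {j : ℤ} (hj : e ≤ j) {z : Plane} (hz : z ∈ Qplus c) :
    d.inCyl hj (mi c (-z)) ↔ z ∈ openStrip c u j := by
  rw [mi_of_mem (neg_mem_Qminus.2 hz)]
  show - -z ∈ openStrip c u j ↔ _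
  rw [neg_neg]

theorem isOpen_inCyl (d : Direction c u e κ) {j : ℤ} (hj : e ≤ j) :
    IsOpen {p | d.inCyl hj p} := by
  have : IsOpen (Quot.mk (Glue c) ⁻¹' {p | d.inCyl hj p}) := by
    rw [isOpen_sum_iff]
    exact ⟨(isOpen_openStrip c u j).preimage continuous_subtype_val,
      (isOpen_openStrip c u j).preimage continuous_subtype_val.neg⟩
  exact this

theorem inCyl_unique (d : Direction c u e κ) {i j : ℤ} (hi : e ≤ i) (hj : e ≤ j) {p : Surface c}
    (h : d.inCyl hi p) (h' : d.inCyl hj p) : i = j := by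
  rcases surface_cases p with ⟨z, hz, rfl⟩ | ⟨z, hz, rfl⟩
  · rw [d.inCyl_pl _ hz] at h h'
    exact d.strip_index_unique hi hj h (openStrip_subset c u j h')
  · rw [d.inCyl_mi _ hz] at h h'
    exact d.strip_index_unique hi hj h (openStrip_subset c u j h')

theorem mi_eq_cyl (d : Direction c u e κ) (hc : 1 ≤ c) {j : ℤ} (hj : e ≤ j) {z : Plane}
    (hz : z ∈ closedStrip c u j) (hQ : z ∈ Qplus c) :
    mi c (-z) = cyl c u e κ j (edgeShift c j - z) := by
  rw [← rotation_pl hQ, ← d.cyl_plus_of_mem hc hj hz hQ, d.rotation_cyl hc hj hz]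

theorem exists_strip_of_mem (d : Direction c u e κ) (hc : 1 ≤ c) {z : Plane} (hz : z ∈ Qplus c) :
    ∃ j, e ≤ j ∧ wedge u (P c j) ≤ wedge u z ∧ wedge u z < wedge u (P c (j + 1)) :=
  d.exists_level (d.bottom z fun m => lam_nonneg_of_mem hc hz m)

/-- The closed cylinders cover the surface. -/
theorem exists_cyl_eq (d : Direction c u e κ) (hc : 1 ≤ c) (p : Surface c) :
    ∃ j, e ≤ j ∧ ∃ z ∈ closedStrip c u j, p = cyl c u e κ j z := by
  rcases surface_cases p with ⟨z, hz, rfl⟩ | ⟨z, hz, rfl⟩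
  · obtain ⟨j, hj, h0, h1⟩ := d.exists_strip_of_mem hc hz
    exact ⟨j, hj, z, ⟨h0, h1.le⟩, (d.cyl_plus_of_mem hc hj ⟨h0, h1.le⟩ hz).symm⟩
  · obtain ⟨j, hj, h0, h1⟩ := d.exists_strip_of_mem hc hz
    exact ⟨j, hj, _, shift_sub_mem_closedStrip ⟨h0, h1.le⟩, d.mi_eq_cyl hc hj ⟨h0, h1.le⟩ hz⟩

/-- A point of a closed cylinder is represented by a point of a trapezoid. -/
theorem cyl_cases (d : Direction c u e κ) (hc : 1 ≤ c) {j : ℤ} (hj : e ≤ j) {z : Plane}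
    (hz : z ∈ closedStrip c u j) :
    ∃ n : ℤ, ∃ w ∈ Qplus c, w ∈ closedStrip c u j ∧
      ((z = w + (n * (κ * height c u j)) • u ∧ cyl c u e κ j z = pl c w) ∨
      (z = edgeShift c j - w + (n * (κ * height c u j)) • u ∧ cyl c u e κ j z = mi c (-w))) := by
  obtain ⟨n, w, rfl, h0, h1⟩ := d.exists_reduce hj z
  have hw : w ∈ closedStrip c u j := by
    have := add_smul_mem_closedStrip hz (-(n * (κ * height c u j)))
    rwa [add_assoc, ← add_smul, add_neg_cancel, zero_smul, add_zero] at this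
  refine ⟨n, ?_⟩
  rw [d.cyl_add_period hj]
  rcases le_total 0 (lam c j w) with h | h
  · exact ⟨w, d.mem_Qplus hj hw h h0, hw, Or.inl ⟨rfl, d.cyl_plus hc hj hw h h0⟩⟩
  · refine ⟨_, d.shift_sub_mem_Qplus hj hw h h1.le, shift_sub_mem_closedStrip hw, Or.inr ⟨?_, ?_⟩⟩
    · rw [sub_sub_cancel]
    · rw [d.cyl_minus hc hj hw h h1.le, neg_sub]

theorem inCyl_cyl (d : Direction c u e κ) (hc : 1 ≤ c) {j : ℤ} (hj : e ≤ j) {z : Plane}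
    (hz : z ∈ openStrip c u j) : d.inCyl hj (cyl c u e κ j z) := by
  obtain ⟨n, w, hw, -, ⟨h, h'⟩ | ⟨h, h'⟩⟩ := d.cyl_cases hc hj (openStrip_subset c u j hz)
  · rw [h', d.inCyl_pl hj hw]
    simpa [openStrip, h, wedge_add_smul] using hz
  · rw [h', d.inCyl_mi hj hw]
    have := shift_sub_mem_openStrip (add_smul_mem_openStrip hz (-(n * (κ * height c u j))))
    rw [h] at this
    rw [show edgeShift c j - (edgeShift c j - w + (n * (κ * height c u j)) • u +
      (-(n * (κ * height c u j))) • u) = w by module] at this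
    exact this

theorem inCyl_iff (d : Direction c u e κ) (hc : 1 ≤ c) {j : ℤ} (hj : e ≤ j) {p : Surface c} :
    d.inCyl hj p ↔ p ∈ cyl c u e κ j '' openStrip c u j := by
  constructor
  · intro h
    rcases surface_cases p with ⟨z, hz, rfl⟩ | ⟨z, hz, rfl⟩
    · rw [d.inCyl_pl hj hz] at h
      exact ⟨z, h, d.cyl_plus_of_mem hc hj (openStrip_subset c u j h) hz⟩
    · rw [d.inCyl_mi hj hz] at h
      exact ⟨_, shift_sub_mem_openStrip h,
        (d.mi_eq_cyl hc hj (openStrip_subset c u j h) hz).symm⟩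
  · rintro ⟨z, hz, rfl⟩
    exact d.inCyl_cyl hc hj hz

/-! ### The twists -/

/-- The shear of the `j`-th strip that fixes the lower boundary. -/
noncomputable def stripShear (c : ℝ) (u : Plane) (a : ℝ) (j : ℤ) (z : Plane) : Plane :=
  z + (a * (wedge u z - wedge u (P c j))) • u

theorem wedge_stripShear (a : ℝ) (j : ℤ) (z : Plane) :
    wedge u (stripShear c u a j z) = wedge u z := wedge_add_smul u z _

theorem stripShear_mem_closedStrip {a : ℝ} {j : ℤ} {z : Plane} (hz : z ∈ closedStrip c u j) :
    stripShear c u a j z ∈ closedStrip c u j := add_smul_mem_closedStrip hz _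

theorem stripShear_mem_openStrip {a : ℝ} {j : ℤ} {z : Plane} (hz : z ∈ openStrip c u j) :
    stripShear c u a j z ∈ openStrip c u j := add_smul_mem_openStrip hz _

theorem continuous_stripShear (a : ℝ) (j : ℤ) : Continuous (stripShear c u a j) := by
  have := continuous_wedge u
  unfold stripShear; fun_prop

open Classical in
/-- The `m`-fold twist, on the points represented by points of `Q_c^+`. -/
noncomputable def twistPlus (d : Direction c u e κ) (hc : 1 ≤ c) (m : ℤ) (z : Plane) :
    Surface c :=
  if hz : z ∈ Qplus c then
    let j := (d.exists_strip_of_mem hc hz).choose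
    cyl c u e κ j (stripShear c u (m * κ) j z)
  else pl c z

/-- The choice of the strip matters only on a diagonal shared by two strips. There the shear of the
upper strip is the identity and that of the lower strip is `m` full turns, which `cyl` ignores. -/
theorem twistPlus_eq (d : Direction c u e κ) (hc : 1 ≤ c) (m : ℤ) {j : ℤ} (hj : e ≤ j)
    {z : Plane} (hz : z ∈ closedStrip c u j) (hQ : z ∈ Qplus c) :
    d.twistPlus hc m z = cyl c u e κ j (stripShear c u (m * κ) j z) := by
  obtain ⟨hi, h0, h1⟩ := (d.exists_strip_of_mem hc hQ).choose_spec
  unfold twistPlus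
  rw [dif_pos hQ]
  simp only
  generalize (d.exists_strip_of_mem hc hQ).choose = i at hi h0 h1
  rcases lt_trichotomy i j with h | h | h
  · linarith [d.level_mono (i := i + 1) (j := j) (by omega) (by omega), hz.1]
  · rw [h]
  · have h2 := d.level_mono (i := j + 1) (j := i) (by omega) (by omega)
    have h3 : wedge u z = wedge u (P c i) := le_antisymm (by linarith [hz.2]) h0
    have h4 : wedge u z = wedge u (P c (j + 1)) := le_antisymm hz.2 (by linarith)
    have h5 := d.cyl_add_period hj z m
    have e1 : stripShear c u (m * κ) i z = z := by
      rw [stripShear, h3, sub_self, mul_zero, zero_smul, add_zero]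
    have e2 : stripShear c u (m * κ) j z = z + (m * (κ * height c u j)) • u := by
      rw [stripShear, h4, height, mul_assoc]
    rw [e1, e2, h5, d.cyl_plus_of_mem hc hj hz hQ, d.cyl_plus_of_mem hc hi ⟨h0, h1.le⟩ hQ]

/-- The half-turn exchanges the two boundaries of the strip, so the shear that fixes the lower one
becomes the shear that fixes the upper one. The two differ by `m` full turns. -/
theorem rotation_twistPlus (d : Direction c u e κ) (hc : 1 ≤ c) (m : ℤ) {j : ℤ} (hj : e ≤ j)
    {z : Plane} (hz : z ∈ closedStrip c u j) (hQ : z ∈ Qplus c) :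
    rotation c (d.twistPlus hc m z) =
      cyl c u e κ j (stripShear c u (m * κ) j (edgeShift c j - z)) := by
  rw [d.twistPlus_eq hc m hj hz hQ, d.rotation_cyl hc hj (stripShear_mem_closedStrip hz),
    ← d.cyl_add_period hj _ m]
  congr 1
  simp only [stripShear, wedge_sub_right, edgeShift, wedge_add_right, height]
  module

theorem twistPlus_glue (d : Direction c u e κ) (hc : 1 ≤ c) (m : ℤ) {k : ℤ} {z : Plane}
    (hz : z ∈ segment ℝ (P c k) (P c (k + 1))) :
    d.twistPlus hc m z = rotation c (d.twistPlus hc m (edgeShift c k - z)) := by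
  have hQ := segment_subset_Qplus c k hz
  have hz' := shift_sub_mem_segment hz
  have hQ' := segment_subset_Qplus c k hz'
  rcases d.edge_cases k with ⟨j, hj, hk⟩ | ⟨he, rfl⟩
  · have h1 := d.edge_subset_closedStrip hj hk hz
    have h2 := d.edge_subset_closedStrip hj hk hz'
    rw [d.rotation_twistPlus hc m hj h2 hQ', d.twistPlus_eq hc m hj h1 hQ]
    rcases hk with rfl | rfl
    · rw [sub_sub_cancel]
    · rw [← d.cyl_add_period hj (stripShear c u (m * κ) j z) 1]
      congr 1
      have hp : edgeShift c j = edgeShift c (e - 1 - j) + (κ * height c u j) • u := by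
        rw [← d.period j]; abel
      rw [hp, stripShear, stripShear, show edgeShift c (e - 1 - j) + (κ * height c u j) • u -
        (edgeShift c (e - 1 - j) - z) = z + (κ * height c u j) • u by abel, wedge_add_smul]
      push_cast
      module
  -- The remaining edge, from `P_0` to `P_1` in the slope 1 case, is parallel to `u`. It lies on the
  -- level that the lowest shear fixes, so the twist is the identity on it.
  · have h1 := d.flat_edge_level he hz
    have h2 := d.flat_edge_level he hz'
    have hm := (d.level_strictMono le_rfl (show e < e + 1 by omega)).le
    have m1 : z ∈ closedStrip c u e := ⟨h1.ge, h1 ▸ hm⟩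
    have m2 : edgeShift c 0 - z ∈ closedStrip c u e := ⟨h2.ge, h2 ▸ hm⟩
    have e1 : stripShear c u (m * κ) e z = z := by
      rw [stripShear, h1, sub_self, mul_zero, zero_smul, add_zero]
    have e2 : stripShear c u (m * κ) e (edgeShift c 0 - z) = edgeShift c 0 - z := by
      rw [stripShear, h2, sub_self, mul_zero, zero_smul, add_zero]
    rw [d.twistPlus_eq hc m le_rfl m1 hQ, d.twistPlus_eq hc m le_rfl m2 hQ', e1, e2,
      d.cyl_plus_of_mem hc le_rfl m1 hQ, d.cyl_plus_of_mem hc le_rfl m2 hQ', rotation_pl hQ',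
      neg_sub, pl_eq_mi hz]

theorem continuousOn_twistPlus (d : Direction c u e κ) (hc : 1 ≤ c) (m : ℤ) :
    ContinuousOn (d.twistPlus hc m) (Qplus c) := by
  have hstrip (j : ℤ) (hj : e ≤ j) :
      ContinuousOn (d.twistPlus hc m) (Qplus c ∩ closedStrip c u j) := by
    have := (d.continuousOn_cyl hc hj).comp (t := closedStrip c u j)
      (s := Qplus c ∩ closedStrip c u j)
      (continuous_stripShear (c := c) (u := u) (m * κ) j).continuousOn
      fun z hz => stripShear_mem_closedStrip hz.2
    exact this.congr fun z hz => d.twistPlus_eq hc m hj hz.2 hz.1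
  have hcl (j : ℤ) : IsClosed (Qplus c ∩ closedStrip c u j) :=
    (isClosed_Qplus hc).inter (isClosed_closedStrip c u j)
  have hw := continuous_wedge u
  intro z hz
  obtain ⟨j, hj, h0, h1⟩ := d.exists_strip_of_mem hc hz
  rcases hj.eq_or_lt with rfl | hlt
  · refine (hstrip e le_rfl z ⟨hz, h0, h1.le⟩).mono_of_mem_nhdsWithin ?_
    filter_upwards [self_mem_nhdsWithin, mem_nhdsWithin_of_mem_nhds
      ((isOpen_lt hw continuous_const).mem_nhds h1)] with y hy hy'
    exact ⟨hy, d.bottom y fun k => lam_nonneg_of_mem hc hy k, le_of_lt hy'⟩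
  · have hj' : e ≤ j - 1 := by omega
    have := ((hstrip (j - 1) hj').union_of_isClosed (hstrip j hj) (hcl _) (hcl _)) z
      (Or.inr ⟨hz, h0, h1.le⟩)
    refine this.mono_of_mem_nhdsWithin ?_
    have h2 := d.level_strictMono hj' (show j - 1 < j by omega)
    filter_upwards [self_mem_nhdsWithin, mem_nhdsWithin_of_mem_nhds
      ((isOpen_lt hw continuous_const).mem_nhds h1), mem_nhdsWithin_of_mem_nhds
      ((isOpen_lt continuous_const hw).mem_nhds (h2.trans_le h0))] with y hy hy1 hy2
    rcases le_total (wedge u y) (wedge u (P c j)) with h | h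
    · exact Or.inl ⟨hy, le_of_lt hy2, by rwa [sub_add_cancel]⟩
    · exact Or.inr ⟨hy, h, le_of_lt hy1⟩

/-- The `m`-fold twist as a map. -/
noncomputable def twistFun (d : Direction c u e κ) (hc : 1 ≤ c) (m : ℤ) : Surface c → Surface c :=
  Quot.lift (Sum.elim (fun x => d.twistPlus hc m x) (fun y => rotation c (d.twistPlus hc m (-y))))
    (by
      rintro _ _ ⟨k, x, y, hx, hy⟩
      simp only [Sum.elim_inl, Sum.elim_inr, hy, neg_sub]
      exact d.twistPlus_glue hc m hx)

theorem twistFun_pl (d : Direction c u e κ) (hc : 1 ≤ c) (m : ℤ) {z : Plane} (hz : z ∈ Qplus c) :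
    d.twistFun hc m (pl c z) = d.twistPlus hc m z := by
  rw [pl_of_mem hz]; rfl

theorem twistFun_mi (d : Direction c u e κ) (hc : 1 ≤ c) (m : ℤ) {z : Plane} (hz : z ∈ Qplus c) :
    d.twistFun hc m (mi c (-z)) = rotation c (d.twistPlus hc m z) := by
  rw [mi_of_mem (neg_mem_Qminus.2 hz)]
  show rotation c (d.twistPlus hc m (- -z)) = _
  rw [neg_neg]

theorem continuous_twistFun (d : Direction c u e κ) (hc : 1 ≤ c) (m : ℤ) :
    Continuous (d.twistFun hc m) := by
  refine continuous_quot_lift _ (Continuous.sumElim ?_ ?_)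
  · exact (d.continuousOn_twistPlus hc m).comp_continuous continuous_subtype_val fun x => x.2
  · exact (rotation c).continuous.comp ((d.continuousOn_twistPlus hc m).comp_continuous
      continuous_subtype_val.neg fun x => mem_Qminus.1 x.2)

theorem twistFun_cyl (d : Direction c u e κ) (hc : 1 ≤ c) (m : ℤ) {j : ℤ} (hj : e ≤ j)
    {z : Plane} (hz : z ∈ closedStrip c u j) :
    d.twistFun hc m (cyl c u e κ j z) = cyl c u e κ j (stripShear c u (m * κ) j z) := by
  obtain ⟨n, w, hw, hw', ⟨h, h'⟩ | ⟨h, h'⟩⟩ := d.cyl_cases hc hj hz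
  · rw [h', d.twistFun_pl hc m hw, d.twistPlus_eq hc m hj hw' hw, h,
      ← d.cyl_add_period hj (stripShear c u (m * κ) j w) n]
    congr 1
    rw [stripShear, stripShear, wedge_add_smul]; abel
  · rw [h', d.twistFun_mi hc m hw, d.rotation_twistPlus hc m hj hw' hw, h,
      ← d.cyl_add_period hj (stripShear c u (m * κ) j (edgeShift c j - w)) n]
    congr 1
    rw [stripShear, stripShear, wedge_add_smul]; abel

theorem twistFun_twistFun (d : Direction c u e κ) (hc : 1 ≤ c) (m : ℤ) (p : Surface c) :
    d.twistFun hc m (d.twistFun hc (-m) p) = p := by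
  obtain ⟨j, hj, z, hz, rfl⟩ := d.exists_cyl_eq hc p
  rw [d.twistFun_cyl hc _ hj hz, d.twistFun_cyl hc _ hj (stripShear_mem_closedStrip hz)]
  congr 1
  rw [stripShear, wedge_stripShear, stripShear]
  push_cast
  module

/-- The automorphism that acts on every cylinder in the direction `u` as the `m`-fold right
Dehn twist. -/
noncomputable def twist (d : Direction c u e κ) (hc : 1 ≤ c) (m : ℤ) :
    Surface c ≃ₜ Surface c where
  toFun := d.twistFun hc m
  invFun := d.twistFun hc (-m)
  left_inv p := by simpa using d.twistFun_twistFun hc (-m) p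
  right_inv p := d.twistFun_twistFun hc m p
  continuous_toFun := d.continuous_twistFun hc m
  continuous_invFun := d.continuous_twistFun hc (-m)

theorem twistFun_rotation (d : Direction c u e κ) (hc : 1 ≤ c) (m : ℤ) (p : Surface c) :
    d.twistFun hc m (rotation c p) = rotation c (d.twistFun hc m p) := by
  rcases surface_cases p with ⟨z, hz, rfl⟩ | ⟨z, hz, rfl⟩
  · rw [rotation_pl hz, d.twistFun_mi hc m hz, d.twistFun_pl hc m hz]
  · rw [rotation_mi (neg_mem_Qminus.2 hz), neg_neg, d.twistFun_mi hc m hz, d.twistFun_pl hc m hz,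
      rotation_rotation]

end Direction

namespace Direction

variable {c : ℝ} {u : Plane} {e : ℤ} {κ : ℝ}

/-! ### The diagonals -/

theorem diag_right (d : Direction c u e κ) {j : ℤ} (hj : e ≤ j) {z : Plane}
    (hl : wedge u z = wedge u (P c j)) : z + (lam c j z / height c u j) • u = P c j := by
  rw [d.right_point hj, hl, sub_self, zero_div, zero_smul, add_zero]

theorem diag_left (d : Direction c u e κ) {j : ℤ} (hj : e ≤ j) {z : Plane}
    (hl : wedge u z = wedge u (P c j)) :
    z + (-(lam c (e - 1 - j) z / height c u j)) • u = P c (e - j) := by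
  rw [d.left_point hj, hl, sub_self, zero_div, zero_smul, add_zero]

theorem diag_pos (d : Direction c u e κ) (hc : 1 ≤ c) {j : ℤ} (hj : e ≤ j) {z : Plane}
    (hz : z ∈ Qplus c) (hl : wedge u z = wedge u (P c j)) (hv : ∀ k, z ≠ P c k) :
    0 < lam c j z ∧ 0 < lam c (e - 1 - j) z := by
  refine ⟨lt_of_le_of_ne (lam_nonneg_of_mem hc hz _) fun h => hv j ?_,
    lt_of_le_of_ne (lam_nonneg_of_mem hc hz _) fun h => hv (e - j) ?_⟩
  · simpa [← h] using d.diag_right hj hl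
  · simpa [← h] using d.diag_left hj hl

/-- Away from its ends, a diagonal above the lowest one lies strictly between the sides of the
trapezoids on both sides of it, and these two trapezoids together contain a neighbourhood. -/
theorem diag_interior (d : Direction c u e κ) (hc : 1 ≤ c) {j : ℤ} (hj : e < j) {z : Plane}
    (hz : z ∈ Qplus c) (hl : wedge u z = wedge u (P c j)) (hv : ∀ k, z ≠ P c k) :
    z ∈ interior (Qplus c) := by
  obtain ⟨h1, h2⟩ := d.diag_pos hc hj.le hz hl hv
  have hh := d.step_pos hj.le
  have hj' : e ≤ j - 1 := by omega
  have hh' := d.step_pos hj'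
  have h3 : 0 < lam c (j - 1) z := by
    have := lam_right c u (j - 1) z (lam c j z / height c u j)
    rw [d.diag_right hj.le hl] at this
    have h0 := lam_self_succ c (j - 1)
    rw [sub_add_cancel] at h0
    rw [h0] at this
    have := mul_pos (div_pos h1 hh) hh'
    linarith
  have h4 : 0 < lam c (e - 1 - (j - 1)) z := by
    have := d.lam_left (j - 1) z (-(lam c (e - 1 - j) z / height c u j))
    rw [d.diag_left hj.le hl, show e - 1 - (j - 1) = e - j by ring, lam_self] at this
    rw [show e - 1 - (j - 1) = e - j by ring]
    have := mul_pos (div_pos h2 hh) hh'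
    linarith
  have hw := continuous_wedge u
  refine interior_maximal (t := {z | wedge u (P c (j - 1)) < wedge u z} ∩
    ({z | wedge u z < wedge u (P c (j + 1))} ∩ ({z | 0 < lam c j z} ∩
    ({z | 0 < lam c (e - 1 - j) z} ∩ ({z | 0 < lam c (j - 1) z} ∩
    {z | 0 < lam c (e - 1 - (j - 1)) z}))))) (fun w hw => ?_) ?_ ⟨?_, ?_, h1, h2, h3, h4⟩
  · obtain ⟨a1, a2, a3, a4, a5, a6⟩ := hw
    rcases le_total (wedge u (P c j)) (wedge u w) with h | h
    · exact d.mem_Qplus hj.le ⟨h, le_of_lt a2⟩ (le_of_lt a3) (le_of_lt a4)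
    · exact d.mem_Qplus hj' ⟨le_of_lt a1, by rwa [sub_add_cancel]⟩ (le_of_lt a5) (le_of_lt a6)
  · have o (k : ℤ) : IsOpen {z | 0 < lam c k z} := isOpen_lt continuous_const (continuous_lam c k)
    exact (isOpen_lt continuous_const hw).inter ((isOpen_lt hw continuous_const).inter
      ((o _).inter ((o _).inter ((o _).inter (o _)))))
  · show wedge u (P c (j - 1)) < wedge u z
    rw [hl]; exact d.level_strictMono hj' (by omega)
  · show wedge u z < wedge u (P c (j + 1))
    rw [hl]; exact d.level_strictMono hj.le (by omega)

/-- For `e = 0` the lowest diagonal has equal ends and is reduced to the vertex `P_0`. -/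
theorem base_eq_one (d : Direction c u e κ) (hc : 1 ≤ c) {z : Plane}
    (hz : z ∈ Qplus c) (hl : wedge u z = wedge u (P c e)) (hv : ∀ k, z ≠ P c k) : e = 1 := by
  refine d.base.resolve_left fun he => ?_
  obtain ⟨h1, h2⟩ := d.diag_pos hc le_rfl hz hl hv
  have hh := d.step_pos le_rfl
  have e1 := d.diag_right le_rfl hl
  have e2 := d.diag_left le_rfl hl
  rw [sub_self, ← he, ← e1] at e2
  have := congrFun e2 0
  simp only [Pi.add_apply, Pi.smul_apply, smul_eq_mul, d.fst] at this
  have := div_pos h1 hh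
  have := div_pos h2 hh
  linarith

/-- One chart serves for all diagonals: a nondegenerate lowest diagonal is the edge of index 0, and
the open parts of the others are in the interior of `Q_c^+`. -/
theorem diag_mem_W (d : Direction c u e κ) (hc : 1 ≤ c) {j : ℤ} (hj : e ≤ j) {z : Plane}
    (hz : z ∈ Qplus c) (hl : wedge u z = wedge u (P c j)) (hv : ∀ k, z ≠ P c k) : z ∈ W c 0 := by
  rcases hj.eq_or_lt with rfl | hj
  · obtain ⟨h1, h2⟩ := d.diag_pos hc le_rfl hz hl hv
    have he := d.base_eq_one hc hz hl hv
    have hh := d.step_pos le_rfl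
    have e1 := congrFun (d.diag_right le_rfl hl) 0
    have e2 := congrFun (d.diag_left le_rfl hl) 0
    rw [sub_self] at e2
    have e3 : P c (0 + 1) 0 = P c e 0 := by rw [he, zero_add]
    simp only [Pi.add_apply, Pi.smul_apply, smul_eq_mul, d.fst] at e1 e2
    have := div_pos h1 hh
    have := div_pos h2 hh
    exact Or.inl (Or.inr ⟨by linarith, by linarith⟩)
  · exact interior_subset_W c 0 (d.diag_interior hc hj hz hl hv)

theorem psi_zero {z : Plane} (hc : 1 ≤ c) (hz : z ∈ Qplus c) : psi c 0 z = pl c z :=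
  psi_of_nonneg (lam_nonneg_of_mem hc hz 0)

theorem not_vertex (hc : 1 ≤ c) {k : ℤ} {w z : Plane} (hw : w ∈ W c k) (hz : z ∈ Qplus c)
    (h : psi c k w = pl c z) (j : ℤ) : z ≠ P c j := by
  rw [← eq_of_psi_eq_pl hc hw hz h]
  rintro rfl
  exact P_notMem_W hc j k hw

/-! ### The derivative of the twists -/

/-- The shear with the direction `u`. -/
def shear (u : Plane) (a : ℝ) (v : Plane) : Plane := v + (a * wedge u v) • u

theorem continuous_shear (u : Plane) (a : ℝ) : Continuous (shear u a) := by
  have := continuous_wedge u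
  unfold shear; fun_prop

theorem shear_zero (u : Plane) (a : ℝ) : shear u a 0 = 0 := by
  simp [shear, wedge_zero_right]

theorem shear_neg (u : Plane) (a : ℝ) (v : Plane) : shear u a (-v) = -shear u a v := by
  simp only [shear, wedge_neg_right]; module

theorem wedge_shear (u : Plane) (a : ℝ) (v : Plane) : wedge u (shear u a v) = wedge u v :=
  wedge_add_smul u v _

theorem tendsto_shear (u : Plane) (a : ℝ) : Tendsto (shear u a) (𝓝 0) (𝓝 0) := by
  simpa [shear_zero] using (continuous_shear u a).tendsto 0

theorem stripShear_add {a : ℝ} {j : ℤ} (z v : Plane) :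
    stripShear c u a j (z + v) = stripShear c u a j z + shear u a v := by
  simp only [stripShear, shear, wedge_add_right]; module

theorem stripShear_of_level {a : ℝ} {j : ℤ} {z : Plane} (hl : wedge u z = wedge u (P c j)) :
    stripShear c u a j z = z := by
  rw [stripShear, hl, sub_self, mul_zero, zero_smul, add_zero]

theorem stripShear_of_level_succ {a : ℝ} {j : ℤ} {z : Plane}
    (hl : wedge u z = wedge u (P c (j + 1))) :
    stripShear c u a j z = z + (a * height c u j) • u := by
  rw [stripShear, hl, height]

theorem twistPlus_near_diag (d : Direction c u e κ) (hc : 1 ≤ c) (m : ℤ) {j : ℤ} (hj : e ≤ j)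
    {z v : Plane} (hl : wedge u z = wedge u (P c j)) (hv : z + v ∈ closedStrip c u j)
    (hQ : z + v ∈ Qplus c) (hQ' : z + shear u (m * κ) v ∈ Qplus c) :
    d.twistFun hc m (psi c 0 (z + v)) = psi c 0 (z + shear u (m * κ) v) := by
  have h1 : z + shear u (m * κ) v ∈ closedStrip c u j := by
    simpa only [closedStrip, mem_ofPred_eq, wedge_add_right, wedge_shear] using hv
  rw [psi_zero hc hQ, psi_zero hc hQ', d.twistFun_pl hc m hQ, d.twistPlus_eq hc m hj hv hQ,
    stripShear_add, stripShear_of_level hl, d.cyl_plus_of_mem hc hj h1 hQ']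

theorem lam_zero_of_base_one (d : Direction c u e κ) (he : e = 1) (z : Plane) :
    lam c 0 z = wedge u z := by
  subst he
  have h := d.symm 1
  have h0 := d.fst
  rw [sub_self, P_zero, P_one] at h
  simp [wedge, h0] at h
  simp [lam_eq, P_one, P_zero, wedge, h0, show u 1 = 1 by linarith]

/-- Near a diagonal, the twist is a shear. -/
theorem twist_near_diag (d : Direction c u e κ) (hc : 1 ≤ c) (m : ℤ) {j : ℤ} (hj : e ≤ j)
    {z : Plane} (hz : z ∈ Qplus c) (hl : wedge u z = wedge u (P c j)) (hnv : ∀ k, z ≠ P c k) :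
    ∀ᶠ v in 𝓝 (0 : Plane), d.twistFun hc m (psi c 0 (z + v)) =
      psi c 0 (z + shear u (m * κ) v) := by
  have hw := continuous_wedge u
  have hup : ∀ᶠ v in 𝓝 (0 : Plane), z + v ∈ {z | wedge u z < wedge u (P c (j + 1))} :=
    eventually_add_mem (isOpen_lt hw continuous_const)
      (show wedge u z < _ from hl ▸ d.level_strictMono hj (by omega))
  rcases hj.eq_or_lt with rfl | hlt
  · have he := d.base_eq_one hc hz hl hnv
    have hW := d.diag_mem_W hc le_rfl hz hl hnv
    have hl0 : wedge u (P c e) = 0 := by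
      rw [← d.lam_zero_of_base_one he, he, ← zero_add (1 : ℤ), lam_self_succ]
    -- Around the edge of index 0 only the upper half belongs to `Q_c^+`. The lower half follows by
    -- the rotation, which commutes with the twist.
    have half : ∀ y v : Plane, wedge u y = wedge u (P c e) → y + v ∈ W c 0 →
        y + shear u (m * κ) v ∈ W c 0 → 0 ≤ wedge u v → wedge u v ≤ wedge u (P c (e + 1)) →
        d.twistFun hc m (psi c 0 (y + v)) = psi c 0 (y + shear u (m * κ) v) := by
      intro y v hy h1 h2 h3 h4
      refine d.twistPlus_near_diag hc m le_rfl hy ?_ (mem_Qplus_of_W hc h1 ?_)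
        (mem_Qplus_of_W hc h2 ?_)
      · constructor <;> rw [wedge_add_right] <;> linarith
      · rw [d.lam_zero_of_base_one he, wedge_add_right]; linarith
      · rw [d.lam_zero_of_base_one he, wedge_add_right, wedge_shear]; linarith
    have hup' : ∀ᶠ v in 𝓝 (0 : Plane), 0 + v ∈ {z | -wedge u (P c (e + 1)) < wedge u z} :=
      eventually_add_mem (isOpen_lt continuous_const hw) (by
        have := d.level_strictMono le_rfl (show e < e + 1 by omega)
        show _ < wedge u 0
        rw [wedge_zero_right]; linarith)
    filter_upwards [hup, hup', eventually_add_mem (isOpen_W c 0) hW,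
      (tendsto_shear u (m * κ)).eventually (eventually_add_mem (isOpen_W c 0) hW)]
      with v h1 h2 h3 h4
    rw [wedge_add_right] at h1
    rw [zero_add] at h2
    rcases le_or_gt 0 (wedge u v) with h | h
    · exact half z v hl h3 h4 h (by linarith)
    · have hs : wedge u (edgeShift c 0 - z) = wedge u (P c e) := by
        rw [← d.lam_zero_of_base_one he, lam_shift_sub, d.lam_zero_of_base_one he, hl, hl0, neg_zero]
      have h5 := half (edgeShift c 0 - z) (-v) hs
        (by rw [← sub_eq_add_neg, sub_sub]; exact shift_sub_mem_W.2 h3)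
        (by rw [shear_neg, ← sub_eq_add_neg, sub_sub]; exact shift_sub_mem_W.2 h4)
        (by rw [wedge_neg_right]; linarith) (by rw [wedge_neg_right]; linarith)
      rw [shear_neg, ← sub_eq_add_neg, ← sub_eq_add_neg, sub_sub, sub_sub, ← rotation_psi hc h3,
        ← rotation_psi hc h4, d.twistFun_rotation] at h5
      exact (rotation c).injective h5
  · have hj' : e ≤ j - 1 := by omega
    have hint := d.diag_interior hc hlt hz hl hnv
    have hdown : ∀ᶠ v in 𝓝 (0 : Plane), z + v ∈ {z | wedge u (P c (j - 1)) < wedge u z} :=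
      eventually_add_mem (isOpen_lt continuous_const hw)
        (show _ < wedge u z from hl ▸ d.level_strictMono hj' (by omega))
    filter_upwards [hup, hdown, eventually_add_mem isOpen_interior hint,
      (tendsto_shear u (m * κ)).eventually (eventually_add_mem isOpen_interior hint)]
      with v h1 h2 h3 h4
    have h3 := interior_subset h3
    have h4 := interior_subset h4
    rcases le_total (wedge u (P c j)) (wedge u (z + v)) with h | h
    · exact d.twistPlus_near_diag hc m hj hl ⟨h, le_of_lt h1⟩ h3 h4
    · have hv : z + v ∈ closedStrip c u (j - 1) := ⟨le_of_lt h2, by rwa [sub_add_cancel]⟩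
      have h5 : z + shear u (m * κ) v ∈ closedStrip c u (j - 1) := by
        simpa only [closedStrip, mem_ofPred_eq, wedge_add_right, wedge_shear] using hv
      rw [psi_zero hc h3, psi_zero hc h4, d.twistFun_pl hc m h3, d.twistPlus_eq hc m hj' hv h3,
        stripShear_add, stripShear_of_level_succ (by rw [sub_add_cancel, hl]), mul_assoc,
        add_right_comm, d.cyl_add_period hj', d.cyl_plus_of_mem hc hj' h5 h4]

theorem flat_psi_id {k : ℤ} {z : Plane} (hz : z ∈ W c k) :
    Flat (.id ℝ Plane) (fun v => psi c k (z + v)) 0 :=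
  ⟨k, z, hz, by simp⟩

/-- For a point of `Q_c^+` the given chart is first replaced, by the dichotomy, by one adapted to
the direction: the cylinder map inside a strip, or `psi c 0` on a diagonal. Points of `Q_c^-` are
reduced to this case by the rotation. -/
theorem twist_local (d : Direction c u e κ) (hc : 1 ≤ c) (m : ℤ) {k : ℤ} {z : Plane}
    (hz : z ∈ W c k) : ∃ i, ∃ w ∈ W c i, ∀ᶠ v in 𝓝 (0 : Plane),
      d.twistFun hc m (psi c k (z + v)) = psi c i (w + shear u (m * κ) v) := by
  have hneg : Tendsto (fun v : Plane => -v) (𝓝 0) (𝓝 0) := by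
    simpa using (continuous_neg (G := Plane)).tendsto 0
  have hS := tendsto_shear u (m * κ)
  have plus : ∀ y ∈ Qplus c, ∀ k, ∀ z ∈ W c k, psi c k z = pl c y →
      ∃ i, ∃ w ∈ W c i, ∀ᶠ v in 𝓝 (0 : Plane),
        d.twistFun hc m (psi c k (z + v)) = psi c i (w + shear u (m * κ) v) := by
    intro y hy k z hz h
    obtain ⟨j, hj, h0, h1⟩ := d.exists_strip_of_mem hc hy
    rcases h0.eq_or_lt with h0 | h0
    · have hnv := not_vertex hc hz hy h
      have hW := d.diag_mem_W hc hj hy h0.symm hnv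
      refine ⟨0, y, hW, ?_⟩
      have := ((flat_psi_id hz).dichotomy hc (flat_psi_id hW)).resolve_right fun h' =>
        h'.self_of_nhds (by rw [add_zero, add_zero, h, psi_zero hc hy])
      filter_upwards [this, d.twist_near_diag hc m hj hy h0.symm hnv] with v e1 e2
      rw [e1, e2]
    · have hy' : y ∈ openStrip c u j := ⟨h0, h1⟩
      obtain ⟨i, w, hw, hc1⟩ := d.flat_cyl hc hj hy'
      have hfl : Flat (.id ℝ Plane) (fun v => cyl c u e κ j (y + v)) 0 :=
        ⟨i, w, hw, by simpa using hc1⟩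
      have h2 := ((flat_psi_id hz).dichotomy hc hfl).resolve_right fun h' =>
        h'.self_of_nhds (by
          rw [add_zero, add_zero, h, d.cyl_plus_of_mem hc hj (openStrip_subset c u j hy') hy])
      obtain ⟨i', w', hw', hc2⟩ :=
        d.flat_cyl hc hj (stripShear_mem_openStrip (a := m * κ) hy')
      refine ⟨i', w', hw', ?_⟩
      filter_upwards [h2, hS.eventually hc2,
        eventually_add_mem (isOpen_openStrip c u j) hy'] with v e1 e2 e3
      rw [e1, d.twistFun_cyl hc m hj (openStrip_subset c u j e3), stripShear_add, e2]
      rfl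
  rcases surface_cases (psi c k z) with ⟨y, hy, h⟩ | ⟨y, hy, h⟩
  · exact plus y hy k z hz h
  · obtain ⟨i, w, hw, hv⟩ := plus y hy k _ (shift_sub_mem_W.2 hz)
      (by rw [← rotation_psi hc hz, h, rotation_mi (neg_mem_Qminus.2 hy), neg_neg])
    refine ⟨i, edgeShift c i - w, shift_sub_mem_W.2 hw, ?_⟩
    filter_upwards [hneg.eventually hv, eventually_add_mem (isOpen_W c k) hz,
      (hneg.comp hS).eventually (eventually_add_mem (isOpen_W c i) hw)] with v e1 e2 e3
    rw [← sub_eq_add_neg, sub_sub, ← rotation_psi hc e2, d.twistFun_rotation, shear_neg] at e1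
    have := congrArg (rotation c) e1
    simp only [Function.comp_apply] at e3
    rw [rotation_rotation, rotation_psi hc e3] at this
    rw [this]
    congr 1
    abel

theorem twist_hasDerivative (d : Direction c u e κ) (hc : 1 ≤ c) (m : ℤ) :
    HasDerivative (d.twist hc m) (shearGL u (m * κ)) := by
  have key : ∀ (m : ℤ) (k : ℤ), ∀ z ∈ W c k, IsChartAt c (d.twistFun hc m (psi c k z)) fun v =>
      d.twistFun hc m (psi c k
        (z + (((shearGL u (m * κ))⁻¹ : GL (Fin 2) ℝ) : Matrix (Fin 2) (Fin 2) ℝ).mulVec v)) := by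
    intro m k z hz
    obtain ⟨i, w, hw, hv⟩ := d.twist_local hc m hz
    refine isChartAt_of_psi hc hw ?_
    have ht := tendsto_shear u (-(m * κ))
    filter_upwards [ht.eventually hv] with v e1
    rw [shearGL_inv, shearGL_mulVec]
    refine e1.trans ?_
    congr 2
    simp only [shear, wedge_add_right, wedge_smul_right, wedge_self]
    module
  refine hasDerivative_of_charts hc (key m) ?_
  have := key (-m)
  rw [shearGL_inv] at this
  intro k z hz
  have := this k z hz
  push_cast at this
  rw [neg_mul, neg_neg] at this
  exact this

end Direction

/-! ### Flat maps and automorphisms -/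

theorem HasDerivative.eventually_psi {c : ℝ} (hc : 1 ≤ c) {f : Surface c ≃ₜ Surface c}
    {A : GL (Fin 2) ℝ} (hf : HasDerivative f A) {k : ℤ} {z : Plane} (hz : z ∈ W c k) :
    ∃ m, ∃ w ∈ W c m, ∀ᶠ s in 𝓝 (0 : Plane),
      f (psi c k (z + s)) = psi c m (w + (A : Matrix (Fin 2) (Fin 2) ℝ).mulVec s) := by
  obtain ⟨-, m, w, hw, h⟩ := (isChartAt_iff hc).1 ((hf _ _).1 (isChartAt_psi hc hz))
  refine ⟨m, w, hw, ?_⟩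
  have ht : Tendsto (fun s : Plane => (A : Matrix (Fin 2) (Fin 2) ℝ).mulVec s) (𝓝 0) (𝓝 0) := by
    have : Continuous fun s : Plane => (A : Matrix (Fin 2) (Fin 2) ℝ).mulVec s :=
      continuous_const.matrix_mulVec continuous_id
    simpa using this.tendsto 0
  have hA : ((A⁻¹ : GL (Fin 2) ℝ) : Matrix (Fin 2) (Fin 2) ℝ) * (A : Matrix (Fin 2) (Fin 2) ℝ)
      = 1 := by
    rw [← Units.val_mul, inv_mul_cancel, Units.val_one]
  filter_upwards [ht.eventually h] with s e
  rw [← e, Matrix.mulVec_mulVec, hA, Matrix.one_mulVec]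

theorem HasDerivative.flat {c : ℝ} (hc : 1 ≤ c) {f : Surface c ≃ₜ Surface c} {A : GL (Fin 2) ℝ}
    (hf : HasDerivative f A) {E : Type*} [NormedAddCommGroup E] [NormedSpace ℝ E]
    {L L' : E →L[ℝ] Plane} (hL : ∀ s, L' s = (A : Matrix (Fin 2) (Fin 2) ℝ).mulVec (L s))
    {σ : E → Surface c} {x : E} (hσ : Flat L σ x) : Flat L' (fun y => f (σ y)) x := by
  obtain ⟨k, z, hz, h⟩ := hσ
  obtain ⟨m, w, hw, h'⟩ := hf.eventually_psi hc hz
  refine ⟨m, w, hw, ?_⟩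
  have ht : Tendsto L (𝓝 0) (𝓝 0) := by simpa using L.continuous.tendsto 0
  filter_upwards [h, ht.eventually h'] with s e1 e2
  rw [e1, e2, hL]

/-- The line in the direction `v`, as a linear map. -/
noncomputable def line (v : Plane) : ℝ →L[ℝ] Plane := ContinuousLinearMap.toSpanSingleton ℝ v

@[simp] theorem line_apply (v : Plane) (t : ℝ) : line v t = t • v := by
  simp [line]

theorem flat_reverse {c : ℝ} {v : Plane} {σ : ℝ → Surface c} {a t : ℝ}
    (h : Flat (line v) σ (a - t)) : Flat (line (-v)) (fun s => σ (a - s)) t := by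
  obtain ⟨k, z, hz, h⟩ := h
  refine ⟨k, z, hz, ?_⟩
  have hneg : Tendsto (fun s : ℝ => -s) (𝓝 0) (𝓝 0) := by
    simpa using (continuous_neg (G := ℝ)).tendsto 0
  filter_upwards [hneg.eventually h] with s e1
  rw [show a - (t + s) = a - t + -s by ring, e1]
  simp

theorem flat_rotation {c : ℝ} (hc : 1 ≤ c) {v : Plane} {σ : ℝ → Surface c} {t : ℝ}
    (h : Flat (line v) σ t) : Flat (line (-v)) (fun s => rotation c (σ s)) t :=
  (rotation_hasDerivative hc).flat hc (fun s => by simp [Matrix.neg_mulVec]) h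

/-- The restriction of a flat map to a line. -/
theorem Flat.line {c : ℝ} {Φ : Plane → Surface c} {z v : Plane} {t : ℝ}
    (h : Flat (.id ℝ Plane) Φ (z + t • v)) :
    Flat (HooperSurface.line v) (fun s => Φ (z + s • v)) t := by
  obtain ⟨k, w, hw, h⟩ := h
  refine ⟨k, w, hw, ?_⟩
  have ht : Tendsto (fun s : ℝ => s • v) (𝓝 0) (𝓝 0) := by
    have : Continuous fun s : ℝ => s • v := by fun_prop
    simpa using this.tendsto 0
  filter_upwards [ht.eventually h] with s e1
  rw [add_smul, ← add_assoc, e1]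
  simp

theorem flat_line_psi {c : ℝ} {k : ℤ} {z v : Plane} {t : ℝ} (h : z + t • v ∈ W c k) :
    Flat (line v) (fun s => psi c k (z + s • v)) t := by
  have := flat_psi (c := c) (k := k) (line v) (z := z) (x := t) (by simpa using h)
  simpa using this

/-- A flat line cannot run into a vertex from the left. -/
theorem not_flat_at_vertex {c : ℝ} (hc : 1 ≤ c) {j : ℤ} {v : Plane} {σ : ℝ → Surface c} {s : ℝ}
    (hσ : Flat (line v) σ s) (hQ : ∀ᶠ t in 𝓝[>] (0 : ℝ), P c j + t • (-v) ∈ Qplus c)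
    (h : ∀ᶠ t in 𝓝[>] (0 : ℝ), σ (s - t) = pl c (P c j + t • (-v))) : False := by
  obtain ⟨k, z, hz, h'⟩ := hσ
  refine ray_not_psi hc hQ hz ?_
  have hneg : Tendsto (fun s : ℝ => -s) (𝓝[>] 0) (𝓝 0) := by
    have := (continuous_neg (G := ℝ)).tendsto 0
    rw [neg_zero] at this
    exact this.mono_left nhdsWithin_le_nhds
  filter_upwards [h, hneg.eventually h'] with t e1 e2
  rw [← e1, sub_eq_add_neg, e2]
  simp

namespace Direction

variable {c : ℝ} {u : Plane} {e : ℤ} {κ : ℝ}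

/-- A point on a complete line in the direction `u` is not on a diagonal. -/
theorem inCyl_of_line (d : Direction c u e κ) (hc : 1 ≤ c) {σ : ℝ → Surface c}
    (hσ : ∀ t, Flat (line u) σ t) : ∃ j, ∃ hj : e ≤ j, d.inCyl hj (σ 0) := by
  have plus : ∀ σ : ℝ → Surface c, (∀ t, Flat (line u) σ t) → ∀ z ∈ Qplus c, σ 0 = pl c z →
      ∃ j, e ≤ j ∧ z ∈ openStrip c u j := by
    intro σ hσ z hz h
    obtain ⟨j, hj, h0, h1⟩ := d.exists_strip_of_mem hc hz
    rcases h0.eq_or_lt with h0 | h0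
    · exfalso
      have hl := h0.symm
      have hnv : ∀ k, z ≠ P c k := by
        obtain ⟨k, w, hw, h'⟩ := hσ 0
        have := h'.self_of_nhds
        rw [add_zero, map_zero, add_zero, h] at this
        exact not_vertex hc hw hz this.symm
      obtain ⟨p1, p2⟩ := d.diag_pos hc hj hz hl hnv
      have hh := d.step_pos hj
      -- `s` is the parameter at which the line along the diagonal reaches `P_j`. Up to then `σ`
      -- follows the diagonal by unique continuation, so flatness at `s` would give a regular point
      -- in place of a vertex.
      set s := lam c j z / height c u j with hs
      have hspos : 0 < s := div_pos p1 hh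
      have hend : z + s • u = P c j := d.diag_right hj hl
      have hQ : ∀ t ∈ Ico 0 s, z + t • u ∈ Qplus c := by
        intro t ht
        refine d.mem_Qplus hj ?_ ?_ ?_
        · exact add_smul_mem_closedStrip ⟨h0.le, h1.le⟩ _
        · rw [lam_right]
          have : t * height c u j ≤ lam c j z := by
            have := ht.2.le
            rwa [hs, le_div_iff₀ hh] at this
          linarith
        · rw [d.lam_left]
          have := mul_nonneg ht.1 hh.le
          linarith
      have hW : ∀ t ∈ Ico 0 s, z + t • u ∈ W c 0 := by
        intro t ht
        refine d.diag_mem_W hc hj (hQ t ht) (by rw [wedge_add_smul, hl]) fun k hk => ?_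
        have hp1 : 0 < lam c j (z + t • u) := by
          rw [lam_right]
          have : t * height c u j < lam c j z := by
            have := ht.2
            rwa [hs, lt_div_iff₀ hh] at this
          linarith
        have hp2 : 0 < lam c (e - 1 - j) (z + t • u) := by
          rw [d.lam_left]
          have := mul_nonneg ht.1 hh.le
          linarith
        rw [hk] at hp1 hp2
        have hlk : wedge u (P c k) = wedge u (P c j) := by rw [← hk, wedge_add_smul, hl]
        rcases le_or_gt e k with hek | hek
        · rcases lt_trichotomy k j with hkj | rfl | hkj
          · linarith [d.level_strictMono hek hkj]
          · linarith [lam_self c k]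
          · linarith [d.level_strictMono hj hkj]
        · have hlk' : wedge u (P c (e - k)) = wedge u (P c j) := by rw [d.symm, hlk]
          have hek' : e ≤ e - k := by rcases d.base with h | h <;> omega
          rcases lt_trichotomy (e - k) j with hkj | hkj | hkj
          · linarith [d.level_strictMono hek' hkj]
          · have := lam_self_succ c (e - 1 - j)
            rw [show e - 1 - j + 1 = k by omega] at this
            linarith
          · linarith [d.level_strictMono hj hkj]
      have heq : EqOn σ (fun t => psi c 0 (z + t • u)) (Ico 0 s) :=
        Flat.eqOn hc isPreconnected_Ico (fun t _ => hσ t) (fun t ht => flat_line_psi (hW t ht))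
          (left_mem_Ico.2 hspos) (by simp [h, psi_zero hc hz])
      have hsmall : ∀ᶠ t in 𝓝[>] (0 : ℝ), t ∈ Ioc 0 s := Ioc_mem_nhdsGT hspos
      have hpt (t : ℝ) : P c j + t • (-u) = z + (s - t) • u := by rw [← hend]; module
      refine not_flat_at_vertex hc (hσ s) (j := j) ?_ ?_
      · filter_upwards [hsmall] with t ht
        rw [hpt]
        exact hQ _ ⟨by linarith [ht.2], by linarith [ht.1]⟩
      · filter_upwards [hsmall] with t ht
        have ht' : s - t ∈ Ico 0 s := ⟨by linarith [ht.2], by linarith [ht.1]⟩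
        rw [hpt, ← psi_zero hc (hQ _ ht')]
        exact heq ht'
    · exact ⟨j, hj, h0, h1⟩
  rcases surface_cases (σ 0) with ⟨z, hz, h⟩ | ⟨z, hz, h⟩
  · obtain ⟨j, hj, hz'⟩ := plus σ hσ z hz h
    exact ⟨j, hj, h ▸ (d.inCyl_pl hj hz).2 hz'⟩
  · obtain ⟨j, hj, hz'⟩ := plus (fun t => rotation c (σ (0 - t)))
      (fun t => by
        have := flat_rotation hc (flat_reverse (a := 0) (t := t) (hσ _))
        rwa [neg_neg] at this) z hz
      (by simp only [sub_zero]; rw [h, rotation_mi (neg_mem_Qminus.2 hz), neg_neg])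
    exact ⟨j, hj, h ▸ (d.inCyl_mi hj hz).2 hz'⟩

/-! ### Classification of the cylinders in the direction `u` -/

theorem strip_iff {j : ℤ} {z : Plane} :
    z ∈ strip u (height c u j) ↔ z + P c j ∈ openStrip c u j := by
  simp only [strip, openStrip, mem_ofPred_eq, wedge_add_right, height]
  constructor <;> rintro ⟨h1, h2⟩ <;> constructor <;> linarith

theorem isCylinder_cyl (d : Direction c u e κ) (hc : 1 ≤ c) {j : ℤ} (hj : e ≤ j) :
    IsCylinder c u (κ * height c u j) (height c u j) fun z => cyl c u e κ j (z + P c j) where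
  w_pos := mul_pos d.pos (d.step_pos hj)
  h_pos := d.step_pos hj
  chart z hz := by
    have := (isChartAt_iff_flat hc).2 (d.flat_cyl hc hj (strip_iff.1 hz))
    simpa only [add_right_comm] using this
  eq_iff z hz z' hz' := by
    rw [d.cyl_eq_iff hc hj (strip_iff.1 hz) (strip_iff.1 hz')]
    refine exists_congr fun n => ?_
    rw [add_right_comm, add_left_inj]

theorem image_cyl (d : Direction c u e κ) (hc : 1 ≤ c) {j : ℤ} (hj : e ≤ j) :
    (fun z => cyl c u e κ j (z + P c j)) '' strip u (height c u j) = {p | d.inCyl hj p} := by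
  ext p
  rw [mem_ofPred_eq, d.inCyl_iff hc hj]
  constructor
  · rintro ⟨z, hz, rfl⟩
    exact ⟨_, strip_iff.1 hz, rfl⟩
  · rintro ⟨z, hz, rfl⟩
    exact ⟨z - P c j, strip_iff.2 (by simpa using hz), by simp⟩

theorem convex_strip (u : Plane) (h : ℝ) : Convex ℝ (strip u h) := by
  intro x hx y hy a b ha hb hab
  have : a • wedge u x + b • wedge u y ∈ Ioo 0 h := convex_Ioo 0 h hx hy ha hb hab
  simp only [strip, mem_ofPred_eq, wedge_add_right, wedge_smul_right]
  exact this

theorem isOpen_strip (u : Plane) (h : ℝ) : IsOpen (strip u h) :=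
  (isOpen_lt continuous_const (continuous_wedge u)).inter
    (isOpen_lt (continuous_wedge u) continuous_const)

theorem convex_openStrip (c : ℝ) (u : Plane) (j : ℤ) : Convex ℝ (openStrip c u j) := by
  intro x hx y hy a b ha hb hab
  have : a • wedge u x + b • wedge u y ∈ Ioo (wedge u (P c j)) (wedge u (P c (j + 1))) :=
    convex_Ioo _ _ hx hy ha hb hab
  simp only [openStrip, mem_ofPred_eq, wedge_add_right, wedge_smul_right]
  exact this

theorem strip_nonempty (d : Direction c u e κ) {h : ℝ} (hh : 0 < h) : (strip u h).Nonempty := by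
  refine ⟨![0, h / 2], ?_, ?_⟩ <;> simp [wedge, d.fst, hh]

/-- Every cylinder in the direction `u` is contained in one of the cylinders of the
decomposition. -/
theorem cylinder_subset (d : Direction c u e κ) (hc : 1 ≤ c) {w h : ℝ} {Φ : Plane → Surface c}
    (hΦ : IsCylinder c u w h Φ) : ∃ j, ∃ hj : e ≤ j, Φ '' strip u h ⊆ {p | d.inCyl hj p} := by
  have hflat : ∀ z ∈ strip u h, Flat (.id ℝ Plane) Φ z := fun z hz =>
    (isChartAt_iff_flat hc).1 (hΦ.chart z hz)
  have hcont : ContinuousOn Φ (strip u h) := fun z hz =>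
    ((hflat z hz).continuousAt hc).continuousWithinAt
  have hin : ∀ z ∈ strip u h, ∃ j, ∃ hj : e ≤ j, d.inCyl hj (Φ z) := by
    intro z hz
    have := d.inCyl_of_line hc (σ := fun t => Φ (z + t • u)) fun t => Flat.line (hflat _ ?_)
    · simpa using this
    · simpa only [strip, mem_ofPred_eq, wedge_add_smul] using hz
  obtain ⟨z₀, hz₀⟩ := d.strip_nonempty hΦ.h_pos
  obtain ⟨j, hj, h₀⟩ := hin z₀ hz₀
  refine ⟨j, hj, ?_⟩
  -- The strip is connected and covered by the preimages of pairwise disjoint open cylinders, so it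
  -- stays in one of them.
  have hO : IsOpen {p | ∃ i, ∃ hi : e ≤ i, i ≠ j ∧ d.inCyl hi p} := by
    have : {p | ∃ i, ∃ hi : e ≤ i, i ≠ j ∧ d.inCyl hi p} =
        ⋃ i, ⋃ hi : e ≤ i, ⋃ _ : i ≠ j, {p | d.inCyl hi p} := by
      ext p; simp
    rw [this]
    exact isOpen_iUnion fun i => isOpen_iUnion fun hi => isOpen_iUnion fun _ => d.isOpen_inCyl hi
  have hsub := (convex_strip u h).isPreconnected.subset_left_of_subset_union
    (hcont.isOpen_inter_preimage (isOpen_strip u h) (d.isOpen_inCyl hj))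
    (hcont.isOpen_inter_preimage (isOpen_strip u h) hO)
    (Set.disjoint_left.2 fun z h1 ⟨_, i, hi, hne, h2⟩ => hne (d.inCyl_unique hi hj h2 h1.2))
    (fun z hz => by
      obtain ⟨i, hi, h1⟩ := hin z hz
      by_cases hij : i = j
      · subst hij; exact Or.inl ⟨hz, h1⟩
      · exact Or.inr ⟨hz, i, hi, hij, h1⟩) ⟨z₀, hz₀, hz₀, h₀⟩
  rintro _ ⟨z, hz, rfl⟩
  exact (hsub hz).2

theorem inCyl_nonempty (d : Direction c u e κ) (hc : 1 ≤ c) {j : ℤ} (hj : e ≤ j) :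
    ∃ p, d.inCyl hj p := by
  obtain ⟨z, hz⟩ := d.strip_nonempty (d.step_pos hj)
  exact ⟨_, d.inCyl_cyl hc hj (strip_iff.1 hz)⟩

theorem isMaximalCylinder_cyl (d : Direction c u e κ) (hc : 1 ≤ c) {j : ℤ} (hj : e ≤ j) :
    IsMaximalCylinder c u (κ * height c u j) (height c u j)
      fun z => cyl c u e κ j (z + P c j) := by
  refine ⟨d.isCylinder_cyl hc hj, fun w' h' Φ' hΦ' hsub => ?_⟩
  obtain ⟨i, hi, hi'⟩ := d.cylinder_subset hc hΦ'
  rw [d.image_cyl hc hj] at hsub ⊢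
  obtain ⟨p, hp⟩ := d.inCyl_nonempty hc hj
  obtain rfl := d.inCyl_unique hi hj (hi' (hsub hp)) hp
  exact hi'.antisymm hsub

theorem image_of_maximal (d : Direction c u e κ) (hc : 1 ≤ c) {w h : ℝ} {Φ : Plane → Surface c}
    (hΦ : IsMaximalCylinder c u w h Φ) :
    ∃ j, ∃ hj : e ≤ j, Φ '' strip u h = {p | d.inCyl hj p} := by
  obtain ⟨j, hj, hsub⟩ := d.cylinder_subset hc hΦ.1
  refine ⟨j, hj, ?_⟩
  have := hΦ.2 _ _ _ (d.isCylinder_cyl hc hj) (by rwa [d.image_cyl hc hj])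
  rw [← this, d.image_cyl hc hj]

theorem mem_maximalCylinders_iff (d : Direction c u e κ) (hc : 1 ≤ c) {C : Set (Surface c)} :
    C ∈ maximalCylinders c u ↔ ∃ j, ∃ hj : e ≤ j, C = {p | d.inCyl hj p} := by
  constructor
  · rintro ⟨w, h, Φ, hΦ, rfl⟩
    exact d.image_of_maximal hc hΦ
  · rintro ⟨j, hj, rfl⟩
    exact ⟨_, _, _, d.isMaximalCylinder_cyl hc hj, (d.image_cyl hc hj).symm⟩

theorem closedStrip_subset_closure (d : Direction c u e κ) {j : ℤ} (hj : e ≤ j) :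
    closedStrip c u j ⊆ closure (openStrip c u j) := by
  intro z hz
  obtain ⟨w, hw⟩ := d.strip_nonempty (d.step_pos hj)
  set y := w + P c j
  have hy : y ∈ openStrip c u j := strip_iff.1 hw
  have hcont : Continuous fun t : ℝ => z + t • (y - z) := by fun_prop
  have ht : Tendsto (fun t : ℝ => z + t • (y - z)) (𝓝[>] 0) (𝓝 z) := by
    simpa using (hcont.tendsto 0).mono_left nhdsWithin_le_nhds
  refine mem_closure_of_tendsto ht ?_
  filter_upwards [Ioc_mem_nhdsGT (one_pos : (0 : ℝ) < 1)] with t ⟨h0, h1⟩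
  simp only [openStrip, mem_ofPred_eq, wedge_add_right, wedge_smul_right, wedge_sub_right]
  constructor <;> nlinarith [hz.1, hz.2, hy.1, hy.2]

theorem hasCylinderDecomposition (d : Direction c u e κ) (hc : 1 ≤ c) :
    HasCylinderDecomposition c u := by
  constructor
  · rintro C hC C' hC' hne
    obtain ⟨i, hi, rfl⟩ := (d.mem_maximalCylinders_iff hc).1 hC
    obtain ⟨j, hj, rfl⟩ := (d.mem_maximalCylinders_iff hc).1 hC'
    refine Set.disjoint_left.2 fun p h1 h2 => hne ?_
    obtain rfl := d.inCyl_unique hi hj h1 h2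
    rfl
  · refine eq_univ_of_forall fun p => ?_
    obtain ⟨j, hj, z, hz, rfl⟩ := d.exists_cyl_eq hc p
    refine mem_iUnion₂.2 ⟨_, (d.mem_maximalCylinders_iff hc).2 ⟨j, hj, rfl⟩, ?_⟩
    have h1 := d.closedStrip_subset_closure hj hz
    have h2 := ((d.continuousOn_cyl hc hj) z hz).mono (openStrip_subset c u j)
    have h3 := h2.mem_closure_image h1
    refine closure_mono ?_ h3
    rintro _ ⟨y, hy, rfl⟩
    exact d.inCyl_cyl hc hj hy

/-- A parametrization of one of the cylinders of the decomposition is, up to a translation, the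
standard one. -/
theorem eq_cyl_of_image (d : Direction c u e κ) (hc : 1 ≤ c) {w h : ℝ} {Φ : Plane → Surface c}
    (hΦ : IsCylinder c u w h Φ) {j : ℤ} (hj : e ≤ j)
    (himg : Φ '' strip u h = {p | d.inCyl hj p}) :
    h = height c u j ∧ w = κ * height c u j ∧ ∃ τ : Plane, wedge u τ = wedge u (P c j) ∧
      ∀ z ∈ strip u h, Φ z = cyl c u e κ j (z + τ) := by
  have hflat : ∀ z ∈ strip u h, Flat (.id ℝ Plane) Φ z := fun z hz =>
    (isChartAt_iff_flat hc).1 (hΦ.chart z hz)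
  have hin : ∀ z ∈ strip u h, d.inCyl hj (Φ z) := fun z hz => by
    have : Φ z ∈ Φ '' strip u h := ⟨z, hz, rfl⟩
    rwa [himg] at this
  obtain ⟨z₀, hz₀⟩ := d.strip_nonempty hΦ.h_pos
  obtain ⟨z₁, hz₁, he₁⟩ := (d.inCyl_iff hc hj).1 (hin z₀ hz₀)
  set τ := z₁ - z₀ with hτ
  have hz₁' : z₀ + τ ∈ openStrip c u j := by rwa [hτ, add_sub_cancel]
  set I := strip u h ∩ {z | z + τ ∈ openStrip c u j} with hI
  have hconv : Convex ℝ I := by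
    refine (convex_strip u h).inter fun x hx y hy a b ha hb hab => ?_
    have := convex_openStrip c u j hx hy ha hb hab
    rw [mem_ofPred_eq]
    convert this using 1
    rw [smul_add, smul_add, add_add_add_comm, ← add_smul, hab, one_smul]
  have hcylτ : ∀ z, z + τ ∈ openStrip c u j →
      Flat (.id ℝ Plane) (fun z => cyl c u e κ j (z + τ)) z := by
    intro z hz
    obtain ⟨k, y, hy, hv⟩ := d.flat_cyl hc hj hz
    exact ⟨k, y, hy, by simpa only [add_right_comm] using hv⟩
  have heq : EqOn Φ (fun z => cyl c u e κ j (z + τ)) I :=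
    Flat.eqOn hc hconv.isPreconnected (fun z hz => hflat z hz.1) (fun z hz => hcylτ z hz.2)
      ⟨hz₀, hz₁'⟩ (by rw [hτ, add_sub_cancel, he₁])
  have hh := d.step_pos hj
  -- If the translated strip of `Φ` stuck out of the strip of `cyl`, the vertex `P_j` or `P_{j+1}`
  -- would correspond to a point of the domain of `Φ`. Near it `Φ` has a chart, while along the
  -- segment to the other vertex `Φ` agrees with `cyl` and runs into a singularity.
  have vertex : ∀ (k k' : ℤ), P c k - τ ∈ strip u h →
      (∀ t ∈ Ioo (0 : ℝ) 1, P c k + t • (P c k' - P c k) ∈ openStrip c u j) → False := by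
    intro k k' hs hop
    obtain ⟨i, y, hy, hv⟩ := hflat _ hs
    have ht : Tendsto (fun t : ℝ => t • (P c k' - P c k)) (𝓝[>] 0) (𝓝 0) := by
      have : Continuous fun t : ℝ => t • (P c k' - P c k) := by fun_prop
      simpa using (this.tendsto 0).mono_left nhdsWithin_le_nhds
    have hmem : ∀ t ∈ Ioo (0 : ℝ) 1, P c k + t • (P c k' - P c k) ∈ Qplus c := fun t ht =>
      convex_combo_mem (convex_Qplus c) ht.1.le ht.2.le (P_mem c k) (P_mem c k')
    have hIoo : ∀ᶠ t in 𝓝[>] (0 : ℝ), t ∈ Ioo 0 1 := Ioo_mem_nhdsGT one_pos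
    refine ray_not_psi hc (j := k) (d := P c k' - P c k) ?_ hy ?_
    · filter_upwards [hIoo] with t ht using hmem t ht
    · filter_upwards [hIoo, ht.eventually hv,
        ht.eventually (eventually_add_mem (isOpen_strip u h) hs)] with t h1 h2 h3
      have e1 : P c k - τ + t • (P c k' - P c k) + τ = P c k + t • (P c k' - P c k) := by abel
      have := heq ⟨h3, by rw [mem_ofPred_eq, e1]; exact hop t h1⟩
      simp only [e1] at this
      rw [← d.cyl_plus_of_mem hc hj (openStrip_subset c u j (hop t h1)) (hmem t h1), ← this, h2]
      rfl
  have hsub : ∀ z ∈ strip u h, z + τ ∈ openStrip c u j := by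
    intro z hz
    have hj1 : wedge u (P c (j + 1)) = wedge u (P c j) + height c u j := by rw [height]; ring
    have a1 := hz₁'.1
    have a2 := hz₁'.2
    rw [wedge_add_right] at a1 a2
    constructor
    · by_contra! hcon
      rw [wedge_add_right] at hcon
      refine vertex j (j + 1) ?_ fun t ht => ?_
      · constructor <;> rw [wedge_sub_right] <;> linarith [hz.1, hz₀.2]
      · constructor <;> rw [wedge_add_right, wedge_smul_right, wedge_sub_right] <;>
          nlinarith [ht.1, ht.2]
    · by_contra! hcon
      rw [wedge_add_right] at hcon
      refine vertex (j + 1) j ?_ fun t ht => ?_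
      · constructor <;> rw [wedge_sub_right] <;> linarith [hz.2, hz₀.1]
      · constructor <;> rw [wedge_add_right, wedge_smul_right, wedge_sub_right] <;>
          nlinarith [ht.1, ht.2]
  have hΦτ : ∀ z ∈ strip u h, Φ z = cyl c u e κ j (z + τ) := fun z hz => heq ⟨hz, hsub z hz⟩
  have hsurj : ∀ y ∈ openStrip c u j, y - τ ∈ strip u h := by
    intro y hy
    have : cyl c u e κ j y ∈ Φ '' strip u h := by rw [himg]; exact d.inCyl_cyl hc hj hy
    obtain ⟨z, hz, hzy⟩ := this
    rw [hΦτ z hz] at hzy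
    obtain ⟨n, hn⟩ := (d.cyl_eq_iff hc hj (hsub z hz) hy).1 hzy
    rw [hn, add_right_comm, add_sub_cancel_right]
    simpa only [strip, mem_ofPred_eq, wedge_add_smul] using hz
  -- comparison of the ranges of `u ∧ z`
  have hval : ∀ s : ℝ, wedge u (![0, s] : Plane) = s := fun s => by simp [wedge, d.fst]
  have hiff : ∀ s : ℝ, s ∈ Ioo 0 h ↔
      s ∈ Ioo (wedge u (P c j) - wedge u τ) (wedge u (P c (j + 1)) - wedge u τ) := by
    intro s
    constructor
    · intro hs
      have := hsub ![0, s] (by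
        simp only [strip, mem_ofPred_eq, hval]
        exact hs)
      simp only [openStrip, mem_ofPred_eq, wedge_add_right, hval] at this
      exact ⟨by linarith [this.1], by linarith [this.2]⟩
    · intro hs
      have := hsurj ![0, s + wedge u τ] (by
        simp only [openStrip, mem_ofPred_eq, hval]
        exact ⟨by linarith [hs.1], by linarith [hs.2]⟩)
      simp only [strip, mem_ofPred_eq, wedge_sub_right, hval] at this
      exact ⟨by linarith [this.1], by linarith [this.2]⟩
  have hIoo := Set.ext hiff
  have hlt : wedge u (P c j) - wedge u τ < wedge u (P c (j + 1)) - wedge u τ := by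
    unfold height at hh; linarith
  have i1 := congrArg sInf hIoo
  have i2 := congrArg sSup hIoo
  rw [csInf_Ioo hΦ.h_pos, csInf_Ioo hlt] at i1
  rw [csSup_Ioo hΦ.h_pos, csSup_Ioo hlt] at i2
  have hhh : h = height c u j := by rw [height]; linarith
  refine ⟨hhh, ?_, τ, by linarith, hΦτ⟩
  -- comparison of the periods
  have hwpos := mul_pos d.pos hh
  have hu : ∀ s t : ℝ, z₀ + s • u = z₀ + t • u → s = t := by
    intro s t hst
    have := congrFun hst 0
    simpa [d.fst] using this
  have hmem (s : ℝ) : z₀ + s • u ∈ strip u h := by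
    simpa only [strip, mem_ofPred_eq, wedge_add_smul] using hz₀
  have key (s : ℝ) : (∃ n : ℤ, s = n * w) ↔ ∃ n : ℤ, s = n * (κ * height c u j) := by
    have h1 := hΦ.eq_iff z₀ hz₀ _ (hmem s)
    rw [hΦτ _ hz₀, hΦτ _ (hmem s), d.cyl_eq_iff hc hj (hsub _ hz₀) (hsub _ (hmem s))] at h1
    constructor
    · rintro ⟨n, rfl⟩
      obtain ⟨m, hm⟩ := h1.2 ⟨n, rfl⟩
      rw [add_right_comm z₀ τ] at hm
      exact ⟨m, hu _ _ (add_right_cancel hm)⟩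
    · rintro ⟨n, rfl⟩
      obtain ⟨m, hm⟩ := h1.1 ⟨n, by abel⟩
      exact ⟨m, hu _ _ hm⟩
  obtain ⟨n, hn⟩ := (key w).1 ⟨1, by simp⟩
  obtain ⟨m, hm⟩ := (key (κ * height c u j)).2 ⟨1, by simp⟩
  have hnpos : 0 < n := by
    have : (0 : ℝ) < n := pos_of_mul_pos_left (hn ▸ hΦ.w_pos) hwpos.le
    exact_mod_cast this
  have hmpos : 0 < m := by
    have : (0 : ℝ) < m := pos_of_mul_pos_left (hm ▸ hwpos) hΦ.w_pos.le
    exact_mod_cast this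
  have h1 : (1 : ℝ) ≤ n := by exact_mod_cast hnpos
  have h2 : (1 : ℝ) ≤ m := by exact_mod_cast hmpos
  nlinarith [hΦ.w_pos]

theorem isRightTwist (d : Direction c u e κ) (hc : 1 ≤ c) : IsRightTwist u (d.twist hc 1) := by
  refine ⟨d.hasCylinderDecomposition hc, fun C hC => ?_, fun w h Φ hΦ z hz => ?_⟩
  · obtain ⟨j, hj, rfl⟩ := (d.mem_maximalCylinders_iff hc).1 hC
    have hmaps : ∀ m : ℤ, ∀ p, d.inCyl hj p → d.inCyl hj (d.twistFun hc m p) := by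
      intro m p hp
      obtain ⟨z, hz, rfl⟩ := (d.inCyl_iff hc hj).1 hp
      rw [d.twistFun_cyl hc m hj (openStrip_subset c u j hz)]
      exact d.inCyl_cyl hc hj (stripShear_mem_openStrip hz)
    ext p
    constructor
    · rintro ⟨q, hq, rfl⟩
      exact hmaps 1 q hq
    · intro hp
      exact ⟨d.twistFun hc (-1) p, hmaps (-1) p hp, d.twistFun_twistFun hc 1 p⟩
  · obtain ⟨j, hj, himg⟩ := d.image_of_maximal hc hΦ
    obtain ⟨rfl, rfl, τ, hτ, heq⟩ := d.eq_cyl_of_image hc hΦ.1 hj himg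
    have hz' : z + τ ∈ openStrip c u j := by
      have := strip_iff.1 hz
      simpa only [openStrip, mem_ofPred_eq, wedge_add_right, hτ] using this
    have hmem : z + (wedge u z / height c u j * (κ * height c u j)) • u ∈ strip u (height c u j) := by
      simpa only [strip, mem_ofPred_eq, wedge_add_smul] using hz
    rw [heq z hz, heq _ hmem]
    show d.twistFun hc 1 _ = _
    rw [d.twistFun_cyl hc 1 hj (openStrip_subset c u j hz')]
    congr 1
    have hh := (d.step_pos hj).ne'
    rw [stripShear, wedge_add_right, hτ, add_sub_cancel_right,
      show wedge u z / height c u j * (κ * height c u j) = κ * wedge u z by field_simp]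
    push_cast
    module

end Direction

/-! ### Saddle connections -/

/-- `σ` is a straight line on `(0, 1)` with the velocity `v` that cannot be extended to a regular
point at either end: a saddle connection with the holonomy `v`. -/
structure IsSaddle (c : ℝ) (v : Plane) (σ : ℝ → Surface c) : Prop where
  ne : v ≠ 0
  flat : ∀ t ∈ Ioo (0 : ℝ) 1, Flat (line v) σ t
  start : ∀ k, ∀ z ∈ W c k, ¬ ∀ᶠ t in 𝓝[>] (0 : ℝ), σ t = psi c k (z + t • v)
  finish : ∀ k, ∀ z ∈ W c k, ¬ ∀ᶠ t in 𝓝[>] (0 : ℝ), σ (1 - t) = psi c k (z + t • (-v))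

theorem IsSaddle.reverse {c : ℝ} {v : Plane} {σ : ℝ → Surface c} (h : IsSaddle c v σ) :
    IsSaddle c (-v) fun t => σ (1 - t) where
  ne := neg_ne_zero.2 h.ne
  flat t ht := flat_reverse (h.flat _ ⟨by linarith [ht.2], by linarith [ht.1]⟩)
  start := h.finish
  finish k z hz := by simpa using h.start k z hz

theorem tendsto_smul_zero (v : Plane) : Tendsto (fun t : ℝ => t • v) (𝓝[>] 0) (𝓝 0) := by
  have : Continuous fun t : ℝ => t • v := by fun_prop
  simpa using (this.tendsto 0).mono_left nhdsWithin_le_nhds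

/-- The definition speaks of charts only and never of the end points, so nothing about the action of
`f` on the singularities is needed. -/
theorem IsSaddle.map {c : ℝ} (hc : 1 ≤ c) {v : Plane} {σ : ℝ → Surface c} (h : IsSaddle c v σ)
    {f : Surface c ≃ₜ Surface c} {A : GL (Fin 2) ℝ} (hf : HasDerivative f A) :
    IsSaddle c ((A : Matrix (Fin 2) (Fin 2) ℝ).mulVec v) fun t => f (σ t) := by
  have hA : ((A⁻¹ : GL (Fin 2) ℝ) : Matrix (Fin 2) (Fin 2) ℝ) * (A : Matrix (Fin 2) (Fin 2) ℝ)
      = 1 := by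
    rw [← Units.val_mul, inv_mul_cancel, Units.val_one]
  have hback : ∀ {k : ℤ} {z : Plane}, z ∈ W c k → ∀ {d : Plane} {τ : ℝ → Surface c},
      (∀ᶠ t in 𝓝[>] (0 : ℝ),
        f (τ t) = psi c k (z + t • (A : Matrix (Fin 2) (Fin 2) ℝ).mulVec d)) →
      ∃ m, ∃ w ∈ W c m, ∀ᶠ t in 𝓝[>] (0 : ℝ), τ t = psi c m (w + t • d) := by
    intro k z hz d τ ht
    obtain ⟨m, w, hw, h'⟩ := hf.inv.eventually_psi hc hz
    refine ⟨m, w, hw, ?_⟩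
    filter_upwards [ht, (tendsto_smul_zero _).eventually h'] with t e1 e2
    rw [← e1, Matrix.mulVec_smul, Matrix.mulVec_mulVec, hA, Matrix.one_mulVec] at e2
    rw [← e2]
    exact (f.symm_apply_apply _).symm
  constructor
  · intro h0
    refine h.ne ?_
    have := congrArg ((A⁻¹ : GL (Fin 2) ℝ) : Matrix (Fin 2) (Fin 2) ℝ).mulVec h0
    rwa [Matrix.mulVec_mulVec, hA, Matrix.one_mulVec, Matrix.mulVec_zero] at this
  · exact fun t ht => hf.flat hc (fun s => by simp [Matrix.mulVec_smul]) (h.flat t ht)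
  · intro k z hz hcon
    obtain ⟨m, w, hw, h'⟩ := hback hz hcon
    exact h.start m w hw h'
  · intro k z hz hcon
    rw [← Matrix.mulVec_neg] at hcon
    obtain ⟨m, w, hw, h'⟩ := hback hz (τ := fun t => σ (1 - t)) hcon
    exact h.finish m w hw h'

theorem IsSaddle.rotate {c : ℝ} (hc : 1 ≤ c) {v : Plane} {σ : ℝ → Surface c}
    (h : IsSaddle c v σ) : IsSaddle c v fun t => rotation c (σ (1 - t)) := by
  have := h.reverse.map hc (rotation_hasDerivative hc)
  simpa [Matrix.neg_mulVec] using this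

theorem mem_interior_of_pos {c : ℝ} (hc : 1 ≤ c) {z : Plane} (h : ∀ m, 0 < lam c m z) :
    z ∈ interior (Qplus c) := by
  rcases mem_Qplus_cases hc ((mem_Qplus_iff hc).2 fun m => (h m).le) with h' | ⟨k, h'⟩ | ⟨k, rfl⟩
  · exact h'
  · exact absurd (fst_of_openSegment hc h').2.2 (h k).ne'
  · exact ((h k).ne (lam_self c k).symm).elim

/-- The invariant quadratic form of the linear part of `T_c`. -/
def form (c : ℝ) (v : Plane) : ℝ := (c + 1) * v 0 ^ 2 - (c - 1) * v 1 ^ 2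

theorem form_edge (c : ℝ) (k : ℤ) : form c (P c (k + 1) - P c k) = 2 := by
  have step (k : ℤ) : form c (P c (k + 1 + 1) - P c (k + 1)) = form c (P c (k + 1) - P c k) := by
    simp only [form, Pi.sub_apply, P_succ_fst c (k + 1), P_succ_snd c (k + 1)]
    simp only [P_succ_fst c k, P_succ_snd c k]
    ring
  induction k using Int.induction_on with
  | zero => simp [form, P_one, P_zero]; ring
  | succ i ih => rw [step, ih]
  | pred i ih => rw [← step, sub_add_cancel, ih]

/-- The edges have `form` equal to 2, while `form c v ≤ 0`, so `v` is steeper than every edge: with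
`(a, b)` the edge vector, `(b v_0)² < (a v_1)²`. The upward ray in the direction `v` thus moves away
from all edges at once. -/
theorem wedge_edge_pos {c : ℝ} (hc : 1 ≤ c) {v : Plane} (hv : 0 < v 1) (h : form c v ≤ 0) (m : ℤ) :
    0 < wedge (P c (m + 1) - P c m) v := by
  have hf := form_edge c m
  have hw := width_pos hc m
  simp only [form, Pi.sub_apply] at hf h
  simp only [wedge, Pi.sub_apply]
  set a := P c (m + 1) 0 - P c m 0
  set b := P c (m + 1) 1 - P c m 1
  by_cases h0 : v 0 = 0
  · rw [h0]; have := mul_pos hw hv; linarith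
  · have hx : 0 < v 0 ^ 2 := by positivity
    have hc1 : 0 < c - 1 := by
      by_contra hcon
      have : c = 1 := by linarith
      subst this
      linarith
    have h2 : (b * v 0) ^ 2 < (a * v 1) ^ 2 := by
      have e1 : (c - 1) * (c + 1) * (a * v 1) ^ 2 =
          ((c + 1) * a ^ 2) * ((c - 1) * v 1 ^ 2) := by ring
      have e2 : (c + 1) * a ^ 2 = 2 + (c - 1) * b ^ 2 := by linarith
      have e3 : (2 + (c - 1) * b ^ 2) * ((c + 1) * v 0 ^ 2) ≤
          (2 + (c - 1) * b ^ 2) * ((c - 1) * v 1 ^ 2) :=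
        mul_le_mul_of_nonneg_left (by linarith) (by positivity)
      have e4 : 0 < (c - 1) * (c + 1) := by positivity
      have e5 : 0 < (c + 1) * v 0 ^ 2 := by positivity
      refine lt_of_mul_lt_mul_left ?_ e4.le
      rw [e1, e2]
      nlinarith
    have := abs_lt_of_sq_lt_sq h2 (mul_pos hw hv).le
    linarith [le_abs_self (b * v 0)]

/-- There are no saddle connections in the directions in which the polygons are unbounded. -/
theorem IsSaddle.form_pos {c : ℝ} (hc : 1 ≤ c) {v : Plane} {σ : ℝ → Surface c}
    (h : IsSaddle c v σ) : 0 < form c v := by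
  have plus : ∀ v σ, IsSaddle c v σ → 0 < v 1 → form c v ≤ 0 → ∀ z ∈ Qplus c,
      σ (1 / 2) = pl c z → False := by
    intro v σ h hv hf z hz hσ
    have hmid : (1 / 2 : ℝ) ∈ Ioo (0 : ℝ) 1 := by norm_num
    obtain ⟨k, w, hw, h'⟩ := h.flat _ hmid
    have e1 := h'.self_of_nhds
    rw [add_zero, map_zero, add_zero, hσ] at e1
    have e2 := eq_of_psi_eq_pl hc hw hz e1.symm
    subst e2
    -- From its midpoint on, the line stays in the interior of `Q_c^+` for ever, so its end at time
    -- 1 would be regular.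
    have hint : ∀ s : ℝ, 0 < s → w + s • v ∈ interior (Qplus c) := by
      intro s hs
      refine mem_interior_of_pos hc fun m => ?_
      rw [lam_add, wedge_smul_right]
      have := lam_nonneg_of_mem hc hz m
      have := mul_pos hs (wedge_edge_pos hc hv hf m)
      linarith
    have hW : ∀ t ∈ Ico (1 / 2 : ℝ) 1, w + (-(1 / 2 : ℝ)) • v + t • v ∈ W c k := by
      intro t ht
      rcases ht.1.eq_or_lt with rfl | ht'
      · rw [add_assoc, ← add_smul, neg_add_cancel, zero_smul, add_zero]; exact hw
      · rw [add_assoc, ← add_smul]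
        exact interior_subset_W c k (hint _ (by linarith))
    have heq : EqOn σ (fun t => psi c k (w + (-(1 / 2 : ℝ)) • v + t • v)) (Ico (1 / 2) 1) :=
      Flat.eqOn hc isPreconnected_Ico
        (fun t ht => h.flat t ⟨by linarith [ht.1], ht.2⟩) (fun t ht => flat_line_psi (hW t ht))
        (left_mem_Ico.2 (by norm_num)) (by
          rw [add_assoc, ← add_smul, neg_add_cancel, zero_smul, add_zero, hσ, e1])
    refine h.finish k (w + (1 / 2 : ℝ) • v) (interior_subset_W c k (hint _ (by norm_num))) ?_
    filter_upwards [Ioc_mem_nhdsGT (show (0 : ℝ) < 1 / 2 by norm_num)] with t ht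
    rw [heq (show 1 - t ∈ Ico (1 / 2 : ℝ) 1 from ⟨by linarith [ht.2], by linarith [ht.1]⟩)]
    simp only []
    congr 1
    module
  have pos : ∀ v σ, IsSaddle c v σ → 0 < v 1 → form c v ≤ 0 → False := by
    intro v σ h hv hf
    rcases surface_cases (σ (1 / 2)) with ⟨z, hz, e⟩ | ⟨z, hz, e⟩
    · exact plus v σ h hv hf z hz e
    · refine plus v _ (h.rotate hc) hv hf z hz ?_
      rw [show (1 : ℝ) - 1 / 2 = 1 / 2 by norm_num, e, rotation_mi (neg_mem_Qminus.2 hz), neg_neg]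
  by_contra! hf
  rcases lt_trichotomy (v 1) 0 with h1 | h1 | h1
  · exact pos (-v) _ h.reverse (by simpa using h1) (by simpa [form] using hf)
  · refine h.ne ?_
    have : v 0 ^ 2 ≤ 0 := by
      simp only [form, h1] at hf
      nlinarith [sq_nonneg (v 0)]
    have h0 : v 0 = 0 := by nlinarith [sq_nonneg (v 0)]
    ext i; fin_cases i
    · exact h0
    · exact h1
  · exact pos v σ h h1 hf

/-! ### Vertical strips -/

/-- The half-strip of `Q_c^+` above an edge and the half-strip of `Q_c^-` below it form a strip that
is infinite both ways and closed, with only the two ends of the edge removed. Saddle connections are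
measured by the strips they cross. -/
theorem mem_W_of_strip {c : ℝ} (hc : 1 ≤ c) {k : ℤ} {z : Plane} (h0 : P c k 0 ≤ z 0)
    (h1 : z 0 ≤ P c (k + 1) 0) (hk : z ≠ P c k) (hk' : z ≠ P c (k + 1)) : z ∈ W c k := by
  have key : ∀ z : Plane, z 0 = P c k 0 → z ≠ P c k → z ∈ W c k := by
    intro z hz hne
    rcases lt_trichotomy (z 1) (P c k 1) with h | h | h
    · refine Or.inr (interior_above_vertex hc (k := k + 1) ?_ ?_)
      · simp [edgeShift, hz]
      · simp [edgeShift]; linarith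
    · exact absurd (by ext i; fin_cases i <;> assumption) hne
    · exact interior_subset_W c k (interior_above_vertex hc hz h)
  rcases h0.eq_or_lt with h0 | h0
  · exact key z h0.symm hk
  · rcases h1.eq_or_lt with h1 | h1
    · rw [← shift_sub_mem_W]
      refine key _ (by simp [edgeShift, h1]) fun h => hk' ?_
      rw [edgeShift, sub_eq_iff_eq_add] at h
      exact (add_left_cancel h).symm
    · exact Or.inl (Or.inr ⟨h0, h1⟩)

theorem exists_strip' {c : ℝ} (hc : 1 ≤ c) (x : ℝ) : ∃ k : ℤ, P c k 0 < x ∧ x ≤ P c (k + 1) 0 := by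
  obtain ⟨k, h0, h1⟩ := exists_strip hc x
  rcases h0.eq_or_lt with h | h
  · exact ⟨k - 1, by linarith [one_le_fst_sub hc (show k - 1 < k by omega)],
      by rw [sub_add_cancel]; exact h.ge⟩
  · exact ⟨k, h, h1.le⟩

/-- Every regular point lies in a vertical strip that is closed on the left. -/
theorem exists_psi_left {c : ℝ} (hc : 1 ≤ c) {m : ℤ} {w : Plane} (hw : w ∈ W c m) :
    ∃ k, ∃ z ∈ W c k, psi c m w = psi c k z ∧ P c k 0 ≤ z 0 ∧ z 0 < P c (k + 1) 0 := by
  rcases surface_cases (psi c m w) with ⟨y, hy, h⟩ | ⟨y, hy, h⟩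
  · have hv := Direction.not_vertex hc hw hy h
    obtain ⟨k, h0, h1⟩ := exists_strip hc (y 0)
    exact ⟨k, y, mem_W_of_strip hc h0 h1.le (hv _) (hv _),
      by rw [h, psi_of_nonneg (lam_nonneg_of_mem hc hy k)], h0, h1⟩
  · have h' : psi c m (edgeShift c m - w) = pl c y := by
      rw [← rotation_psi hc hw, h, rotation_mi (neg_mem_Qminus.2 hy), neg_neg]
    have hv := Direction.not_vertex hc (shift_sub_mem_W.2 hw) hy h'
    obtain ⟨k, h0, h1⟩ := exists_strip' hc (y 0)
    have hW := mem_W_of_strip hc h0.le h1 (hv _) (hv _)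
    refine ⟨k, edgeShift c k - y, shift_sub_mem_W.2 hW, ?_, ?_, ?_⟩
    · rw [← rotation_psi hc hW, psi_of_nonneg (lam_nonneg_of_mem hc hy k), rotation_pl hy, h]
    · simp [edgeShift]; linarith
    · simp [edgeShift]; linarith

/-- Every regular point lies in a vertical strip that is closed on the right. -/
theorem exists_psi_right {c : ℝ} (hc : 1 ≤ c) {m : ℤ} {w : Plane} (hw : w ∈ W c m) :
    ∃ k, ∃ z ∈ W c k, psi c m w = psi c k z ∧ P c k 0 < z 0 ∧ z 0 ≤ P c (k + 1) 0 := by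
  obtain ⟨k, z, hz, h, h0, h1⟩ := exists_psi_left hc (shift_sub_mem_W.2 hw)
  refine ⟨k, edgeShift c k - z, shift_sub_mem_W.2 hz, ?_, ?_, ?_⟩
  · rw [← rotation_psi hc hz, ← h, rotation_psi hc (shift_sub_mem_W.2 hw), sub_sub_cancel]
  · simp [edgeShift]; linarith
  · simp [edgeShift]; linarith

theorem same_strip {c : ℝ} (hc : 1 ≤ c) {k m : ℤ} {a b : Plane} (ha : P c k 0 < a 0)
    (ha' : a 0 < P c (k + 1) 0) (hb : P c m 0 < b 0) (hb' : b 0 < P c (m + 1) 0)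
    (h : psi c k a = psi c m b) : k = m ∧ a = b := by
  rcases psi_eq_psi hc (Or.inl (Or.inr ⟨ha, ha'⟩)) (Or.inl (Or.inr ⟨hb, hb'⟩)) h with
    ⟨_, rfl⟩ | ⟨_, h⟩
  · exact ⟨(index_unique hc ha ha' hb.le hb'.le).symm, rfl⟩
  · have e := congrFun h 0
    simp only [edgeShift, Pi.sub_apply, Pi.add_apply] at e
    have : m = k := index_unique hc (k := k) (x := P c k 0 + P c (k + 1) 0 - a 0) (by linarith)
      (by linarith) (by linarith) (by linarith)
    subst this
    exact ⟨rfl, sub_left_injective h⟩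

theorem Flat.eq_psi {c : ℝ} {E : Type*} [NormedAddCommGroup E] [NormedSpace ℝ E]
    {L : E →L[ℝ] Plane} {σ : E → Surface c} {x : E} (h : Flat L σ x) :
    ∃ k, ∃ z ∈ W c k, σ x = psi c k z := by
  obtain ⟨k, z, hz, h⟩ := h
  exact ⟨k, z, hz, by simpa using h.self_of_nhds⟩

/-- A saddle connection that moves to the right crosses the rest of the vertical strip. -/
theorem IsSaddle.forward {c : ℝ} (hc : 1 ≤ c) {v : Plane} {σ : ℝ → Surface c}
    (h : IsSaddle c v σ) (hv : 0 < v 0) {t₀ : ℝ} (ht₀ : t₀ ∈ Ioo (0 : ℝ) 1) {k : ℤ} {z : Plane}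
    (hz : z ∈ W c k) (hσ : σ t₀ = psi c k z) (h0 : P c k 0 ≤ z 0) (h1 : z 0 < P c (k + 1) 0) :
    P c (k + 1) 0 - z 0 ≤ (1 - t₀) * v 0 ∧
    (∀ t, t₀ ≤ t → (t - t₀) * v 0 < P c (k + 1) 0 - z 0 → σ t = psi c k (z + (t - t₀) • v)) ∧
    (P c (k + 1) 0 - z 0 = (1 - t₀) * v 0 → z + (1 - t₀) • v = P c (k + 1)) := by
  have hline (t : ℝ) : z + (-t₀) • v + t • v = z + (t - t₀) • v := by module
  have hW : ∀ t, t₀ ≤ t → (t - t₀) * v 0 < P c (k + 1) 0 - z 0 →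
      z + (-t₀) • v + t • v ∈ W c k := by
    intro t ht ht'
    rw [hline]
    rcases ht.eq_or_lt with rfl | ht
    · simpa using hz
    · have := mul_pos (sub_pos.2 ht) hv
      refine Or.inl (Or.inr ⟨?_, ?_⟩) <;> simp <;> linarith
  have hfin : ∀ s ≤ (1 : ℝ), t₀ < s → (s - t₀) * v 0 ≤ P c (k + 1) 0 - z 0 →
      EqOn σ (fun t => psi c k (z + (-t₀) • v + t • v)) (Ico t₀ s) := by
    intro s hs hs' hle
    have hlt : ∀ t ∈ Ico t₀ s, (t - t₀) * v 0 < P c (k + 1) 0 - z 0 := fun t ht => by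
      have := mul_lt_mul_of_pos_right (sub_lt_sub_right ht.2 t₀) hv
      linarith
    refine Flat.eqOn hc isPreconnected_Ico (fun t ht => h.flat t ⟨?_, ?_⟩)
      (fun t ht => flat_line_psi (hW t ht.1 (hlt t ht))) (left_mem_Ico.2 hs') ?_
    · linarith [ht₀.1, ht.1]
    · linarith [ht.2]
    · rw [hline, sub_self, zero_smul, add_zero, hσ]
  -- A saddle connection that stops inside the strip can stop only at a removed point; otherwise it
  -- would extend in the chart of the strip.
  have hend : (1 - t₀) * v 0 ≤ P c (k + 1) 0 - z 0 → z + (1 - t₀) • v ∉ W c k := by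
    intro hle hmem
    have heq := hfin 1 le_rfl ht₀.2 hle
    refine h.finish k _ hmem ?_
    filter_upwards [Ioc_mem_nhdsGT (sub_pos.2 ht₀.2)] with t ht
    rw [heq (show 1 - t ∈ Ico t₀ 1 from ⟨by linarith [ht.2], by linarith [ht.1]⟩)]
    simp only []
    congr 1
    module
  have h2 : P c (k + 1) 0 - z 0 ≤ (1 - t₀) * v 0 := by
    by_contra! hlt
    refine hend hlt.le ?_
    rw [← hline]
    exact hW 1 ht₀.2.le hlt
  refine ⟨h2, fun t ht ht' => ?_, fun heq => ?_⟩
  · have ht1 : t < 1 := by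
      have : (t - t₀) * v 0 < (1 - t₀) * v 0 := by linarith
      linarith [lt_of_mul_lt_mul_right this hv.le]
    rcases ht.eq_or_lt with rfl | ht
    · simpa using hσ
    · set s := t₀ + (P c (k + 1) 0 - z 0) / v 0 with hs
      have e1 : (s - t₀) * v 0 = P c (k + 1) 0 - z 0 := by rw [hs]; field_simp; ring
      have e2 : s ≤ 1 := by
        have : (s - t₀) * v 0 ≤ (1 - t₀) * v 0 := by linarith
        linarith [le_of_mul_le_mul_right this hv]
      have e3 : t < s := by
        have : (t - t₀) * v 0 < (s - t₀) * v 0 := by linarith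
        linarith [lt_of_mul_lt_mul_right this hv.le]
      have := hfin s e2 (ht.trans e3) e1.le ⟨ht.le, e3⟩
      simp only [] at this
      rw [this, hline]
  · by_contra hne
    refine hend heq.ge (mem_W_of_strip hc ?_ ?_ ?_ hne)
    · have := mul_pos (sub_pos.2 ht₀.2) hv
      simp; linarith
    · simp; linarith
    · intro hk
      have := congrFun hk 0
      have h3 := width_pos hc k
      simp at this
      linarith

theorem IsSaddle.backward {c : ℝ} (hc : 1 ≤ c) {v : Plane} {σ : ℝ → Surface c}
    (h : IsSaddle c v σ) (hv : 0 < v 0) {t₀ : ℝ} (ht₀ : t₀ ∈ Ioo (0 : ℝ) 1) {k : ℤ} {z : Plane}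
    (hz : z ∈ W c k) (hσ : σ t₀ = psi c k z) (h0 : P c k 0 < z 0) (h1 : z 0 ≤ P c (k + 1) 0) :
    z 0 - P c k 0 ≤ t₀ * v 0 ∧ (z 0 - P c k 0 = t₀ * v 0 → z = P c k + t₀ • v) := by
  have e : (edgeShift c k - z) 0 = P c k 0 + P c (k + 1) 0 - z 0 := rfl
  obtain ⟨a1, -, a3⟩ := (h.rotate hc).forward hc hv (t₀ := 1 - t₀)
    ⟨by linarith [ht₀.2], by linarith [ht₀.1]⟩ (shift_sub_mem_W.2 hz)
    (by simp only [sub_sub_cancel]; rw [hσ, rotation_psi hc hz])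
    (by rw [e]; linarith) (by rw [e]; linarith)
  rw [e, sub_sub_cancel] at a1 a3
  refine ⟨by linarith, fun heq => ?_⟩
  have := a3 (by linarith)
  rw [edgeShift] at this
  have h2 : P c k + t₀ • v - z = 0 := by
    have h3 : P c k + t₀ • v - z = (P c k + P c (k + 1) - z + t₀ • v) - P c (k + 1) := by abel
    rw [h3, this, sub_self]
  exact (sub_eq_zero.1 h2).symm

/-- A saddle connection that moves to the right starts at a vertex. -/
theorem IsSaddle.exists_start {c : ℝ} (hc : 1 ≤ c) {v : Plane} {σ : ℝ → Surface c}
    (h : IsSaddle c v σ) (hv : 0 < v 0) : ∃ k, ∃ t₀ ∈ Ioo (0 : ℝ) 1,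
      t₀ * v 0 < P c (k + 1) 0 - P c k 0 ∧ P c (k + 1) 0 - P c k 0 ≤ v 0 ∧
      (∀ t, t₀ ≤ t → t * v 0 < P c (k + 1) 0 - P c k 0 → σ t = psi c k (P c k + t • v)) ∧
      (P c (k + 1) 0 - P c k 0 = v 0 → P c k + v = P c (k + 1)) := by
  -- This makes `t₀ * v 0 < 1`, so the initial piece up to `t₀` is narrower than every strip.
  set t₀ := 1 / (2 * (1 + v 0)) with ht
  have hpos : 0 < t₀ := by positivity
  have hlt : t₀ * v 0 < 1 := by
    rw [ht, div_mul_eq_mul_div, div_lt_one (by positivity)]; linarith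
  have hlt1 : t₀ < 1 := by
    rw [ht, div_lt_one (by positivity)]; linarith
  have hmem : t₀ ∈ Ioo (0 : ℝ) 1 := ⟨hpos, hlt1⟩
  obtain ⟨m, w, hw, hσm⟩ := (h.flat t₀ hmem).eq_psi
  obtain ⟨k, z, hz, hkz, h0, h1⟩ := exists_psi_right hc hw
  have hσ := hσm.trans hkz
  obtain ⟨b1, b2⟩ := h.backward hc hv hmem hz hσ h0 h1
  have hwid := one_le_width hc k
  have h1' : z 0 < P c (k + 1) 0 := by linarith
  -- Followed forward from time `s`, the line does not leave its strip before `t₀`, so both times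
  -- belong to the same strip and its left boundary is at least `(t₀ - s) * v 0` behind. Letting `s`
  -- tend to 0 puts the start on that boundary, hence at a vertex.
  have key : ∀ s ∈ Ioo 0 t₀, (t₀ - s) * v 0 ≤ z 0 - P c k 0 := by
    intro s hs
    have hs1 : s ∈ Ioo (0 : ℝ) 1 := ⟨hs.1, hs.2.trans hlt1⟩
    obtain ⟨m', w', hw', hσm'⟩ := (h.flat s hs1).eq_psi
    obtain ⟨k', y, hy, hky, y0, y1⟩ := exists_psi_left hc hw'
    have hσ' := hσm'.trans hky
    have hb : y 0 - P c k' 0 ≤ s * v 0 := by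
      rcases y0.eq_or_lt with y0 | y0
      · have := mul_pos hs.1 hv
        linarith
      · exact (h.backward hc hv hs1 hy hσ' y0 y1.le).1
    obtain ⟨-, a2, -⟩ := h.forward hc hv hs1 hy hσ' y0 y1
    have hwid' := one_le_width hc k'
    have e1 : (t₀ - s) * v 0 < P c (k' + 1) 0 - y 0 := by linarith
    have e2 := mul_pos (sub_pos.2 hs.2) hv
    have e3 := a2 t₀ hs.2.le e1
    rw [hσ] at e3
    obtain ⟨rfl, e4⟩ := same_strip hc h0 h1' (b := y + (t₀ - s) • v) (by simp; linarith)
      (by simp; linarith) e3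
    rw [e4]
    simp; linarith
  have heq : z 0 - P c k 0 = t₀ * v 0 := by
    refine le_antisymm b1 (le_of_forall_pos_lt_add fun ε hε => ?_)
    set s := min (t₀ / 2) (ε / (2 * v 0)) with hs
    have s1 : 0 < s := by positivity
    have s2 : s < t₀ := (min_le_left _ _).trans_lt (by linarith)
    have s3 : s * v 0 < ε := by
      have : s * v 0 ≤ ε / (2 * v 0) * v 0 := mul_le_mul_of_nonneg_right (min_le_right _ _) hv.le
      have e : ε / (2 * v 0) * v 0 = ε / 2 := by field_simp
      linarith
    have := key s ⟨s1, s2⟩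
    linarith
  have hzP := b2 heq
  obtain ⟨a1, a2, a3⟩ := h.forward hc hv hmem hz hσ h0.le h1'
  have hl (t : ℝ) : z + (t - t₀) • v = P c k + t • v := by rw [hzP]; module
  refine ⟨k, t₀, hmem, by linarith, by linarith, fun t ht ht' => ?_, fun hw => ?_⟩
  · rw [a2 t ht (by linarith), hl]
  · have := a3 (by linarith)
    rwa [hl, one_smul] at this

theorem IsSaddle.fst_ne_zero {c : ℝ} (hc : 1 ≤ c) {v : Plane} {σ : ℝ → Surface c}
    (h : IsSaddle c v σ) : v 0 ≠ 0 := by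
  intro h0
  have := h.form_pos hc
  simp only [form, h0] at this
  nlinarith [sq_nonneg (v 1)]

theorem IsSaddle.one_le_abs_fst {c : ℝ} (hc : 1 ≤ c) {v : Plane} {σ : ℝ → Surface c}
    (h : IsSaddle c v σ) : 1 ≤ |v 0| := by
  have pos : ∀ v σ, IsSaddle c v σ → 0 < v 0 → 1 ≤ v 0 := by
    intro v σ h hv
    obtain ⟨k, -, -, -, h1, -⟩ := h.exists_start hc hv
    linarith [one_le_width hc k]
  rcases lt_or_gt_of_ne (h.fst_ne_zero hc) with h0 | h0
  · rw [abs_of_neg h0]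
    simpa using pos _ _ h.reverse (by simpa using h0)
  · rw [abs_of_pos h0]
    exact pos v σ h h0

theorem one_le_edge_snd {c : ℝ} (hc : 1 ≤ c) {k : ℤ} (hk : 0 ≤ k) :
    1 + 2 * P c k 0 ≤ P c (k + 1) 1 - P c k 1 := by
  obtain ⟨h0, h1⟩ := P_nonneg hc hk
  rw [P_succ_snd]; nlinarith

theorem edge_snd_neg {c : ℝ} (hc : 1 ≤ c) {k : ℤ} (hk : k < 0) :
    P c (k + 1) 1 - P c k 1 < 0 := by
  have := one_le_edge_snd hc (k := -(k + 1)) (by omega)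
  have h0 := (P_nonneg hc (k := -(k + 1)) (by omega)).1
  rw [show -(k + 1) + 1 = -k by ring, P_neg_snd, P_neg_snd] at this
  linarith

/-- Horizontal saddle connections cross at least two vertical strips. -/
theorem IsSaddle.two_le_abs_fst {c : ℝ} (hc : 1 ≤ c) {v : Plane} {σ : ℝ → Surface c}
    (h : IsSaddle c v σ) (h1 : v 1 = 0) : 2 ≤ |v 0| := by
  have pos : ∀ v σ, IsSaddle c v σ → v 1 = 0 → 0 < v 0 → 2 ≤ v 0 := by
    intro v σ h h1 hv
    obtain ⟨k, t₀, ht₀, a0, a1, a2, a3⟩ := h.exists_start hc hv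
    by_contra! hlt
    -- If the first strip is the whole width, the vector is that of an edge, and no edge is
    -- horizontal. Otherwise `t₁` is the time of leaving the first strip; less than 1 remains, too
    -- little to cross a whole second strip from its left boundary.
    rcases a1.eq_or_lt with a1 | a1
    · have := congrFun (a3 a1) 1
      simp only [Pi.add_apply, h1, add_zero] at this
      rcases le_or_gt 0 k with hk | hk
      · linarith [one_le_edge_snd hc hk, (P_nonneg hc hk).1]
      · linarith [edge_snd_neg hc hk]
    · set t₁ := (P c (k + 1) 0 - P c k 0) / v 0 with ht₁
      have e1 : t₁ * v 0 = P c (k + 1) 0 - P c k 0 := by rw [ht₁]; field_simp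
      have e2 : t₁ < 1 := by rw [ht₁, div_lt_one hv]; exact a1
      have e3 : t₀ < t₁ := by
        rw [ht₁, lt_div_iff₀ hv]; exact a0
      have hm : t₁ ∈ Ioo (0 : ℝ) 1 := ⟨ht₀.1.trans e3, e2⟩
      obtain ⟨m, w, hw, hσm⟩ := (h.flat t₁ hm).eq_psi
      obtain ⟨k', z, hz, hkz, z0, z1⟩ := exists_psi_left hc hw
      have hσ := hσm.trans hkz
      obtain ⟨f1, -, -⟩ := h.forward hc hv hm hz hσ z0 z1
      have w1 := one_le_width hc k
      have w2 := one_le_width hc k'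
      have z0' : P c k' 0 < z 0 := by linarith
      have hz' : z + (-t₁) • v + t₁ • v = z := by module
      have hfl := flat_line_psi (c := c) (k := k') (z := z + (-t₁) • v) (v := v) (t := t₁)
        (by rwa [hz'])
      have hev := ((h.flat t₁ hm).dichotomy hc hfl).resolve_right fun h' =>
        h'.self_of_nhds (by rw [hz', hσ])
      have hstrip : ∀ᶠ t in 𝓝 t₁, P c k' 0 < (z + (-t₁) • v + t • v) 0 ∧
          (z + (-t₁) • v + t • v) 0 < P c (k' + 1) 0 := by
        have hcont : Continuous fun t : ℝ => (z + (-t₁) • v + t • v) 0 := by fun_prop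
        exact (hcont.tendsto t₁).eventually (Ioo_mem_nhds (by rw [hz']; exact z0')
          (by rw [hz']; exact z1))
      have hleft : ∀ᶠ t in 𝓝[<] t₁, t ∈ Ioo t₀ t₁ := Ioo_mem_nhdsLT e3
      -- The point at `t₁` is strictly inside its strip, so just before `t₁` the line is in that
      -- same strip and in strip `k`. Hence they coincide, although the line has just reached the
      -- right boundary of strip `k`.
      obtain ⟨t, ht, g1, g2, g3⟩ := (hleft.and
        ((hev.filter_mono nhdsWithin_le_nhds).and (hstrip.filter_mono nhdsWithin_le_nhds))).exists
      have g4 : t * v 0 < t₁ * v 0 := mul_lt_mul_of_pos_right ht.2 hv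
      have g5 := a2 t ht.1.le (by linarith)
      have g6 : 0 < t * v 0 := mul_pos (ht₀.1.trans ht.1) hv
      rw [g1] at g5
      obtain ⟨rfl, g7⟩ := same_strip hc g2 g3 (b := P c k + t • v) (by simpa using g6)
        (by simp; linarith) g5
      have g8 := congrFun g7 0
      simp at g8
      linarith
  rcases lt_or_gt_of_ne (h.fst_ne_zero hc) with h0 | h0
  · rw [abs_of_neg h0]
    simpa using pos _ _ h.reverse (by simpa using h1) (by simpa using h0)
  · rw [abs_of_pos h0]
    exact pos v σ h h1 h0

/-! ### Examples of saddle connections -/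

theorem isSaddle_of_segment {c : ℝ} (hc : 1 ≤ c) {i j : ℤ} (hij : i ≠ j)
    (h : ∀ t ∈ Ioo (0 : ℝ) 1, P c i + t • (P c j - P c i) ∈ W c 0) :
    IsSaddle c (P c j - P c i) fun t => psi c 0 (P c i + t • (P c j - P c i)) := by
  have hIoo : ∀ᶠ t in 𝓝[>] (0 : ℝ), t ∈ Ioo 0 1 := Ioo_mem_nhdsGT one_pos
  have hQ : ∀ t ∈ Ioo (0 : ℝ) 1, P c i + t • (P c j - P c i) ∈ Qplus c := fun t ht =>
    convex_combo_mem (convex_Qplus c) ht.1.le ht.2.le (P_mem c i) (P_mem c j)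
  have hrev (t : ℝ) : P c i + (1 - t) • (P c j - P c i) = P c j + t • (-(P c j - P c i)) := by
    module
  refine ⟨sub_ne_zero.2 ((P_injective hc).ne hij.symm), fun t ht => flat_line_psi (h t ht), ?_, ?_⟩
  · intro k z hz hcon
    refine ray_not_psi hc (j := i) (d := P c j - P c i) ?_ hz ?_
    · filter_upwards [hIoo] with t ht using hQ t ht
    · filter_upwards [hIoo, hcon] with t ht e
      rw [← Direction.psi_zero hc (hQ t ht), e]
  · intro k z hz hcon
    refine ray_not_psi hc (j := j) (d := -(P c j - P c i)) ?_ hz ?_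
    · filter_upwards [hIoo] with t ht
      rw [← hrev]
      exact hQ _ ⟨by linarith [ht.2], by linarith [ht.1]⟩
    · filter_upwards [hIoo, hcon] with t ht e
      rw [← e, hrev, ← Direction.psi_zero hc]
      rw [← hrev]
      exact hQ _ ⟨by linarith [ht.2], by linarith [ht.1]⟩

theorem isSaddle_edge {c : ℝ} (hc : 1 ≤ c) :
    IsSaddle c ![1, 1] fun t => psi c 0 (t • ![1, 1]) := by
  have := isSaddle_of_segment hc (show (0 : ℤ) ≠ 1 by norm_num) fun t ht => by
    refine Or.inl (Or.inr ?_)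
    simp [P_zero, P_one, ht.1, ht.2]
  simpa only [P_zero, P_one, zero_add, sub_zero] using this

theorem isSaddle_diagonal {c : ℝ} (hc : 1 ≤ c) : ∃ σ, IsSaddle c ![2, 0] σ := by
  have := isSaddle_of_segment hc (show (-1 : ℤ) ≠ 1 by norm_num) fun t ht => by
    refine interior_subset_W c 0 ((horizontal hc).diag_interior hc (j := 1) (by norm_num)
      (convex_combo_mem (convex_Qplus c) ht.1.le ht.2.le (P_mem c _) (P_mem c _)) ?_ ?_)
    · simp [wedge, P_one, P_neg_one]
    · intro k hk
      have e0 := congrFun hk 0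
      have e1 := congrFun hk 1
      simp [P_one, P_neg_one] at e0 e1
      have h0 : P c (-1) 0 < P c k 0 := by rw [P_neg_one]; simp; linarith [ht.1]
      have h1 : P c k 0 < P c 1 0 := by rw [P_one]; simp; linarith [ht.2]
      have a0 := (fst_strictMono hc).lt_iff_lt.1 h0
      have a1 := (fst_strictMono hc).lt_iff_lt.1 h1
      obtain rfl : k = 0 := by omega
      simp [P_zero] at e1
  have h2 : P c 1 - P c (-1) = ![2, 0] := by
    ext i; fin_cases i <;> norm_num [P_one, P_neg_one]
  rw [h2] at this
  exact ⟨_, this⟩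

/-! ### Translation automorphisms are trivial -/

theorem exists_mem_interior_strip {c : ℝ} (hc : 1 ≤ c) (k : ℤ) :
    ∃ z ∈ interior (Qplus c), P c k 0 < z 0 ∧ z 0 < P c (k + 1) 0 := by
  have w := width_pos hc k
  set z : Plane := ![(P c k 0 + P c (k + 1) 0) / 2, (P c k 1 + P c (k + 1) 1) / 2 + 1] with hz
  have h0 : P c k 0 < z 0 := by simp [hz]; linarith
  have h1 : z 0 < P c (k + 1) 0 := by simp [hz]; linarith
  refine ⟨z, interior_of_strip hc h0 h1 ?_, h0, h1⟩
  have : lam c k z = P c (k + 1) 0 - P c k 0 := by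
    rw [lam_eq]; simp [hz]; ring
  rwa [this]

theorem isPreconnected_W {c : ℝ} (hc : 1 ≤ c) (k : ℤ) : IsPreconnected (W c k) := by
  have hint := (convex_Qplus c).interior
  have hstrip : Convex ℝ {z : Plane | P c k 0 < z 0 ∧ z 0 < P c (k + 1) 0} :=
    (convex_halfSpace_gt (LinearMap.proj (R := ℝ) (φ := fun _ : Fin 2 => ℝ) 0).isLinear _).inter
      (convex_halfSpace_lt (LinearMap.proj (R := ℝ) (φ := fun _ : Fin 2 => ℝ) 0).isLinear _)
  have himage : {z | edgeShift c k - z ∈ interior (Qplus c)} =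
      (fun z => edgeShift c k - z) '' interior (Qplus c) := by
    ext z
    exact ⟨fun h => ⟨_, h, sub_sub_cancel _ _⟩, by rintro ⟨w, hw, rfl⟩; simpa using hw⟩
  obtain ⟨z, hz, hs⟩ := exists_mem_interior_strip hc k
  refine IsPreconnected.union (edgeShift c k - z) (Or.inr (shift_sub_fst hs)) (by simpa using hz)
    (IsPreconnected.union z hz hs hint.isPreconnected hstrip.isPreconnected) ?_
  rw [himage]
  exact hint.isPreconnected.image _ (by fun_prop)

/-- A point of the surface that is not a vertex lies in the image of a chart. -/
theorem point_cases {c : ℝ} (hc : 1 ≤ c) (p : Surface c) :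
    (∃ k, ∃ z ∈ W c k, p = psi c k z) ∨ ∃ j, p = pl c (P c j) := by
  rcases surface_cases p with ⟨z, hz, rfl⟩ | ⟨z, hz, rfl⟩
  · rcases mem_Qplus_cases hc hz with h | ⟨k, h⟩ | ⟨k, rfl⟩
    · exact Or.inl ⟨0, z, interior_subset_W c 0 h, (Direction.psi_zero hc hz).symm⟩
    · refine Or.inl ⟨k, z, edge_subset_W hc k h, (psi_of_nonneg ?_).symm⟩
      exact lam_nonneg_of_mem hc hz k
    · exact Or.inr ⟨k, rfl⟩
  · have hneg (k : ℤ) : mi c (-z) = mi c ((edgeShift c k - z) - edgeShift c k) := by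
      congr 1; abel
    have hl (k : ℤ) : lam c k (edgeShift c k - z) ≤ 0 := by
      rw [lam_shift_sub]; linarith [lam_nonneg_of_mem hc hz k]
    rcases mem_Qplus_cases hc hz with h | ⟨k, h⟩ | ⟨k, rfl⟩
    · have hW := shift_sub_mem_W.2 (interior_subset_W c 0 h)
      exact Or.inl ⟨0, _, hW, by rw [psi_of_nonpos hc hW (hl 0), hneg 0]⟩
    · have hW := shift_sub_mem_W.2 (edge_subset_W hc k h)
      exact Or.inl ⟨k, _, hW, by rw [psi_of_nonpos hc hW (hl k), hneg k]⟩
    · refine Or.inr ⟨k - 1, ?_⟩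
      rw [pl_eq_mi (k := k - 1) (left_mem_segment ℝ _ _)]
      congr 1
      simp [edgeShift]

theorem psi_ne_vertex {c : ℝ} (hc : 1 ≤ c) {k j : ℤ} {z : Plane} (hz : z ∈ W c k) :
    psi c k z ≠ pl c (P c j) := fun h =>
  Direction.not_vertex hc hz (P_mem c j) h j rfl

theorem isClosed_vertices {c : ℝ} (hc : 1 ≤ c) (s : Set ℤ) : IsClosed (P c '' s) := by
  refine Metric.isClosed_of_pairwise_le_dist one_pos ?_
  rintro _ ⟨i, -, rfl⟩ _ ⟨j, -, rfl⟩ hij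
  refine le_trans ?_ (dist_le_pi_dist (P c i) (P c j) 0)
  rw [Real.dist_eq]
  rcases lt_trichotomy i j with h | rfl | h
  · rw [abs_sub_comm]; exact (one_le_fst_sub hc h).trans (le_abs_self _)
  · exact absurd rfl hij
  · exact (one_le_fst_sub hc h).trans (le_abs_self _)

theorem isClosed_of_pieces {c : ℝ} {F : Set (Surface c)} {A B : Set Plane} (hA : IsClosed A)
    (hB : IsClosed B) (h1 : ∀ z ∈ Qplus c, pl c z ∈ F ↔ z ∈ A)
    (h2 : ∀ z ∈ Qplus c, mi c (-z) ∈ F ↔ z ∈ B) : IsClosed F := by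
  have hq : IsQuotientMap (Quot.mk (Glue c) : _ → Surface c) := isQuotientMap_quot_mk
  refine hq.isClosed_preimage.1 (isClosed_sum_iff.2 ?_)
  constructor
  · convert hA.preimage (continuous_subtype_val (p := (· ∈ Qplus c))) using 1
    ext ⟨z, hz⟩
    have := h1 z hz
    rwa [pl_of_mem hz] at this
  · convert (hB.preimage continuous_neg).preimage
      (continuous_subtype_val (p := (· ∈ Qminus c))) using 1
    ext ⟨z, hz⟩
    have := h2 (-z) (mem_Qminus.1 hz)
    rwa [neg_neg, mi_of_mem hz] at this

theorem pl_eq_vertex {c : ℝ} (hc : 1 ≤ c) {j : ℤ} {z : Plane} (hz : z ∈ Qplus c)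
    (h : pl c z = pl c (P c j)) : ∃ k, z = P c k := by
  rcases mem_Qplus_cases hc hz with h' | ⟨k, h'⟩ | h'
  · rw [← Direction.psi_zero hc hz] at h
    exact absurd h (psi_ne_vertex hc (interior_subset_W c 0 h'))
  · rw [← psi_of_nonneg (lam_nonneg_of_mem hc hz k)] at h
    exact absurd h (psi_ne_vertex hc (edge_subset_W hc k h'))
  · exact h'

theorem mi_eq_vertex {c : ℝ} (hc : 1 ≤ c) {j : ℤ} {z : Plane} (hz : z ∈ Qplus c)
    (h : mi c (-z) = pl c (P c j)) : ∃ k, z = P c k := by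
  have e := congrArg (rotation c) h
  have e' : mi c (-P c j) = pl c (P c (j - 1)) := by
    rw [pl_eq_mi (k := j - 1) (left_mem_segment ℝ _ _)]
    congr 1
    simp [edgeShift]
  rw [rotation_mi (neg_mem_Qminus.2 hz), neg_neg, rotation_pl (P_mem c j), e'] at e
  exact pl_eq_vertex hc hz e

/-- The half of an edge that starts at a vertex, as a subset of the surface, is closed. -/
theorem isClosed_half_edge {c : ℝ} (hc : 1 ≤ c) (j : ℤ) :
    IsClosed (pl c '' ((fun t : ℝ => P c j + t • (P c (j + 1) - P c j)) '' Icc 0 (1 / 2))) := by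
  set e : ℝ → Plane := fun t => P c j + t • (P c (j + 1) - P c j) with he
  have hcomp : IsCompact (e '' Icc 0 (1 / 2)) := isCompact_Icc.image (by fun_prop)
  have hopen : ∀ t ∈ Ioc (0 : ℝ) (1 / 2), e t ∈ W c j := fun t ht => by
    have w := width_pos hc j
    refine Or.inl (Or.inr ⟨?_, ?_⟩) <;> simp [he] <;> nlinarith [ht.1, ht.2]
  have hmem : ∀ t ∈ Icc (0 : ℝ) (1 / 2), e t ∈ Qplus c := fun t ht =>
    convex_combo_mem (convex_Qplus c) ht.1 (by linarith [ht.2]) (P_mem c j) (P_mem c (j + 1))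
  have hpsi : ∀ t ∈ Icc (0 : ℝ) (1 / 2), psi c j (e t) = pl c (e t) := fun t ht =>
    psi_of_nonneg (lam_nonneg_of_mem hc (hmem t ht) j)
  have h0 : e 0 = P c j := by simp [he]
  -- The preimage in each polygon is the half edge or its half-turned copy, together with every
  -- vertex identified with `P_j`; those vertices are at mutual distance at least 1.
  refine isClosed_of_pieces
    ((isClosed_vertices hc {k | pl c (P c k) = pl c (P c j)}).union hcomp.isClosed)
    ((isClosed_vertices hc {k | mi c (-P c k) = pl c (P c j)}).union
      (hcomp.image (f := fun z => edgeShift c j - z) (by fun_prop)).isClosed) ?_ ?_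
  · intro z hz
    constructor
    · rintro ⟨_, ⟨t, ht, rfl⟩, h⟩
      rcases ht.1.eq_or_lt with rfl | h1
      · rw [h0] at h
        obtain ⟨k, rfl⟩ := pl_eq_vertex hc hz h.symm
        exact Or.inl ⟨k, h.symm, rfl⟩
      · rw [← hpsi t ht] at h
        exact Or.inr ⟨t, ht, eq_of_psi_eq_pl hc (hopen t ⟨h1, ht.2⟩) hz h⟩
    · rintro (⟨k, hk, rfl⟩ | h)
      · exact ⟨P c j, ⟨0, ⟨le_rfl, by norm_num⟩, h0⟩, hk.symm⟩
      · exact ⟨z, h, rfl⟩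
  · intro z hz
    constructor
    · rintro ⟨_, ⟨t, ht, rfl⟩, h⟩
      rcases ht.1.eq_or_lt with rfl | h1
      · rw [h0] at h
        obtain ⟨k, rfl⟩ := mi_eq_vertex hc hz h.symm
        exact Or.inl ⟨k, h.symm, rfl⟩
      · rw [← hpsi t ht] at h
        have := eq_of_psi_eq_mi hc (hopen t ⟨h1, ht.2⟩) (neg_mem_Qminus.2 hz) h
        refine Or.inr ⟨_, ⟨t, ht, rfl⟩, ?_⟩
        simp only
        rw [← neg_sub, this, neg_neg]
    · rintro (⟨k, hk, rfl⟩ | ⟨_, ⟨t, ht, rfl⟩, rfl⟩)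
      · exact ⟨P c j, ⟨0, ⟨le_rfl, by norm_num⟩, h0⟩, hk.symm⟩
      · refine ⟨e t, ⟨t, ht, rfl⟩, ?_⟩
        rw [pl_eq_mi (k := j), neg_sub]
        rw [segment_eq_image']
        exact ⟨t, ⟨ht.1, by linarith [ht.2]⟩, rfl⟩

/-- Only the vertices remain, and continuity is used in place of charts. `f` fixes a half edge at
`P_j` except perhaps its end; the image of that half edge is closed, so it contains the vertex, and
only the end itself can be mapped there. -/
theorem eq_one_of_fix_charts {c : ℝ} (hc : 1 ≤ c) {f : Surface c ≃ₜ Surface c}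
    (h : ∀ k, ∀ z ∈ W c k, f (psi c k z) = psi c k z) : f = 1 := by
  ext p
  show f p = p
  rcases point_cases hc p with ⟨k, z, hz, rfl⟩ | ⟨j, rfl⟩
  · exact h k z hz
  set e : ℝ → Plane := fun t => P c j + t • (P c (j + 1) - P c j) with he
  have h0 : e 0 = P c j := by simp [he]
  set F := pl c '' (e '' Icc 0 (1 / 2)) with hF
  have hmem : ∀ t ∈ Icc (0 : ℝ) (1 / 2), e t ∈ Qplus c := fun t ht =>
    convex_combo_mem (convex_Qplus c) ht.1 (by linarith [ht.2]) (P_mem c j) (P_mem c (j + 1))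
  have hopen : ∀ t ∈ Ioc (0 : ℝ) (1 / 2), e t ∈ W c j := fun t ht => by
    have w := width_pos hc j
    refine Or.inl (Or.inr ⟨?_, ?_⟩) <;> simp [he] <;> nlinarith [ht.1, ht.2]
  have hfix : ∀ t ∈ Ioc (0 : ℝ) (1 / 2), f (pl c (e t)) = pl c (e t) := fun t ht => by
    rw [← psi_of_nonneg (lam_nonneg_of_mem hc (hmem t ⟨ht.1.le, ht.2⟩) j)]
    exact h j _ (hopen t ht)
  have hcl : IsClosed (f '' F) := (Homeomorph.isClosedMap f) _ (isClosed_half_edge hc j)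
  have hev : Ioc (0 : ℝ) (1 / 2) ∈ 𝓝[>] (0 : ℝ) := Ioc_mem_nhdsGT (by norm_num)
  have htend : Tendsto (fun t => pl c (e t)) (𝓝[>] 0) (𝓝 (pl c (P c j))) := by
    have h1 : Tendsto e (𝓝[>] 0) (𝓝[Qplus c] (P c j)) := by
      refine tendsto_nhdsWithin_iff.2 ⟨?_, ?_⟩
      · have : Continuous e := by fun_prop
        simpa [h0] using (this.tendsto 0).mono_left nhdsWithin_le_nhds
      · filter_upwards [hev] with t ht using hmem t ⟨ht.1.le, ht.2⟩
    exact (continuousOn_pl c _ (P_mem c j)).tendsto.comp h1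
  obtain ⟨_, ⟨_, ⟨t, ht, rfl⟩, rfl⟩, hx⟩ : pl c (P c j) ∈ f '' F := by
    refine hcl.mem_of_tendsto htend ?_
    filter_upwards [hev] with t ht
    exact ⟨pl c (e t), ⟨e t, ⟨t, ⟨ht.1.le, ht.2⟩, rfl⟩, rfl⟩, hfix t ht⟩
  rcases ht.1.eq_or_lt with rfl | h1
  · rwa [h0] at hx
  · rw [hfix t ⟨h1, ht.2⟩, ← psi_of_nonneg (lam_nonneg_of_mem hc (hmem t ht) j)] at hx
    exact absurd hx (psi_ne_vertex hc (hopen t ⟨h1, ht.2⟩))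

theorem HasDerivative.eqOn_W {c : ℝ} (hc : 1 ≤ c) {f : Surface c ≃ₜ Surface c}
    (hf : HasDerivative f 1) {k : ℤ} {z : Plane} (hz : z ∈ W c k)
    (h : f (psi c k z) = psi c k z) : ∀ w ∈ W c k, f (psi c k w) = psi c k w := by
  have hflat : ∀ w ∈ W c k, Flat (.id ℝ Plane) (psi c k) w := fun w hw =>
    (isChartAt_iff_flat hc).1 (isChartAt_psi hc hw)
  exact Flat.eqOn hc (isPreconnected_W hc k)
    (fun w hw => hf.flat hc (L' := .id ℝ Plane) (by simp) (hflat w hw)) hflat hz h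

/-- The image of the edge of index 0 is a saddle connection with vector `(1, 1)`. As every strip has
width at least 1, it has the vector of the edge under its first strip; edges with `k < 0` descend
and those with `k > 0` rise by at least 3. So points of the edge of index 0 are fixed, and the fixed
set spreads from chart to chart through the interior of `Q_c^+`. -/
theorem HasDerivative.eq_one {c : ℝ} (hc : 1 ≤ c) {f : Surface c ≃ₜ Surface c}
    (hf : HasDerivative f 1) : f = 1 := by
  have hs := (isSaddle_edge hc).map hc hf
  simp only [Units.val_one, Matrix.one_mulVec] at hs
  obtain ⟨k, t, ht, h1, h2, h3, h4⟩ := hs.exists_start hc (by simp)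
  have hw : P c (k + 1) 0 - P c k 0 = 1 := le_antisymm (by simpa using h2) (one_le_width hc k)
  have hy : P c (k + 1) 1 - P c k 1 = 1 := by
    rw [← h4 (by simpa using hw)]; simp
  have hk : 0 ≤ k := by
    by_contra hk
    linarith [edge_snd_neg hc (not_le.1 hk)]
  obtain rfl : k = 0 := by
    by_contra hk'
    have := one_le_fst_sub hc (lt_of_le_of_ne hk (Ne.symm hk'))
    rw [P_zero] at this
    simp only [Pi.zero_apply, sub_zero] at this
    linarith [one_le_edge_snd hc hk]
  have hfix := h3 t le_rfl h1
  simp only [P_zero, zero_add] at hfix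
  have hmem : t • ![1, 1] ∈ W c 0 := by
    refine Or.inl (Or.inr ?_)
    simp [P_zero, P_one, ht.1, ht.2]
  have hW := hf.eqOn_W hc hmem hfix
  obtain ⟨z, hz, -⟩ := exists_mem_interior_strip hc 0
  have hpsi (m : ℤ) : psi c m z = psi c 0 z := by
    rw [psi_of_nonneg (lam_pos_of_interior hc hz m).le, psi_of_nonneg (lam_pos_of_interior hc hz 0).le]
  refine eq_one_of_fix_charts hc fun m => hf.eqOn_W hc (interior_subset_W c m hz) ?_
  rw [hpsi, hW z (interior_subset_W c 0 hz)]

/-! ### The Veech group -/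

theorem mulVec_fst (M : Matrix (Fin 2) (Fin 2) ℝ) (v : Plane) :
    M.mulVec v 0 = M 0 0 * v 0 + M 0 1 * v 1 := by
  simp [Matrix.mulVec, dotProduct]

theorem mulVec_snd (M : Matrix (Fin 2) (Fin 2) ℝ) (v : Plane) :
    M.mulVec v 1 = M 1 0 * v 0 + M 1 1 * v 1 := by
  simp [Matrix.mulVec, dotProduct]

theorem shearGL_zero (u : Plane) : shearGL u 0 = 1 := by
  ext i j; fin_cases i <;> fin_cases j <;> simp [shearGL]

theorem shearGL_add (u : Plane) (a b : ℝ) : shearGL u (a + b) = shearGL u a * shearGL u b := by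
  ext i j; fin_cases i <;> fin_cases j <;> simp [shearGL, Matrix.mul_apply] <;> ring

theorem shearGL_zpow (u : Plane) (a : ℝ) (n : ℤ) : shearGL u a ^ n = shearGL u (n * a) := by
  induction n with
  | zero => simp [shearGL_zero]
  | succ n ih => rw [zpow_add_one, ih, ← shearGL_add]; congr 1; push_cast; ring
  | pred n ih => rw [zpow_sub_one, ih, shearGL_inv, ← shearGL_add]; congr 1; push_cast; ring

/-- The vectors of the saddle connections of the surface. -/
def holonomy (c : ℝ) : Set Plane := {v | ∃ σ, IsSaddle c v σ}

theorem holonomy_map {c : ℝ} (hc : 1 ≤ c) {A : GL (Fin 2) ℝ} (hA : A ∈ VeechGroup c) {v : Plane}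
    (hv : v ∈ holonomy c) : (A : Matrix (Fin 2) (Fin 2) ℝ).mulVec v ∈ holonomy c := by
  obtain ⟨f, hf⟩ := hA
  obtain ⟨σ, hσ⟩ := hv
  exact ⟨_, hσ.map hc hf⟩

/-- The subgroup of the Veech group generated by the derivatives of the rotation, the reflection and
the two twists. -/
def generated (c : ℝ) : Subgroup (GL (Fin 2) ℝ) :=
  Subgroup.closure {-1, reflGL, shearGL ![1, 0] 2, shearGL ![1, 1] (c + 1)}

theorem neg_one_mem_generated (c : ℝ) : -1 ∈ generated c := Subgroup.subset_closure (by simp)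

theorem reflGL_mem_generated (c : ℝ) : reflGL ∈ generated c := Subgroup.subset_closure (by simp)

theorem shear_horizontal_mem (c : ℝ) (n : ℤ) : shearGL ![1, 0] (n * 2) ∈ generated c := by
  rw [← shearGL_zpow]
  exact zpow_mem (Subgroup.subset_closure (by simp)) n

theorem shear_diagonal_mem (c : ℝ) (n : ℤ) : shearGL ![1, 1] (n * (c + 1)) ∈ generated c := by
  rw [← shearGL_zpow]
  exact zpow_mem (Subgroup.subset_closure (by simp)) n

theorem generated_le {c : ℝ} (hc : 1 ≤ c) : generated c ≤ VeechGroup c := by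
  refine (Subgroup.closure_le _).2 ?_
  rintro A (rfl | rfl | rfl | rfl)
  · exact ⟨_, rotation_hasDerivative hc⟩
  · exact ⟨_, reflection_hasDerivative hc⟩
  · exact ⟨_, by simpa using (horizontal hc).twist_hasDerivative hc 1⟩
  · exact ⟨_, by simpa using (diagonal hc).twist_hasDerivative hc 1⟩

theorem shear_horizontal_mulVec (a : ℝ) (v : Plane) :
    (shearGL ![1, 0] a : Matrix (Fin 2) (Fin 2) ℝ).mulVec v = ![v 0 + a * v 1, v 1] := by
  rw [shearGL_mulVec]
  ext i; fin_cases i <;> simp [wedge]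

theorem shear_diagonal_mulVec (a : ℝ) (v : Plane) :
    (shearGL ![1, 1] a : Matrix (Fin 2) (Fin 2) ℝ).mulVec v =
      ![v 0 + a * (v 1 - v 0), v 1 + a * (v 1 - v 0)] := by
  rw [shearGL_mulVec]
  ext i; fin_cases i <;> simp [wedge]

theorem neg_one_mulVec (v : Plane) :
    ((-1 : GL (Fin 2) ℝ) : Matrix (Fin 2) (Fin 2) ℝ).mulVec v = -v := by
  rw [Units.val_neg, Units.val_one, Matrix.neg_mulVec, Matrix.one_mulVec]

theorem exists_abs_add_mul_le (x : ℝ) {y : ℝ} (hy : y ≠ 0) : ∃ n : ℤ, |x + n * y| ≤ |y| / 2 := by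
  refine ⟨-round (x / y), ?_⟩
  have h := abs_sub_round (x / y)
  have e : x + ((-round (x / y) : ℤ) : ℝ) * y = (x / y - round (x / y)) * y := by
    push_cast; field_simp; ring
  rw [e, abs_mul]
  nlinarith [abs_pos.2 hy]

/-! ### Descent for the vectors of saddle connections -/

section holonomy

variable {c : ℝ} {v : Plane}

theorem one_le_abs_fst (hc : 1 ≤ c) (hv : v ∈ holonomy c) : 1 ≤ |v 0| :=
  hv.choose_spec.one_le_abs_fst hc

/-- Horizontal shears change the abscissa by multiples of twice the ordinate, so some image has
abscissa at most `|v 1|` in absolute value, and that abscissa is still at least 1. -/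
theorem one_le_abs_snd (hc : 1 ≤ c) (hv : v ∈ holonomy c) (h : v 1 ≠ 0) : 1 ≤ |v 1| := by
  obtain ⟨n, hn⟩ := exists_abs_add_mul_le (v 0) (mul_ne_zero two_ne_zero h)
  have := one_le_abs_fst hc (holonomy_map hc (generated_le hc (shear_horizontal_mem c n)) hv)
  rw [shear_horizontal_mulVec] at this
  simp only [Matrix.cons_val_zero] at this
  rw [abs_mul, abs_two, ← mul_assoc] at hn
  linarith

/-- The same argument with the shears of slope 1, which change the abscissa by multiples of `(c + 1)
(v 1 - v 0)`. -/
theorem two_le_abs_sub (hc : 1 ≤ c) (hv : v ∈ holonomy c) (h : v 1 ≠ v 0) :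
    2 ≤ (c + 1) * |v 1 - v 0| := by
  have hc' : 0 < c + 1 := by linarith
  obtain ⟨n, hn⟩ := exists_abs_add_mul_le (v 0) (mul_ne_zero hc'.ne' (sub_ne_zero.2 h))
  have := one_le_abs_fst hc (holonomy_map hc (generated_le hc (shear_diagonal_mem c n)) hv)
  rw [shear_diagonal_mulVec] at this
  simp only [Matrix.cons_val_zero] at this
  rw [abs_mul, abs_of_pos hc', ← mul_assoc] at hn
  linarith

/-- Both elements used are linear involutions that fix `(1, 1)`. Below the diagonal, `(x, y) ↦ (2y -
x, y)` shortens the abscissa; above it, `(x, y) ↦ (c x - (c-1) y, (c+1) x - c y)` shortens the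
ordinate without increasing the abscissa. The gain is bounded below by the estimates for `|y|` and
`|y - x|`. -/
theorem fst_pos_descent (hc : 1 ≤ c) (hv : v ∈ holonomy c) (h0 : 0 < v 0) (h1 : 0 < v 1)
    (hne : v 1 ≠ v 0) : ∃ g ∈ generated c,
      |(g : Matrix (Fin 2) (Fin 2) ℝ).mulVec v 0| + |(g : Matrix (Fin 2) (Fin 2) ℝ).mulVec v 1| ≤
        |v 0| + |v 1| - 2 / (c + 1) := by
  have hc' : 0 < c + 1 := by linarith
  have x1 := one_le_abs_fst hc hv
  have y1 := one_le_abs_snd hc hv h1.ne'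
  have hd := two_le_abs_sub hc hv hne
  have hδ : 2 / (c + 1) ≤ 1 := by rw [div_le_one hc']; linarith
  rw [abs_of_pos h0] at x1 ⊢
  rw [abs_of_pos h1] at y1 ⊢
  have hD : shearGL ![1, 0] 2 * reflGL ∈ generated c := by
    refine mul_mem ?_ (reflGL_mem_generated c)
    simpa using shear_horizontal_mem c 1
  have eD : ((shearGL ![1, 0] 2 * reflGL : GL (Fin 2) ℝ) : Matrix (Fin 2) (Fin 2) ℝ).mulVec v =
      ![-v 0 + 2 * v 1, v 1] := by
    rw [Units.val_mul, ← Matrix.mulVec_mulVec, reflGL_mulVec, shear_horizontal_mulVec]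
    simp [refl]
  rcases lt_or_gt_of_ne hne with h | h
  · refine ⟨_, hD, ?_⟩
    rw [eD]
    simp only [Matrix.cons_val_zero, Matrix.cons_val_one]
    rw [abs_of_neg (by linarith)] at hd
    have h2 : 2 / (c + 1) ≤ v 0 - v 1 := by rw [div_le_iff₀ hc']; linarith
    rw [abs_of_pos h1]
    rcases abs_cases (-v 0 + 2 * v 1) with ⟨e, -⟩ | ⟨e, -⟩ <;> rw [e] <;> linarith
  · have hE : shearGL ![1, 1] (c + 1) * (shearGL ![1, 0] 2 * reflGL) ∈ generated c := by
      refine mul_mem ?_ hD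
      simpa using shear_diagonal_mem c 1
    refine ⟨_, hE, ?_⟩
    rw [Units.val_mul, ← Matrix.mulVec_mulVec, eD, shear_diagonal_mulVec]
    simp only [Matrix.cons_val_zero, Matrix.cons_val_one]
    rw [abs_of_pos (by linarith)] at hd
    have hform := hv.choose_spec.form_pos hc
    simp only [form] at hform
    -- Positivity of `form` bounds the slope of `v`: after multiplication by `c - 1` it gives `((c -
    -- 1) y)² ≤ (c² - 1) x²`, which is less than `(c x)²`.
    have hpos : 0 < c * v 0 - (c - 1) * v 1 := by
      by_contra hcon
      have h3 : c * v 0 ≤ (c - 1) * v 1 := by linarith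
      have h4 : (c * v 0) * (c * v 0) ≤ ((c - 1) * v 1) * ((c - 1) * v 1) :=
        mul_self_le_mul_self (by positivity) h3
      have h5 := mul_nonneg (sub_nonneg.2 hc) hform.le
      nlinarith [mul_pos h0 h0]
    have h6 := mul_nonneg (sub_nonneg.2 hc) (sub_nonneg.2 h.le)
    have e0 : -v 0 + 2 * v 1 + (c + 1) * (v 1 - (-v 0 + 2 * v 1)) = c * v 0 - (c - 1) * v 1 := by
      ring
    have e1 : v 1 + (c + 1) * (v 1 - (-v 0 + 2 * v 1)) = (c + 1) * v 0 - c * v 1 := by ring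
    rw [e0, e1, abs_of_pos hpos]
    rcases abs_cases ((c + 1) * v 0 - c * v 1) with ⟨e, -⟩ | ⟨e, -⟩ <;> rw [e] <;> nlinarith

theorem exists_generated_pos (c : ℝ) (v : Plane) : ∃ g ∈ generated c,
    (g : Matrix (Fin 2) (Fin 2) ℝ).mulVec v = ![|v 0|, |v 1|] := by
  have h1 := neg_one_mem_generated c
  have h2 := reflGL_mem_generated c
  rcases abs_cases (v 0) with ⟨e0, -⟩ | ⟨e0, -⟩ <;> rcases abs_cases (v 1) with ⟨e1, -⟩ | ⟨e1, -⟩ <;>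
    rw [e0, e1]
  · exact ⟨1, one_mem _, by ext i; fin_cases i <;> simp⟩
  · refine ⟨-1 * reflGL, mul_mem h1 h2, ?_⟩
    rw [Units.val_mul, ← Matrix.mulVec_mulVec, reflGL_mulVec, neg_one_mulVec]
    ext i; fin_cases i <;> simp [refl]
  · refine ⟨reflGL, h2, ?_⟩
    rw [reflGL_mulVec]
    ext i; fin_cases i <;> simp [refl]
  · refine ⟨-1, h1, ?_⟩
    rw [neg_one_mulVec]
    ext i; fin_cases i <;> simp

/-- Each step of the descent gains at least the fixed amount `2 / (c + 1)`, so finitely many steps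
suffice; the signs are made positive before each step. -/
theorem exists_reduction (hc : 1 ≤ c) (hv : v ∈ holonomy c) : ∃ g ∈ generated c,
    (g : Matrix (Fin 2) (Fin 2) ℝ).mulVec v 1 = 0 ∨
      (g : Matrix (Fin 2) (Fin 2) ℝ).mulVec v 1 = (g : Matrix (Fin 2) (Fin 2) ℝ).mulVec v 0 := by
  have hδ : 0 < 2 / (c + 1) := div_pos two_pos (by linarith)
  have key : ∀ n : ℕ, ∀ v ∈ holonomy c, |v 0| + |v 1| ≤ n * (2 / (c + 1)) → ∃ g ∈ generated c,
      (g : Matrix (Fin 2) (Fin 2) ℝ).mulVec v 1 = 0 ∨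
      (g : Matrix (Fin 2) (Fin 2) ℝ).mulVec v 1 = (g : Matrix (Fin 2) (Fin 2) ℝ).mulVec v 0 := by
    intro n
    induction n with
    | zero =>
      intro v hv h
      have := one_le_abs_fst hc hv
      have := abs_nonneg (v 1)
      simp at h
      linarith
    | succ n ih =>
      intro v hv h
      obtain ⟨g, hg, e⟩ := exists_generated_pos c v
      have hw := holonomy_map hc (generated_le hc hg) hv
      rw [e] at hw
      rcases eq_or_ne (v 1) 0 with h1 | h1
      · exact ⟨g, hg, Or.inl (by rw [e]; simp [h1])⟩
      rcases eq_or_ne |v 1| |v 0| with h2 | h2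
      · exact ⟨g, hg, Or.inr (by rw [e]; simp [h2])⟩
      have x1 := one_le_abs_fst hc hv
      obtain ⟨g', hg', hle⟩ := fst_pos_descent hc hw (by simp; intro h; simp [h] at x1; linarith)
        (by simpa using h1) (by simpa using h2)
      obtain ⟨g'', hg'', h3⟩ := ih _ (holonomy_map hc (generated_le hc hg') hw) (by
        refine hle.trans ?_
        push_cast at h
        simp only [Matrix.cons_val_zero, Matrix.cons_val_one, abs_abs]
        linarith)
      refine ⟨g'' * (g' * g), mul_mem hg'' (mul_mem hg' hg), ?_⟩
      rw [Units.val_mul, Units.val_mul, ← Matrix.mulVec_mulVec, ← Matrix.mulVec_mulVec, e]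
      exact h3
  obtain ⟨n, hn⟩ := exists_nat_ge ((|v 0| + |v 1|) / (2 / (c + 1)))
  exact key n v hv ((div_le_iff₀ hδ).1 hn)

end holonomy

theorem one_one_mem_holonomy {c : ℝ} (hc : 1 ≤ c) : ![1, 1] ∈ holonomy c := ⟨_, isSaddle_edge hc⟩

theorem two_zero_mem_holonomy {c : ℝ} (hc : 1 ≤ c) : ![2, 0] ∈ holonomy c := isSaddle_diagonal hc

theorem GL_mul_inv (A : GL (Fin 2) ℝ) : (A : Matrix (Fin 2) (Fin 2) ℝ) *
    ((A⁻¹ : GL (Fin 2) ℝ) : Matrix (Fin 2) (Fin 2) ℝ) = 1 := by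
  rw [← Units.val_mul, mul_inv_cancel, Units.val_one]

theorem GL_inv_mul (A : GL (Fin 2) ℝ) : ((A⁻¹ : GL (Fin 2) ℝ) : Matrix (Fin 2) (Fin 2) ℝ) *
    (A : Matrix (Fin 2) (Fin 2) ℝ) = 1 := by
  rw [← Units.val_mul, inv_mul_cancel, Units.val_one]

/-! ### Elements of the Veech group modulo the generated subgroup -/

section Veech

variable {c : ℝ} {A : GL (Fin 2) ℝ}

theorem abs_diag_of_horizontal (hc : 1 ≤ c) (hA : A ∈ VeechGroup c) (h : A 1 0 = 0) :
    1 ≤ |A 0 0| ∧ 1 ≤ |A 1 1| := by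
  constructor
  · obtain ⟨σ, hσ⟩ := holonomy_map hc hA (two_zero_mem_holonomy hc)
    have := hσ.two_le_abs_fst hc (by simp [mulVec_snd, h])
    rw [mulVec_fst] at this
    simp [abs_mul] at this
    linarith
  · have := one_le_abs_snd hc (holonomy_map hc hA (one_one_mem_holonomy hc))
    simp only [mulVec_snd, h] at this
    simp at this
    refine this fun h1 => ?_
    have e := congrFun (congrFun (GL_mul_inv A) 1) 1
    simp [Matrix.mul_apply, h, h1] at e

/-- The bounds on the diagonal entries hold for `A` and its inverse, whose diagonal entries are
reciprocal, so they are `±1`. The image of `(1, 1)`, sheared to have abscissa of absolute value at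
most 1, must attain 1; by parity the off-diagonal entry is then an even multiple of `A 1 1`. -/
theorem mem_generated_of_horizontal (hc : 1 ≤ c) (hA : A ∈ VeechGroup c) (h : A 1 0 = 0) :
    A ∈ generated c := by
  obtain ⟨ha, hd⟩ := abs_diag_of_horizontal hc hA h
  have e10 := congrFun (congrFun (GL_inv_mul A) 1) 0
  have e00 := congrFun (congrFun (GL_inv_mul A) 0) 0
  have e11 := congrFun (congrFun (GL_mul_inv A) 1) 1
  simp only [Matrix.mul_apply, Fin.sum_univ_two, h, mul_zero, add_zero, zero_mul, zero_add,
    Matrix.one_apply_eq] at e10 e00 e11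
  have ha0 : A 0 0 ≠ 0 := by rintro h; norm_num [h] at ha
  have h' : A⁻¹ 1 0 = 0 := by
    have e : A⁻¹ 1 0 * A 0 0 = 0 := by simpa using e10
    exact (mul_eq_zero.1 e).resolve_right ha0
  obtain ⟨ha', hd'⟩ := abs_diag_of_horizontal hc (inv_mem hA) h'
  have f00 : |A⁻¹ 0 0| * |A 0 0| = 1 := by rw [← abs_mul, e00, abs_one]
  have f11 : |A 1 1| * |A⁻¹ 1 1| = 1 := by rw [← abs_mul, e11, abs_one]
  have ga : |A 0 0| = 1 := le_antisymm (by nlinarith) ha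
  have gd : |A 1 1| = 1 := le_antisymm (by nlinarith) hd
  have hd0 : A 1 1 ≠ 0 := by rintro h; norm_num [h] at gd
  obtain ⟨n, hn⟩ := exists_abs_add_mul_le (A 0 0 + A 0 1) (mul_ne_zero two_ne_zero hd0)
  have h3 := one_le_abs_fst hc (holonomy_map hc (generated_le hc (shear_horizontal_mem c n))
    (holonomy_map hc hA (one_one_mem_holonomy hc)))
  rw [shear_horizontal_mulVec] at h3
  simp only [mulVec_fst, mulVec_snd, Matrix.cons_val_zero, Matrix.cons_val_one, mul_one, h,
    zero_add] at h3
  rw [abs_mul, abs_two, gd, ← mul_assoc] at hn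
  have h4 : |A 0 0 + A 0 1 + n * 2 * A 1 1| = 1 := le_antisymm (by linarith) h3
  -- The eight sign choices: `A 0 0` and the sheared abscissa are both `±1`, so their difference is
  -- 0 or `±2`.
  obtain ⟨m, hm⟩ : ∃ m : ℤ, A 0 1 = m * 2 * A 1 1 := by
    rcases eq_or_eq_neg_of_abs_eq ga with a1 | a1 <;>
      rcases eq_or_eq_neg_of_abs_eq gd with d1 | d1 <;>
      rcases eq_or_eq_neg_of_abs_eq h4 with b1 | b1 <;> rw [a1, d1] at b1 <;> rw [d1]
    · exact ⟨-n, by push_cast; linarith⟩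
    · exact ⟨-n - 1, by push_cast; linarith⟩
    · exact ⟨-n, by push_cast; linarith⟩
    · exact ⟨-n + 1, by push_cast; linarith⟩
    · exact ⟨-n + 1, by push_cast; linarith⟩
    · exact ⟨-n, by push_cast; linarith⟩
    · exact ⟨-n - 1, by push_cast; linarith⟩
    · exact ⟨-n, by push_cast; linarith⟩
  obtain ⟨R, hR, r00, r01, r10, r11⟩ : ∃ R ∈ generated c,
      R 0 0 = A 0 0 ∧ R 0 1 = 0 ∧ R 1 0 = 0 ∧ R 1 1 = A 1 1 := by
    have h1 := neg_one_mem_generated c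
    have h2 := reflGL_mem_generated c
    rcases eq_or_eq_neg_of_abs_eq ga with a1 | a1 <;>
      rcases eq_or_eq_neg_of_abs_eq gd with d1 | d1 <;> rw [a1, d1]
    · exact ⟨1, one_mem _, by simp⟩
    · exact ⟨-1 * reflGL, mul_mem h1 h2, by simp [reflGL]⟩
    · exact ⟨reflGL, h2, by simp [reflGL]⟩
    · exact ⟨-1, h1, by simp⟩
  have : A = shearGL ![1, 0] (m * 2) * R := by
    ext i j
    fin_cases i <;> fin_cases j <;>
      simp [shearGL, Matrix.mul_apply, r00, r01, r10, r11, h, hm]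
  rw [this]
  exact mul_mem (shear_horizontal_mem c m) hR

/-- Suppose `A` maps `(1, 0)` to `a (1, 1)`. The inverse maps `(1, 1)` to a horizontal saddle
vector, of length `1 / |a| ≥ 2`, so `|a| < 1`. Among the images of the saddle vectors `(1 + 2n, 1)`,
whose abscissas are spaced by `2a`, one has abscissa at most `|a| < 1` in absolute value, a
contradiction. -/
theorem snd_ne_fst_of_veech (hc : 1 ≤ c) (hA : A ∈ VeechGroup c) : A 1 0 ≠ A 0 0 := by
  intro h
  have e00 := congrFun (congrFun (GL_inv_mul A) 0) 0
  have e10 := congrFun (congrFun (GL_inv_mul A) 1) 0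
  simp only [Matrix.mul_apply, Fin.sum_univ_two, h, Matrix.one_apply_eq] at e00 e10
  rw [← add_mul] at e00 e10
  simp only [ne_eq, one_ne_zero, not_false_eq_true, Matrix.one_apply_ne] at e10
  have ha0 : A 0 0 ≠ 0 := by intro h0; rw [h0, mul_zero] at e00; exact zero_ne_one e00
  have h1 : A⁻¹ 1 0 + A⁻¹ 1 1 = 0 := (mul_eq_zero.1 e10).resolve_right ha0
  obtain ⟨σ, hσ⟩ := holonomy_map hc (inv_mem hA) (one_one_mem_holonomy hc)
  have h2 := hσ.two_le_abs_fst hc (by simpa [mulVec_snd] using h1)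
  simp only [mulVec_fst, Matrix.cons_val_zero, Matrix.cons_val_one, mul_one] at h2
  have h3 : |A⁻¹ 0 0 + A⁻¹ 0 1| * |A 0 0| = 1 := by rw [← abs_mul, e00, abs_one]
  have h4 : |A 0 0| < 1 := by nlinarith [abs_pos.2 ha0]
  obtain ⟨n, hn⟩ := exists_abs_add_mul_le (A 0 0 + A 0 1) (mul_ne_zero two_ne_zero ha0)
  have h5 := one_le_abs_fst hc (holonomy_map hc hA
    (holonomy_map hc (generated_le hc (shear_horizontal_mem c n)) (one_one_mem_holonomy hc)))
  rw [shear_horizontal_mulVec] at h5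
  simp only [mulVec_fst, Matrix.cons_val_zero, Matrix.cons_val_one, mul_one] at h5
  rw [abs_mul, abs_two] at hn
  have e : A 0 0 * (1 + n * 2) + A 0 1 = A 0 0 + A 0 1 + n * (2 * A 0 0) := by ring
  rw [e] at h5
  linarith

/-- The Veech group is generated by the derivatives of the four automorphisms. -/
theorem veechGroup_le (hc : 1 ≤ c) : VeechGroup c ≤ generated c := by
  intro A hA
  obtain ⟨g, hg, h⟩ := exists_reduction hc (holonomy_map hc hA (two_zero_mem_holonomy hc))
  have hB := mul_mem (generated_le hc hg) hA
  rw [Matrix.mulVec_mulVec, ← Units.val_mul, mulVec_fst, mulVec_snd] at h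
  simp only [Matrix.cons_val_zero, Matrix.cons_val_one, mul_zero, add_zero] at h
  have key : g * A ∈ generated c := by
    rcases h with h | h
    · exact mem_generated_of_horizontal hc hB (by simpa using h)
    · exact absurd (mul_right_cancel₀ two_ne_zero h) (snd_ne_fst_of_veech hc hB)
  exact (Subgroup.mul_mem_cancel_left _ hg).1 key

end Veech

/-! ### From the Veech group to the automorphism group -/

theorem derivative_val {c : ℝ} (hc : 1 ≤ c) {f : Surface c ≃ₜ Surface c} {A : GL (Fin 2) ℝ}
    (hf : HasDerivative f A) : (derivative hc ⟨f, A, hf⟩ : GL (Fin 2) ℝ) = A :=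
  (derivative_spec hc ⟨f, A, hf⟩).unique hc hf

theorem ker_derivative {c : ℝ} (hc : 1 ≤ c) : (derivative hc).ker = ⊥ := by
  refine (Subgroup.eq_bot_iff_forall _).2 fun f hf => ?_
  have h := derivative_spec hc f
  rw [MonoidHom.mem_ker.1 hf] at h
  exact Subtype.ext (h.eq_one hc)

/-- A set of automorphisms generates the automorphism group if its derivatives generate the
Veech group. -/
theorem closure_eq_top {c : ℝ} (hc : 1 ≤ c) {s : Set (Aut c)}
    (hs : VeechGroup c ≤ Subgroup.closure ((fun f => (derivative hc f : GL (Fin 2) ℝ)) '' s)) :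
    Subgroup.closure s = ⊤ := by
  let φ : Aut c →* GL (Fin 2) ℝ := (VeechGroup c).subtype.comp (derivative hc)
  have hφ : Function.Injective φ :=
    Subtype.val_injective.comp ((MonoidHom.ker_eq_bot_iff _).1 (ker_derivative hc))
  refine (Subgroup.eq_top_iff' _).2 fun f => ?_
  have : φ f ∈ (Subgroup.closure s).map φ := by
    rw [MonoidHom.map_closure]
    exact hs (derivative hc f).2
  obtain ⟨g, hg, e⟩ := this
  rwa [← hφ e]

end HooperSurface

theorem mainTheorem3 (c : ℝ) (hc : 1 ≤ c) :
    (HooperSurface.derivative hc).ker = ⊥ ∧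
    ∃ negI A D E : HooperSurface.Aut c,
      HooperSurface.IsPieceSwap negI.1 ∧
      HooperSurface.IsReflection A.1 ∧
      HooperSurface.IsRightTwist ![1, 0] D.1 ∧
      HooperSurface.IsRightTwist ![1, 1] E.1 ∧
      Subgroup.closure {negI, A, D, E} = ⊤ := by
  open HooperSurface in
  have hD := (horizontal hc).twist_hasDerivative hc 1
  have hE := (diagonal hc).twist_hasDerivative hc 1
  refine ⟨ker_derivative hc, ⟨_, _, rotation_hasDerivative hc⟩, ⟨_, _, reflection_hasDerivative hc⟩,
    ⟨_, _, hD⟩, ⟨_, _, hE⟩, isPieceSwap_rotation c, isReflection_reflection hc,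
    (horizontal hc).isRightTwist hc, (diagonal hc).isRightTwist hc, closure_eq_top hc ?_⟩
  rw [image_insert_eq, image_insert_eq, image_insert_eq, image_singleton,
    derivative_val hc (rotation_hasDerivative hc), derivative_val hc (reflection_hasDerivative hc),
    derivative_val hc hD, derivative_val hc hE]
  simpa [generated] using veechGroup_le hc
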